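/- **Setting.** Let $T>0$, $b\in(0,1]$, $\alpha\in(0,1]$, $c\in(0,2^{\alpha-1})$, $\lambda>(\alpha-1)/T$, and for $n\in\mathbb N$ put $f_n(x)=c\,e^{-\lambda x/n}x^{\alpha-1}$ and $N=\lfloor nT\rfloor$. For a finite set $B=\{i_0<i_1<\dots<i_k\}\subset\mathbb N$ let $L_n(B)=\prod_{j=1}^k f_n(i_j-i_{j-1})$ (so $L_n(B)=1$ if $|B|=1$) and $L_n(\emptyset)=1/(b f_n(N))$; for disjoint finite sets $B,F$ let $D_n(B,F)=\sum_{F'\subset F}(-1)^{|F'|}L_n(B\cup F')$. For all sufficiently large $n$ let $\xi^{(n)}_1,\dots,\xi^{(n)}_N$ be a generalized Bernoulli process with function $f_n$, i.e. $\{0,1\}$-valued random variables on a probability space (which may depend on $n$) with $$P\big(\xi^{(n)}_i=1\ (i\in B),\ \xi^{(n)}_i=0\ (i\in F)\big)=b f_n(N)\,D_n(B,F)$$ for all disjoint $B,F\subset\{1,\dots,N\}$. Let $X=(X_t)_{0\le t\le T}$ be a random element of the space $D[0,T]$ of càdlàg functions with the Skorokhod $J_1$ topology such that the random walks $X^{(n)}_t=n^{-\alpha}\sum_{i=1}^{\lfloor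 nt\rfloor}\xi^{(n)}_i$ converge weakly to $X$ in $D[0,T]$ as $n\to\infty$. Put $a_T=cb\,e^{-\lambda T}T^{\alpha-1}$, $\nu=c\,\Gamma(\alpha)$ and $\nabla X_t=X_t-X_{t-d}$ for $d>0$. Below, $u\sim v$ as $d\downarrow0$ means $u/v\to1$. **Claim.** (i) For $0<t\le T$ all moments of $X_t$ are finite, $E(X_t)=t\,a_T$, and for $k\ge2$ $$E(X_t^k)=t^{\alpha(k-1)+1}\,\frac{a_T\,k!\,\nu^{k-1}}{\Gamma((k-1)\alpha)}\int_0^1\!\int_0^x e^{-\lambda ty}y^{\alpha(k-1)-1}\,dy\,dx .$$ (ii) For $0<t<s\le T$ the product $X_tX_s$ is integrable, $$E(X_tX_s)=s^{\alpha+1}c\,a_T\int_{t/s}^1\!\int_0^{t/s}(x_2-x_1)^{\alpha-1}e^{-\lambda s(x_2-x_1)}\,dx_1\,dx_2+t^{\alpha+1}\,2c\,a_T\int_0^1\!\int_0^x e^{-\lambda ty}y^{\alpha-1}\,dy\,dx ,$$ and $\mathrm{cov}(X_t,X_s)$ equals the same expression minus $ts\,a_T^2$. (iii) For $s,t>0$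 with $s+t\le T$, as $d\downarrow0$, $$E(\nabla X_s\nabla X_{s+t})\sim a_Tc\,d^2e^{-\lambda t}t^{\alpha-1},$$ $$\mathrm{cov}(\nabla X_s,\nabla X_{s+t})\sim a_Tc\,d^2\big(e^{-\lambda t}t^{\alpha-1}-b e^{-\lambda T}T^{\alpha-1}\big),$$ $$\mathrm{corr}(\nabla X_s,\nabla X_{s+t})\sim\frac{e^{-\lambda t}t^{\alpha-1}-b e^{-\lambda T}T^{\alpha-1}}{\frac{2}{\alpha(\alpha+1)}d^{\alpha-1}-b e^{-\lambda T}T^{\alpha-1}} .$$ (iv) For every integer $m\ge1$, all $0<t_1<t_2<\dots<t_m\le T$ and all integers $k_1,\dots,k_m\ge1$, $$\lim_{d\downarrow0}\frac{E\big(\prod_{i=1}^m(\nabla X_{t_i})^{k_i}\big)}{\prod_{i=1}^mE\big((\nabla X_{t_i})^{k_i}\big)}=e^{-\lambda(t_m-t_1)}\Big(\frac{c}{a_T}\Big)^{m-1}\prod_{i=2}^m(t_i-t_{i-1})^{\alpha-1}.$$ -/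

import Mathlib

open Filter Topology MeasureTheory ProbabilityTheory Set
open scoped ENNReal

/-! ### The Skorokhod space `D[0,T]` with the `J₁` topology -/

/-- The space `D[0,T]` of real càdlàg functions on `[0,T]`: right-continuous with left limits. -/
structure SkorokhodSpace (T : ℝ) where
  toFun : Icc (0 : ℝ) T → ℝ
  right_continuous : ∀ t, ContinuousWithinAt toFun (Ici t) t
  left_limit : ∀ t, ∃ l : ℝ, Tendsto toFun (𝓝[<] t) (𝓝 l)

namespace SkorokhodSpace

/-- The value `x(t)` of a path at a real time `t ∈ [0,T]`
(with the value `0` outside `[0,T]`, which is never used). -/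
noncomputable def eval {T : ℝ} (x : SkorokhodSpace T) (t : ℝ) : ℝ :=
  open Classical in if h : t ∈ Icc (0 : ℝ) T then x.toFun ⟨t, h⟩ else 0

/-- The cost of matching `x` with `y` through the increasing bijection `e` of `[0,T]` onto itself:
`max (sup_t |e(t) - t|) (sup_t |x(e(t)) - y(t)|)`. -/
noncomputable def cost {T : ℝ} (x y : SkorokhodSpace T) (e : Icc (0 : ℝ) T ≃o Icc (0 : ℝ) T) :
    ℝ≥0∞ :=
  max (⨆ t, edist (e t) t) (⨆ t, edist (x.toFun (e t)) (y.toFun t))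

lemma cost_refl {T : ℝ} (x : SkorokhodSpace T) : cost x x (OrderIso.refl _) = 0 := by
  simp [cost]

lemma cost_symm {T : ℝ} (x y : SkorokhodSpace T) (e : Icc (0 : ℝ) T ≃o Icc (0 : ℝ) T) :
    cost y x e.symm = cost x y e := by
  unfold cost
  congr 1
  · rw [← e.toEquiv.iSup_comp]
    exact iSup_congr fun t => by simp [edist_comm]
  · rw [← e.toEquiv.iSup_comp]
    exact iSup_congr fun t => by simp [edist_comm]

lemma cost_trans {T : ℝ} (x y z : SkorokhodSpace T) (e f : Icc (0 : ℝ) T ≃o Icc (0 : ℝ) T) :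
    cost x z (f.trans e) ≤ cost x y e + cost y z f := by
  unfold cost
  refine max_le (iSup_le fun t => ?_) (iSup_le fun t => ?_)
  · refine (edist_triangle _ (f t) _).trans (add_le_add ?_ ?_)
    · exact (le_iSup (fun s => edist (e s) s) (f t)).trans (le_max_left _ _)
    · exact (le_iSup (fun s => edist (f s) s) t).trans (le_max_left _ _)
  · refine (edist_triangle _ (y.toFun (f t)) _).trans (add_le_add ?_ ?_)
    · exact (le_iSup (fun s => edist (x.toFun (e s)) (y.toFun s)) (f t)).trans (le_max_right _ _)
    · exact (le_iSup (fun s => edist (y.toFun (f s)) (z.toFun s)) t).trans (le_max_right _ _)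

/-- Skorokhod's metric
`d(x,y) = inf_e max (sup_t |e(t) - t|) (sup_t |x(e(t)) - y(t)|)`, where `e` runs over the
increasing bijections of `[0,T]` onto itself; its topology is the `J₁` topology. -/
noncomputable instance {T : ℝ} : PseudoEMetricSpace (SkorokhodSpace T) where
  edist x y := ⨅ e : Icc (0 : ℝ) T ≃o Icc (0 : ℝ) T, cost x y e
  edist_self x := le_antisymm ((iInf_le _ (OrderIso.refl _)).trans (cost_refl x).le) zero_le
  edist_comm x y := by
    refine le_antisymm (le_iInf fun e => ?_) (le_iInf fun e => ?_)
    · exact (iInf_le _ e.symm).trans (cost_symm y x e).le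
    · exact (iInf_le _ e.symm).trans (cost_symm x y e).le
  edist_triangle x y z := by
    refine ENNReal.le_iInf_add_iInf fun e f => ?_
    exact (iInf_le _ (f.trans e)).trans (cost_trans x y z e f)

/-- `D[0,T]` carries the Borel σ-algebra of the `J₁` topology. -/
noncomputable instance {T : ℝ} : MeasurableSpace (SkorokhodSpace T) := borel _

instance {T : ℝ} : BorelSpace (SkorokhodSpace T) := ⟨rfl⟩

/-- The step function `t ↦ S(⌊n t⌋)` as an element of `D[0,T]`. -/
noncomputable def step (T : ℝ) (n : ℕ) (S : ℕ → ℝ) : SkorokhodSpace T where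
  toFun t := S ⌊(n : ℝ) * t.1⌋₊
  right_continuous t := by
    have h1 : Tendsto (fun s : Icc (0 : ℝ) T => (n : ℝ) * s.1) (𝓝[≥] t) (𝓝[≥] ((n : ℝ) * t.1)) := by
      refine tendsto_nhdsWithin_iff.2 ⟨?_, ?_⟩
      · exact (by fun_prop : Continuous fun s : Icc (0 : ℝ) T => (n : ℝ) * s.1).continuousWithinAt
      · filter_upwards [self_mem_nhdsWithin] with s hs
        exact mul_le_mul_of_nonneg_left (show t.1 ≤ s.1 from hs) n.cast_nonneg
    have h2 := (tendsto_floor_right_pure_floor ((n : ℝ) * t.1)).comp h1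
    refine tendsto_nhds_of_eventually_eq ?_
    filter_upwards [tendsto_pure.1 h2] with s hs
    have : ⌊(n : ℝ) * s.1⌋ = ⌊(n : ℝ) * t.1⌋ := hs
    rw [← Int.floor_toNat, ← Int.floor_toNat, this]
  left_limit t := by
    rcases Nat.eq_zero_or_pos n with rfl | hn
    · exact ⟨S 0, by simpa using tendsto_const_nhds⟩
    have h1 : Tendsto (fun s : Icc (0 : ℝ) T => (n : ℝ) * s.1) (𝓝[<] t) (𝓝[<] ((n : ℝ) * t.1)) := by
      refine tendsto_nhdsWithin_iff.2 ⟨?_, ?_⟩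
      · exact (by fun_prop : Continuous fun s : Icc (0 : ℝ) T => (n : ℝ) * s.1).continuousWithinAt
      · filter_upwards [self_mem_nhdsWithin] with s hs
        exact mul_lt_mul_of_pos_left (show s.1 < t.1 from hs) (by exact_mod_cast hn)
    have h2 := (tendsto_floor_left_pure_ceil_sub_one ((n : ℝ) * t.1)).comp h1
    refine ⟨S (⌈(n : ℝ) * t.1⌉ - 1).toNat, tendsto_nhds_of_eventually_eq ?_⟩
    filter_upwards [tendsto_pure.1 h2] with s hs
    have : ⌊(n : ℝ) * s.1⌋ = ⌈(n : ℝ) * t.1⌉ - 1 := hs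
    rw [← Int.floor_toNat, this]

end SkorokhodSpace

/-! ### The generalized Bernoulli process -/

namespace GBP

/-- `∏ⱼ f(iⱼ - iⱼ₋₁)` over the consecutive entries of an increasing list `i₀, i₁, …, iₖ`. -/
noncomputable def gapProd (f : ℕ → ℝ) : List ℕ → ℝ
  | [] => 1
  | [_] => 1
  | i :: j :: l => f (j - i) * gapProd f (j :: l)

/-- `L(B) = ∏ⱼ f(iⱼ - iⱼ₋₁)` for `B = {i₀ < i₁ < ⋯ < iₖ}`, with `L(∅) = 1 / (b f(N))`. -/
noncomputable def L (f : ℕ → ℝ) (b : ℝ) (N : ℕ) (B : Finset ℕ) : ℝ :=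
  if B = ∅ then 1 / (b * f N) else gapProd f (B.sort (· ≤ ·))

/-- `D(B,F) = ∑_{F' ⊆ F} (-1)^{|F'|} L(B ∪ F')`. -/
noncomputable def D (f : ℕ → ℝ) (b : ℝ) (N : ℕ) (B F : Finset ℕ) : ℝ :=
  ∑ F' ∈ F.powerset, (-1) ^ F'.card * L f b N (B ∪ F')

/-- `ξ₁, …, ξ_N` (with `N ≥ 1`) are `0`-`1`-valued random variables on `(Ω, P)` that form a
generalized Bernoulli process: for disjoint `B, F ⊆ {1, …, N}`,
`P(ξᵢ = 1 for i ∈ B, ξᵢ = 0 for i ∈ F) = b f(N) D(B,F)`. -/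
structure IsGBP {Ω : Type*} [MeasurableSpace Ω] (f : ℕ → ℝ) (b : ℝ) (N : ℕ)
    (ξ : ℕ → Ω → ℝ) (P : Measure Ω) : Prop where
  measurable : ∀ i ∈ Finset.Icc 1 N, Measurable (ξ i)
  binary : ∀ i ∈ Finset.Icc 1 N, ∀ ω, ξ i ω = 0 ∨ ξ i ω = 1
  prob : ∀ B F : Finset ℕ, B ⊆ Finset.Icc 1 N → F ⊆ Finset.Icc 1 N → Disjoint B F →
    P.real {ω | (∀ i ∈ B, ξ i ω = 1) ∧ (∀ i ∈ F, ξ i ω = 0)} = b * f N * D f b N B F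

/-- The tempered power function `fₙ(x) = c e^{-λ x / n} x^{α - 1}`. -/
noncomputable def tempered (c lam α : ℝ) (n x : ℕ) : ℝ :=
  c * Real.exp (-lam * x / n) * (x : ℝ) ^ (α - 1)

/-- The scaled random walk `t ↦ n^{-α} ∑_{i=1}^{⌊n t⌋} ξᵢ` as an element of `D[0,T]`. -/
noncomputable def walk {Ω : Type*} (α T : ℝ) (n : ℕ) (ξ : ℕ → Ω → ℝ) (ω : Ω) :
    SkorokhodSpace T :=
  SkorokhodSpace.step T n fun k => (∑ i ∈ Finset.Icc 1 k, ξ i ω) / (n : ℝ) ^ α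

/-- The constant `a_T = c b e^{-λ T} T^{α - 1}`. -/
noncomputable def aT (α b c lam T : ℝ) : ℝ := c * b * Real.exp (-lam * T) * T ^ (α - 1)

/-- The constant `ν = c Γ(α)`. -/
noncomputable def nu (α c : ℝ) : ℝ := c * Real.Gamma α

/-- The random variable `X_t`. -/
noncomputable def at_ {Ω : Type*} {T : ℝ} (X : Ω → SkorokhodSpace T) (t : ℝ) (ω : Ω) : ℝ :=
  (X ω).eval t

/-- The increment `∇X_t = X_t - X_{t-d}`. -/
noncomputable def incr {Ω : Type*} {T : ℝ} (X : Ω → SkorokhodSpace T) (d t : ℝ) (ω : Ω) : ℝ :=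
  at_ X t ω - at_ X (t - d) ω

/-- The correlation coefficient of two real random variables. -/
noncomputable def corr {Ω : Type*} [MeasurableSpace Ω] (Y Z : Ω → ℝ) (P : Measure Ω) : ℝ :=
  cov[Y, Z; P] / (Real.sqrt Var[Y; P] * Real.sqrt Var[Z; P])

end GBP

/-!
# Moments of the scaling limit of tempered generalized Bernoulli processes

All four parts follow from one formula for the limit `X`. With the kernel
`g(u) = c e^{-λu} u^{α-1}`, for intervals `(u₁, v₁], …, (u_m, v_m]` in increasing order the mixed
moment `E ∏ (X_{v_r} - X_{u_r})^{k_r}` equals `∏ k_r! · a_T` times the integral of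
`g(y₂ - y₁) g(y₃ - y₂) ⋯` over increasing tuples of points, `k_r` of them in the `r`-th interval
(`GBP.integral_prod_incr`).

*Moments of the walk.* Taking `F = ∅` in the definition of the process,
`E ∏_{i ∈ B} ξᵢ = b f(N) L(B)`, and `L` is multiplicative along the gaps of `B`. A product of
binomial coefficients of the numbers of ones in ordered blocks is a sum over increasing chains of
indices (`GBP.chainSum_flat`), so its expectation is a nested sum of the weights `f(j - i)`
(`GBP.IsGBP.integral_chainSum`). After rescaling, these nested sums are integrals of step
functions, and dominated convergence turns them into the iterated integrals
(`GBP.tendsto_chainSum`). Powers differ from falling factorials by terms of lower order, which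
disappear under the scaling (`GBP.tendsto_walk_moment`).

*Passage to `X`.* Evaluation at a time `t` is not continuous for the `J₁` topology. The infimal
convolution `inf_s (|x(s)| + K |s - u|)` is, and for nondecreasing paths it approximates `x(t)`
with an error controlled by a short increment and by `x(T)`. The set of nondecreasing paths is
closed, so `X` has such paths almost surely; bounded moments and small mean square increments of
the walks then give convergence of mixed moments at every time, without knowing beforehand that
`X` has no fixed discontinuities (`tendsto_integral_prod_incr`).

*Closed forms.* By the beta integral the convolution powers of `g` are again tempered power
functions (`GBP.integral_kern_mul_kern`), which evaluates the integrals over a single interval.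

*Short increments.* The condition `λ > (α - 1)/T` makes `g` strictly decreasing on `(0, T]`.
Replacing every gap between points of consecutive short blocks by its largest or smallest value
therefore bounds the mixed moment from both sides by products of one-block moments
(`GBP.HasIncrementMoments.ratio_mem_Icc`), and the bounds have the same limit because `g` is
continuous away from `0`. The strict decrease together with `b ≤ 1` keeps the leading coefficient
of the covariance positive.
-/

/-! ### Continuous functionals on the Skorokhod space -/

namespace SkorokhodSpace

variable {T : ℝ}

/-- The value `x(t)` of a path, extended to all real times by freezing it outside `[0,T]`:
it equals `x(0)` for `t ≤ 0` and `x(T)` for `t ≥ T`. -/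
noncomputable def clamp (hT : 0 ≤ T) (x : SkorokhodSpace T) (t : ℝ) : ℝ :=
  x.toFun (projIcc 0 T hT t)

lemma eval_eq_clamp (hT : 0 ≤ T) (x : SkorokhodSpace T) {t : ℝ} (ht : t ∈ Icc 0 T) :
    x.eval t = clamp hT x t := by
  rw [eval, dif_pos ht, clamp, projIcc_of_mem hT ht]

lemma clamp_of_le (hT : 0 ≤ T) (x : SkorokhodSpace T) {t : ℝ} (ht : t ≤ 0) :
    clamp hT x t = clamp hT x 0 := by
  rw [clamp, clamp, projIcc_of_le_left hT ht, projIcc_of_le_left hT le_rfl]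

lemma clamp_of_ge (hT : 0 ≤ T) (x : SkorokhodSpace T) {t : ℝ} (ht : T ≤ t) :
    clamp hT x t = clamp hT x T := by
  rw [clamp, clamp, projIcc_of_right_le hT ht, projIcc_of_right_le hT le_rfl]

lemma clamp_right_continuous (hT : 0 ≤ T) (x : SkorokhodSpace T) (t : ℝ) :
    ContinuousWithinAt (clamp hT x) (Ici t) t := by
  refine (x.right_continuous (projIcc 0 T hT t)).comp continuous_projIcc.continuousWithinAt ?_
  intro s hs
  exact monotone_projIcc hT hs

/-- Two paths at Skorokhod distance less than `δ` are matched within `δ` by an increasing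
time change of the whole real line. -/
lemma exists_timeChange (hT : 0 ≤ T) {x y : SkorokhodSpace T} {δ : ℝ} (hδ : 0 < δ)
    (h : edist x y < ENNReal.ofReal δ) :
    ∃ τ : ℝ → ℝ, Monotone τ ∧ ∀ s, |τ s - s| ≤ δ ∧ |clamp hT x (τ s) - clamp hT y s| ≤ δ := by
  obtain ⟨e, he⟩ := iInf_lt_iff.1 (show (⨅ e, cost x y e) < _ from h)
  have h1 : ∀ s, |((e s : ℝ)) - s| ≤ δ := fun s => by
    have := ((le_iSup (fun t => edist (e t) t) s).trans (le_max_left _ _)).trans he.le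
    rw [edist_dist, ENNReal.ofReal_le_ofReal_iff hδ.le] at this
    rwa [Subtype.dist_eq, Real.dist_eq] at this
  have h2 : ∀ s, |x.toFun (e s) - y.toFun s| ≤ δ := fun s => by
    have := ((le_iSup (fun t => edist (x.toFun (e t)) (y.toFun t)) s).trans
      (le_max_right _ _)).trans he.le
    rw [edist_dist, ENNReal.ofReal_le_ofReal_iff hδ.le] at this
    rwa [Real.dist_eq] at this
  set p := projIcc 0 T hT with hp
  refine ⟨fun s => e (p s) + (s - p s), ?_, fun s => ⟨?_, ?_⟩⟩
  · intro s t hst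
    have ha : (e (p s) : ℝ) ≤ e (p t) := e.monotone (monotone_projIcc hT hst)
    have hb : s - (p s : ℝ) ≤ t - p t := by
      simp only [hp, coe_projIcc]
      rcases max_cases 0 (min T s) with h | h <;> rcases max_cases 0 (min T t) with h' | h' <;>
      rcases min_cases T s with h'' | h'' <;> rcases min_cases T t with h''' | h''' <;> linarith
    simp only; linarith
  · have := h1 (p s)
    simpa [abs_le] using (by rw [abs_le] at this; constructor <;> linarith :
      -δ ≤ (e (p s) : ℝ) + (s - p s) - s ∧ (e (p s) : ℝ) + (s - p s) - s ≤ δ)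
  · have key : p ((e (p s) : ℝ) + (s - p s)) = e (p s) := by
      rcases le_total s 0 with hs | hs
      · have h0 : p s = ⟨0, left_mem_Icc.2 hT⟩ := projIcc_of_le_left hT hs
        have : e ⟨0, left_mem_Icc.2 hT⟩ = ⟨0, left_mem_Icc.2 hT⟩ := by
          apply le_antisymm
          · rw [← e.le_symm_apply]
            exact Subtype.mk_le_mk.2 (e.symm _).2.1
          · exact Subtype.mk_le_mk.2 (e _).2.1
        rw [h0, this]
        exact projIcc_of_le_left hT (by simpa using hs)
      rcases le_total T s with hs' | hs'
      · have h0 : p s = ⟨T, right_mem_Icc.2 hT⟩ := projIcc_of_right_le hT hs'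
        have : e ⟨T, right_mem_Icc.2 hT⟩ = ⟨T, right_mem_Icc.2 hT⟩ := by
          apply le_antisymm
          · exact Subtype.mk_le_mk.2 (e _).2.2
          · rw [← e.symm_apply_le]
            exact Subtype.mk_le_mk.2 (e.symm _).2.2
        rw [h0, this]
        exact projIcc_of_right_le hT (by simpa using hs')
      · have h0 : p s = ⟨s, hs, hs'⟩ := projIcc_of_mem hT ⟨hs, hs'⟩
        rw [h0]
        simp [hp]
    simp only [clamp]
    rw [← hp, key]
    exact h2 _

/-- A real function on the Skorokhod space that is Lipschitz in the form given by matching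
paths within `δ` is continuous. -/
lemma continuous_of_near {F : SkorokhodSpace T → ℝ} (C : ℝ)
    (h : ∀ x y, ∀ δ : ℝ, 0 < δ → edist x y < ENNReal.ofReal δ → F x ≤ F y + C * δ) :
    Continuous F := by
  have hC : ∀ δ, 0 < δ → C * δ ≤ (|C| + 1) * δ := fun δ hδ => by nlinarith [le_abs_self C]
  rw [EMetric.continuous_iff]
  intro y ε hε
  by_cases htop : ε = ⊤
  · exact ⟨1, one_pos, fun x _ => by rw [htop]; exact edist_lt_top _ _⟩
  obtain ⟨η, hη, rfl⟩ : ∃ η : ℝ, 0 < η ∧ ε = ENNReal.ofReal η :=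
    ⟨ε.toReal, ENNReal.toReal_pos hε.ne' htop, (ENNReal.ofReal_toReal htop).symm⟩
  have hC1 : 0 < |C| + 1 := by positivity
  have hδ : 0 < η / (2 * (|C| + 1)) := by positivity
  refine ⟨ENNReal.ofReal (η / (2 * (|C| + 1))), by simpa using hδ, fun x hx => ?_⟩
  have e1 := h x y _ hδ hx
  have e2 := h y x _ hδ (by rwa [edist_comm])
  have e3 := hC _ hδ
  have e4 : (|C| + 1) * (η / (2 * (|C| + 1))) = η / 2 := by field_simp
  rw [edist_dist, ENNReal.ofReal_lt_ofReal_iff hη, Real.dist_eq, abs_lt]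
  constructor <;> linarith

lemma continuous_clamp_of_ge (hT : 0 ≤ T) {t : ℝ} (ht : T ≤ t) :
    Continuous fun x : SkorokhodSpace T => clamp hT x t := by
  refine continuous_of_near 1 fun x y δ hδ h => ?_
  obtain ⟨τ, -, hτ⟩ := exists_timeChange hT hδ h
  obtain ⟨h1, h2⟩ := hτ (t + δ)
  rw [abs_le] at h1 h2
  rw [clamp_of_ge hT x (by linarith), clamp_of_ge hT y (by linarith)] at h2
  rw [clamp_of_ge hT x ht, clamp_of_ge hT y ht]
  linarith

lemma continuous_clamp_of_le (hT : 0 ≤ T) {t : ℝ} (ht : t ≤ 0) :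
    Continuous fun x : SkorokhodSpace T => clamp hT x t := by
  refine continuous_of_near 1 fun x y δ hδ h => ?_
  obtain ⟨τ, -, hτ⟩ := exists_timeChange hT hδ h
  obtain ⟨h1, h2⟩ := hτ (t - δ)
  rw [abs_le] at h1 h2
  rw [clamp_of_le hT x (by linarith), clamp_of_le hT y (by linarith)] at h2
  rw [clamp_of_le hT x ht, clamp_of_le hT y ht]
  linarith

/-- The infimal convolution `inf_s (|x(s)| + K |s - u|)` of a path with a cone at time `u`.
Unlike evaluation at `u` it is Lipschitz for the Skorokhod metric. -/
noncomputable def infConv (hT : 0 ≤ T) (K u : ℝ) (x : SkorokhodSpace T) : ℝ :=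
  ⨅ s : ℝ, (|clamp hT x s| + K * |s - u|)

lemma infConv_bddBelow (hT : 0 ≤ T) {K : ℝ} (hK : 0 ≤ K) (u : ℝ) (x : SkorokhodSpace T) :
    BddBelow (range fun s : ℝ => |clamp hT x s| + K * |s - u|) :=
  ⟨0, by rintro _ ⟨s, rfl⟩; positivity⟩

lemma infConv_nonneg (hT : 0 ≤ T) {K : ℝ} (hK : 0 ≤ K) (u : ℝ) (x : SkorokhodSpace T) :
    0 ≤ infConv hT K u x :=
  le_ciInf fun s => by positivity

lemma infConv_le (hT : 0 ≤ T) {K : ℝ} (hK : 0 ≤ K) (u : ℝ) (x : SkorokhodSpace T) :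
    infConv hT K u x ≤ |clamp hT x u| := by
  simpa [infConv] using ciInf_le (infConv_bddBelow hT hK u x) u

lemma continuous_infConv (hT : 0 ≤ T) {K : ℝ} (hK : 0 ≤ K) (u : ℝ) :
    Continuous (infConv hT K u : SkorokhodSpace T → ℝ) := by
  refine continuous_of_near (1 + K) fun x y δ hδ h => ?_
  obtain ⟨τ, -, hτ⟩ := exists_timeChange hT hδ h
  rw [← sub_le_iff_le_add]
  refine le_ciInf fun s => ?_
  obtain ⟨h1, h2⟩ := hτ s
  have h3 := ciInf_le (infConv_bddBelow hT hK u x) (τ s)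
  have h4 : |clamp hT x (τ s)| ≤ |clamp hT y s| + δ := by
    have := abs_sub_abs_le_abs_sub (clamp hT x (τ s)) (clamp hT y s)
    linarith
  have h5 : |τ s - u| ≤ |s - u| + δ := by
    have := abs_sub_le (τ s) s u
    linarith
  have h6 := mul_le_mul_of_nonneg_left h5 hK
  change infConv hT K u x - _ ≤ _
  unfold infConv
  nlinarith

/-- The set of nondecreasing paths that start at `0`. -/
def incrPaths (hT : 0 ≤ T) : Set (SkorokhodSpace T) :=
  {x | clamp hT x 0 = 0 ∧ Monotone (clamp hT x)}

/-- For `s ≤ t`, monotonicity of a nearby path at the times `τ s ≤ τ t` gives `x(s) ≤ x(t)` up to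
a small error. -/
lemma isClosed_incrPaths (hT : 0 ≤ T) : IsClosed (incrPaths hT) := by
  refine IsClosed.inter (isClosed_eq (continuous_clamp_of_le hT le_rfl) continuous_const) ?_
  refine IsSeqClosed.isClosed ?_
  intro y x hy hyx s t hst
  refine le_of_forall_pos_le_add fun δ hδ => ?_
  have hδ2 : 0 < δ / 2 := by positivity
  obtain ⟨n, hn⟩ :=
    ((EMetric.tendsto_nhds.1 hyx) (ENNReal.ofReal (δ / 2)) (by simpa using hδ2)).exists
  obtain ⟨τ, hτm, hτ⟩ := exists_timeChange hT hδ2 hn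
  have h1 := (abs_le.1 (hτ s).2).1
  have h2 := (abs_le.1 (hτ t).2).2
  have h3 : clamp hT (y n) (τ s) ≤ clamp hT (y n) (τ t) := hy n (hτm hst)
  linarith

lemma clamp_nonneg (hT : 0 ≤ T) {x : SkorokhodSpace T} (hx : x ∈ incrPaths hT) (t : ℝ) :
    0 ≤ clamp hT x t := by
  rcases le_total t 0 with ht | ht
  · rw [clamp_of_le hT x ht, hx.1]
  · rw [← hx.1]; exact hx.2 ht

lemma clamp_le_right (hT : 0 ≤ T) {x : SkorokhodSpace T} (hx : x ∈ incrPaths hT) (t : ℝ) :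
    clamp hT x t ≤ clamp hT x T := by
  rcases le_total t T with ht | ht
  · exact hx.2 ht
  · rw [clamp_of_ge hT x ht]

/-- On nondecreasing paths a narrow infimal convolution centred just to the right of `t`
nearly dominates the value at `t`. -/
lemma min_le_infConv (hT : 0 ≤ T) {x : SkorokhodSpace T} (hx : x ∈ incrPaths hT) {ε : ℝ}
    (hε : 0 < ε) (t : ℝ) : min (clamp hT x t) (1 / ε) ≤ infConv hT (1 / ε ^ 2) (t + ε) x := by
  refine le_ciInf fun s => ?_
  rcases le_total t s with hs | hs
  · refine (min_le_left _ _).trans ((hx.2 hs).trans ((le_abs_self _).trans ?_))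
    have : 0 ≤ 1 / ε ^ 2 * |s - (t + ε)| := by positivity
    linarith
  · refine (min_le_right _ _).trans ?_
    have h1 : ε ≤ |s - (t + ε)| := by
      rw [abs_sub_comm]; exact le_trans (by linarith) (le_abs_self _)
    have h2 : 1 / ε = 1 / ε ^ 2 * ε := by field_simp
    have h3 : 1 / ε ^ 2 * ε ≤ 1 / ε ^ 2 * |s - (t + ε)| := by gcongr
    have := abs_nonneg (clamp hT x s)
    linarith

/-- The error of the infimal convolution is a short increment plus a term that accounts for the
truncation at `1 / ε` in `min_le_infConv`. -/
lemma abs_infConv_sub_le (hT : 0 ≤ T) {x : SkorokhodSpace T} (hx : x ∈ incrPaths hT) {ε : ℝ}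
    (hε : 0 < ε) (t : ℝ) : |infConv hT (1 / ε ^ 2) (t + ε) x - clamp hT x t| ≤
      (clamp hT x (t + ε) - clamp hT x t) + ε * clamp hT x T ^ 2 := by
  have h0 := clamp_nonneg hT hx t
  have hle := clamp_le_right hT hx t
  have h1 := min_le_infConv hT hx hε t
  have h2 := infConv_le hT (show 0 ≤ 1 / ε ^ 2 by positivity) (t + ε) x
  rw [abs_of_nonneg (clamp_nonneg hT hx _)] at h2
  have h3 : clamp hT x t ≤ clamp hT x (t + ε) := hx.2 (by linarith)
  have h4 : clamp hT x t - ε * clamp hT x T ^ 2 ≤ min (clamp hT x t) (1 / ε) := by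
    rw [le_min_iff]
    constructor
    · nlinarith [sq_nonneg (clamp hT x T)]
    · rw [le_div_iff₀ hε]
      nlinarith [sq_nonneg (ε * clamp hT x T - 1), mul_nonneg hε.le (sub_nonneg.2 hle),
        sq_nonneg (ε * clamp hT x T)]
  have h5 : 0 ≤ ε * clamp hT x T ^ 2 := by positivity
  rw [abs_le]
  constructor <;> linarith

/-- For nondecreasing paths the infimal convolutions recover the value at `t`. -/
lemma tendsto_infConv (hT : 0 ≤ T) {x : SkorokhodSpace T} (hx : x ∈ incrPaths hT) (t : ℝ) :
    Tendsto (fun ε : ℝ => infConv hT (1 / ε ^ 2) (t + ε) x) (𝓝[>] 0) (𝓝 (clamp hT x t)) := by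
  have hA : Tendsto (fun ε : ℝ => clamp hT x (t + ε)) (𝓝[>] 0) (𝓝 (clamp hT x t)) := by
    refine (clamp_right_continuous hT x t).tendsto.comp (tendsto_nhdsWithin_iff.2 ⟨?_, ?_⟩)
    · have : Tendsto (fun ε : ℝ => t + ε) (𝓝 0) (𝓝 (t + 0)) := by
        exact (continuous_const.add continuous_id).tendsto 0
      rw [add_zero] at this
      exact this.mono_left nhdsWithin_le_nhds
    · filter_upwards [self_mem_nhdsWithin] with ε hε
      simp only [mem_Ioi] at hε
      simp [hε.le]
  have hB : Tendsto (fun ε : ℝ => (clamp hT x (t + ε) - clamp hT x t) + ε * clamp hT x T ^ 2)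
      (𝓝[>] 0) (𝓝 0) := by
    have h2 : Tendsto (fun ε : ℝ => ε * clamp hT x T ^ 2) (𝓝[>] 0) (𝓝 0) := by
      have : Tendsto (fun ε : ℝ => ε * clamp hT x T ^ 2) (𝓝 0) (𝓝 (0 * clamp hT x T ^ 2)) :=
        tendsto_id.mul_const _
      rw [zero_mul] at this
      exact this.mono_left nhdsWithin_le_nhds
    simpa using (hA.sub_const (clamp hT x t)).add h2
  rw [tendsto_iff_norm_sub_tendsto_zero]
  refine squeeze_zero' (Eventually.of_forall fun _ => norm_nonneg _) ?_ hB
  filter_upwards [self_mem_nhdsWithin] with ε hε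
  exact abs_infConv_sub_le hT hx hε t

lemma clamp_step (hT : 0 ≤ T) (n : ℕ) (S : ℕ → ℝ) (t : ℝ) :
    clamp hT (step T n S) t = S ⌊(n : ℝ) * max 0 (min T t)⌋₊ := by
  simp [clamp, step, coe_projIcc]

end SkorokhodSpace

/-! ### Convergence of moments from convergence in distribution -/

/-- A sequence converges if it is uniformly approximated by sequences whose limits are close to
the target. -/
lemma tendsto_of_forall_approx {a : ℕ → ℝ} {l : ℝ}
    (h : ∀ η > 0, ∃ (b : ℕ → ℝ) (m : ℝ), Tendsto b atTop (𝓝 m) ∧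
      (∀ᶠ n in atTop, |a n - b n| ≤ η) ∧ |m - l| ≤ η) : Tendsto a atTop (𝓝 l) := by
  rw [Metric.tendsto_nhds]
  intro η hη
  obtain ⟨b, m, hb, hab, hm⟩ := h (η / 4) (by positivity)
  filter_upwards [hab, Metric.tendsto_nhds.1 hb (η / 4) (by positivity)] with n h1 h2
  rw [Real.dist_eq] at *
  rw [abs_le] at h1 hm
  rw [abs_lt] at h2 ⊢
  constructor <;> linarith

lemma abs_sub_clip_le (z : ℝ) {R : ℝ} (hR : 0 < R) : |z - max (-R) (min z R)| ≤ z ^ 2 / R := by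
  rw [le_div_iff₀ hR]
  rcases le_total z R with h1 | h1
  · rw [min_eq_left h1]
    rcases le_total (-R) z with h2 | h2
    · rw [max_eq_right h2]; simp; positivity
    · rw [max_eq_left h2, abs_of_nonpos (by linarith)]; nlinarith
  · rw [min_eq_right h1, max_eq_right (by linarith), abs_of_nonneg (by linarith)]
    nlinarith

section Moments

variable {Ω' : ℕ → Type*} [∀ n, MeasurableSpace (Ω' n)] {P' : ∀ n, Measure (Ω' n)}
  [∀ n, IsProbabilityMeasure (P' n)] {Ω : Type*} [MeasurableSpace Ω] {P : Measure Ω}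
  [IsProbabilityMeasure P]

lemma MeasureTheory.TendstoInDistribution.tendsto_integral_bounded {E : Type*} [TopologicalSpace E]
    [MeasurableSpace E] [OpensMeasurableSpace E] {Y : ∀ n, Ω' n → E} {X : Ω → E}
    (h : TendstoInDistribution Y atTop X P' P) {G : E → ℝ} (hG : Continuous G) {C : ℝ}
    (hC : ∀ z, |G z| ≤ C) :
    Tendsto (fun n => ∫ ω, G (Y n ω) ∂P' n) atTop (𝓝 (∫ ω, G (X ω) ∂P)) := by
  have := (ProbabilityMeasure.tendsto_iff_forall_integral_tendsto.1 h.tendsto)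
    (BoundedContinuousFunction.ofNormedAddCommGroup G hG C hC)
  simp only [BoundedContinuousFunction.coe_ofNormedAddCommGroup, ProbabilityMeasure.coe_mk] at this
  rw [integral_map h.aemeasurable_limit hG.measurable.aestronglyMeasurable] at this
  refine this.congr fun n => ?_
  rw [integral_map (h.forall_aemeasurable n) hG.measurable.aestronglyMeasurable]

/-- Convergence in distribution together with bounded second moments gives convergence
of the means. -/
lemma MeasureTheory.TendstoInDistribution.tendsto_integral_real {Y : ∀ n, Ω' n → ℝ} {X : Ω → ℝ}
    (h : TendstoInDistribution Y atTop X P' P) {C : ℝ}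
    (hC : ∀ᶠ n in atTop, Integrable (fun ω => Y n ω ^ 2) (P' n) ∧ ∫ ω, Y n ω ^ 2 ∂P' n ≤ C) :
    Integrable X P ∧ Tendsto (fun n => ∫ ω, Y n ω ∂P' n) atTop (𝓝 (∫ ω, X ω ∂P)) := by
  have hXm := h.aemeasurable_limit
  have hint : ∀ᶠ n in atTop, Integrable (Y n) (P' n) := by
    filter_upwards [hC] with n hn
    exact ((memLp_two_iff_integrable_sq (h.forall_aemeasurable n).aestronglyMeasurable).2
      hn.1).integrable (by norm_num)
  -- Fatou's lemma applied to `min |X| k` gives integrability of the limit.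
  have hX : Integrable X P := by
    have hb : ∀ k : ℕ, ∫ ω, min |X ω| k ∂P ≤ 1 + C := by
      intro k
      have hk : Continuous fun z : ℝ => min |z| (k : ℝ) := by fun_prop
      have hlim := h.tendsto_integral_bounded hk (C := k) (fun z => by
        rw [abs_of_nonneg (by positivity)]; exact min_le_right _ _)
      refine le_of_tendsto hlim ?_
      filter_upwards [hC] with n hn
      calc ∫ ω, min |Y n ω| k ∂P' n ≤ ∫ ω, (1 + Y n ω ^ 2) ∂P' n := by
            refine integral_mono_of_nonneg (Eventually.of_forall fun ω => by positivity)
              ((integrable_const 1).add hn.1) (Eventually.of_forall fun ω => ?_)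
            refine (min_le_left _ _).trans ?_
            simp only
            rw [← sq_abs]; nlinarith [sq_nonneg (|Y n ω| - 1)]
        _ ≤ 1 + C := by
            rw [integral_add (integrable_const 1) hn.1]; simp [hn.2]
    refine ⟨hXm.aestronglyMeasurable, ?_⟩
    have hle : ∫⁻ ω, ‖X ω‖ₑ ∂P ≤ ENNReal.ofReal (1 + C) := by
      have hlim : ∀ ω, Tendsto (fun k : ℕ => ENNReal.ofReal (min |X ω| k)) atTop (𝓝 ‖X ω‖ₑ) := by
        intro ω
        refine tendsto_const_nhds.congr' ?_
        filter_upwards [eventually_ge_atTop ⌈|X ω|⌉₊] with k hk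
        rw [min_eq_left ((Nat.le_ceil _).trans (by exact_mod_cast hk)), ← Real.norm_eq_abs,
          ofReal_norm]
      calc ∫⁻ ω, ‖X ω‖ₑ ∂P = ∫⁻ ω, liminf (fun k : ℕ => ENNReal.ofReal (min |X ω| k)) atTop ∂P :=
            lintegral_congr fun ω => ((hlim ω).liminf_eq).symm
        _ ≤ liminf (fun k : ℕ => ∫⁻ ω, ENNReal.ofReal (min |X ω| k) ∂P) atTop :=
            lintegral_liminf_le' fun k =>
              ((continuous_abs.measurable.comp_aemeasurable hXm).min aemeasurable_const).ennreal_ofReal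
        _ ≤ ENNReal.ofReal (1 + C) := by
            refine liminf_le_of_le (by isBoundedDefault) fun b hb' => ?_
            obtain ⟨k, hk⟩ := hb'.exists
            refine hk.trans ?_
            rw [← ofReal_integral_eq_lintegral_ofReal]
            · exact ENNReal.ofReal_le_ofReal (hb k)
            · refine Integrable.of_bound (C := k)
                ((continuous_abs.measurable.comp_aemeasurable hXm).min
                  aemeasurable_const).aestronglyMeasurable (Eventually.of_forall fun ω => ?_)
              rw [Real.norm_eq_abs, abs_of_nonneg (by positivity)]; exact min_le_right _ _
            · exact Eventually.of_forall fun ω => by positivity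
    exact hle.trans_lt ENNReal.ofReal_lt_top
  refine ⟨hX, tendsto_of_forall_approx fun η hη => ?_⟩
  have hclip : ∀ R : ℝ, 0 < R → ∀ z : ℝ, |max (-R) (min z R)| ≤ R := fun R hR z => by
    rw [abs_le]; exact ⟨le_max_left _ _, max_le (by linarith) (min_le_right _ _)⟩
  have hcont : ∀ R : ℝ, Continuous fun z : ℝ => max (-R) (min z R) := fun R => by fun_prop
  have hlimX : Tendsto (fun R : ℝ => ∫ ω, max (-R) (min (X ω) R) ∂P) atTop (𝓝 (∫ ω, X ω ∂P)) := by
    refine tendsto_integral_filter_of_dominated_convergence (fun ω => |X ω|) ?_ ?_ hX.abs ?_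
    · exact Eventually.of_forall fun R => ((hcont R).measurable.comp_aemeasurable
        hXm).aestronglyMeasurable
    · filter_upwards [eventually_ge_atTop 0] with R hR
      refine Eventually.of_forall fun ω => ?_
      rw [Real.norm_eq_abs, abs_le]
      constructor
      · rcases le_total (X ω) R with h1 | h1
        · rw [min_eq_left h1]; exact (neg_abs_le _).trans (le_max_right _ _)
        · exact le_trans (by linarith [le_abs_self (X ω)]) (le_max_left _ _)
      · refine max_le ((neg_nonpos.2 hR).trans (abs_nonneg _)) ((min_le_left _ _).trans (le_abs_self _))
    · refine Eventually.of_forall fun ω => tendsto_const_nhds.congr' ?_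
      filter_upwards [eventually_ge_atTop |X ω|] with R hR
      rw [min_eq_left ((le_abs_self _).trans hR), max_eq_right (by linarith [neg_abs_le (X ω)])]
  -- Truncation at a level `R ≥ C / η` costs at most `η`, by `abs_sub_clip_le`.
  obtain ⟨R, hR0, hR1, hR2⟩ := ((eventually_gt_atTop (0 : ℝ)).and
    ((eventually_ge_atTop (C / η)).and (Metric.tendsto_nhds.1 hlimX η hη))).exists
  refine ⟨_, _, h.tendsto_integral_bounded (hcont R) (hclip R hR0), ?_, ?_⟩
  · filter_upwards [hC, hint] with n hn hi
    have hci : Integrable (fun ω => max (-R) (min (Y n ω) R)) (P' n) :=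
      Integrable.of_bound (C := R) ((hcont R).measurable.comp_aemeasurable
        (h.forall_aemeasurable n)).aestronglyMeasurable
        (Eventually.of_forall fun ω => hclip R hR0 _)
    rw [← integral_sub hi hci]
    calc |∫ ω, (Y n ω - max (-R) (min (Y n ω) R)) ∂P' n|
        ≤ ∫ ω, |Y n ω - max (-R) (min (Y n ω) R)| ∂P' n := abs_integral_le_integral_abs
      _ ≤ ∫ ω, Y n ω ^ 2 / R ∂P' n := integral_mono (hi.sub hci).abs (hn.1.div_const R)
          fun ω => abs_sub_clip_le _ hR0
      _ ≤ C / R := by rw [integral_div]; gcongr; exact hn.2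
      _ ≤ η := by rw [div_le_iff₀ hR0]; rw [div_le_iff₀ hη] at hR1; linarith
  · rw [Real.dist_eq] at hR2; exact hR2.le

lemma MeasureTheory.TendstoInDistribution.tendsto_integral_of_sq {E : Type*} [TopologicalSpace E]
    [MeasurableSpace E] [OpensMeasurableSpace E] {Y : ∀ n, Ω' n → E} {X : Ω → E}
    (h : TendstoInDistribution Y atTop X P' P) {G : E → ℝ} (hG : Continuous G) {C : ℝ}
    (hC : ∀ᶠ n in atTop, Integrable (fun ω => G (Y n ω) ^ 2) (P' n) ∧
      ∫ ω, G (Y n ω) ^ 2 ∂P' n ≤ C) :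
    Integrable (fun ω => G (X ω)) P ∧
      Tendsto (fun n => ∫ ω, G (Y n ω) ∂P' n) atTop (𝓝 (∫ ω, G (X ω) ∂P)) :=
  (h.continuous_comp hG).tendsto_integral_real hC

lemma abs_pow_sub_pow_le_of_abs_le {a b M : ℝ} (hM : 1 ≤ M) (ha : |a| ≤ M) (hb : |b| ≤ M) (k : ℕ) :
    |a ^ k - b ^ k| ≤ M ^ k * (k * |a - b|) := by
  induction k with
  | zero => simp
  | succ k ih =>
    have e : a ^ (k + 1) - b ^ (k + 1) = a * (a ^ k - b ^ k) + (a - b) * b ^ k := by ring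
    have h2 : |b ^ k| ≤ M ^ k := by rw [abs_pow]; gcongr
    have h3 : M ^ k ≤ M ^ (k + 1) := pow_le_pow_right₀ hM (by omega)
    calc |a ^ (k + 1) - b ^ (k + 1)| ≤ |a| * |a ^ k - b ^ k| + |a - b| * |b ^ k| := by
          rw [e, ← abs_mul, ← abs_mul]; exact abs_add_le _ _
      _ ≤ M * (M ^ k * (k * |a - b|)) + |a - b| * M ^ (k + 1) := by
          gcongr
          exact h2.trans h3
      _ = M ^ (k + 1) * ((k + 1 : ℕ) * |a - b|) := by push_cast; ring

lemma abs_prod_sub_prod_le {ι : Type*} (s : Finset ι) {a b δ : ι → ℝ} {M : ℝ} (hM : 0 ≤ M)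
    (k : ι → ℕ) (ha : ∀ i ∈ s, |a i| ≤ M ^ k i) (hb : ∀ i ∈ s, |b i| ≤ M ^ k i)
    (hab : ∀ i ∈ s, |a i - b i| ≤ M ^ k i * δ i) :
    |∏ i ∈ s, a i - ∏ i ∈ s, b i| ≤ M ^ (∑ i ∈ s, k i) * ∑ i ∈ s, δ i := by
  classical
  induction s using Finset.induction_on with
  | empty => simp
  | insert j s hj ih =>
    rw [Finset.prod_insert hj, Finset.prod_insert hj, Finset.sum_insert hj, Finset.sum_insert hj]
    have ih' := ih (fun i hi => ha i (Finset.mem_insert_of_mem hi))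
      (fun i hi => hb i (Finset.mem_insert_of_mem hi))
      (fun i hi => hab i (Finset.mem_insert_of_mem hi))
    have h1 := hab j (Finset.mem_insert_self _ _)
    have h2 := ha j (Finset.mem_insert_self _ _)
    have h3 : |∏ i ∈ s, b i| ≤ M ^ ∑ i ∈ s, k i := by
      rw [Finset.abs_prod, ← Finset.prod_pow_eq_pow_sum]
      exact Finset.prod_le_prod (fun _ _ => abs_nonneg _) fun i hi =>
        hb i (Finset.mem_insert_of_mem hi)
    set A := ∏ i ∈ s, a i
    set B := ∏ i ∈ s, b i
    calc |a j * A - b j * B| = |a j * (A - B) + (a j - b j) * B| := by ring_nf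
      _ ≤ |a j| * |A - B| + |a j - b j| * |B| := by
          rw [← abs_mul, ← abs_mul]; exact abs_add_le _ _
      _ ≤ M ^ k j * (M ^ (∑ i ∈ s, k i) * ∑ i ∈ s, δ i) +
            M ^ k j * δ j * M ^ ∑ i ∈ s, k i := by
          have := (abs_nonneg _).trans h1
          gcongr
      _ = _ := by rw [pow_add]; ring

lemma abs_prod_pow_sub_prod_pow_le {ι : Type*} (s : Finset ι) {a b : ι → ℝ} {M : ℝ} (hM : 1 ≤ M)
    (k : ι → ℕ) (ha : ∀ i ∈ s, |a i| ≤ M) (hb : ∀ i ∈ s, |b i| ≤ M) :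
    |∏ i ∈ s, a i ^ k i - ∏ i ∈ s, b i ^ k i| ≤
      M ^ (∑ i ∈ s, k i) * ∑ i ∈ s, k i * |a i - b i| := by
  refine abs_prod_sub_prod_le s (by linarith) k (fun i hi => ?_) (fun i hi => ?_)
    fun i hi => abs_pow_sub_pow_le_of_abs_le hM (ha i hi) (hb i hi) (k i)
  · rw [abs_pow]; exact pow_le_pow_left₀ (abs_nonneg _) (ha i hi) _
  · rw [abs_pow]; exact pow_le_pow_left₀ (abs_nonneg _) (hb i hi) _

end Moments

/-! ### Convergence of moments of increments of nondecreasing paths -/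

section PathMoments

open SkorokhodSpace

/-- The value at a fixed time is measurable on nondecreasing paths, as a limit of continuous
functionals. -/
lemma aemeasurable_clamp {T : ℝ} {Ω : Type*} [MeasurableSpace Ω] {P : Measure Ω} (hT : 0 ≤ T)
    {Y : Ω → SkorokhodSpace T} (hY : AEMeasurable Y P)
    (h : ∀ᵐ ω ∂P, Y ω ∈ incrPaths hT) (t : ℝ) : AEMeasurable (fun ω => clamp hT (Y ω) t) P := by
  obtain ⟨ε, -, hε0, hε⟩ := exists_seq_strictAnti_tendsto (0 : ℝ)
  refine aemeasurable_of_tendsto_metrizable_ae atTop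
    (f := fun n ω => infConv hT (1 / ε n ^ 2) (t + ε n) (Y ω)) (fun n => ?_) ?_
  · exact (continuous_infConv hT (by positivity) _).measurable.comp_aemeasurable hY
  · filter_upwards [h] with ω hω
    exact (tendsto_infConv hT hω t).comp (tendsto_nhdsWithin_iff.2
      ⟨hε, Eventually.of_forall hε0⟩)

variable {T : ℝ} {Ω' : ℕ → Type*} [∀ n, MeasurableSpace (Ω' n)] {P' : ∀ n, Measure (Ω' n)}
  [∀ n, IsProbabilityMeasure (P' n)] {Ω : Type*} [MeasurableSpace Ω] {P : Measure Ω}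
  [IsProbabilityMeasure P]

/-- By the portmanteau theorem a limit in distribution of nondecreasing paths has nondecreasing
paths almost surely, since these paths form a closed set. -/
lemma ae_mem_incrPaths (hT : 0 ≤ T) {Y : ∀ n, Ω' n → SkorokhodSpace T} {X : Ω → SkorokhodSpace T}
    (hX : TendstoInDistribution Y atTop X P' P)
    (hincr : ∀ᶠ n in atTop, ∀ ω, Y n ω ∈ incrPaths hT) : ∀ᵐ ω ∂P, X ω ∈ incrPaths hT := by
  have hcl := isClosed_incrPaths hT
  have h := ProbabilityMeasure.limsup_measure_closed_le_of_tendsto hX.tendsto hcl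
  have h1 : limsup (fun n => ((P' n).map (Y n)) (incrPaths hT)) atTop = 1 := by
    rw [limsup_congr (v := fun _ => (1 : ℝ≥0∞)), limsup_const]
    filter_upwards [hincr] with n hn
    rw [Measure.map_apply_of_aemeasurable (hX.forall_aemeasurable n) hcl.measurableSet]
    have : Y n ⁻¹' incrPaths hT = univ := eq_univ_of_forall hn
    rw [this, measure_univ]
  have h2 : (1 : ℝ≥0∞) ≤ P (X ⁻¹' incrPaths hT) := by
    rw [← Measure.map_apply_of_aemeasurable hX.aemeasurable_limit hcl.measurableSet, ← h1]
    exact h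
  have h3 : P (X ⁻¹' incrPaths hT) = 1 := le_antisymm prob_le_one h2
  exact (mem_ae_iff_prob_eq_one₀ (hX.aemeasurable_limit.nullMeasurable hcl.measurableSet)).2 h3

lemma integral_comb₃ {Ω : Type*} [MeasurableSpace Ω] {P : Measure Ω} {f g h : Ω → ℝ}
    (hf : Integrable f P) (hg : Integrable g P) (hh : Integrable h P) {a b c : ℝ} :
    ∫ ω, (a * f ω + b * g ω + c * h ω) ∂P = a * ∫ ω, f ω ∂P + b * ∫ ω, g ω ∂P + c * ∫ ω, h ω ∂P := by
  have h1 : Integrable (fun ω => a * f ω + b * g ω) P := (hf.const_mul a).add (hg.const_mul b)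
  rw [integral_add h1 (hh.const_mul c), integral_add (hf.const_mul a) (hg.const_mul b),
    integral_const_mul, integral_const_mul, integral_const_mul]

lemma one_add_pow_le {z : ℝ} (hz : 0 ≤ z) (p : ℕ) : (1 + z) ^ p ≤ 2 ^ p * (1 + z ^ p) := by
  rcases le_total z 1 with h | h
  · calc (1 + z) ^ p ≤ 2 ^ p := by gcongr; linarith
      _ ≤ _ := le_mul_of_one_le_right (by positivity) (by simp; positivity)
  · calc (1 + z) ^ p ≤ (2 * z) ^ p := by gcongr; linarith
      _ = 2 ^ p * z ^ p := mul_pow _ _ _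
      _ ≤ _ := by gcongr; simp

/-- If nondecreasing random paths converge in distribution for the `J₁` topology, with bounded
moments at the terminal time and uniformly small mean square increments over short intervals,
then the mixed moments of increments over arbitrary time intervals converge. -/
theorem tendsto_integral_prod_incr (hT : 0 ≤ T) {Y : ∀ n, Ω' n → SkorokhodSpace T}
    {X : Ω → SkorokhodSpace T} (hX : TendstoInDistribution Y atTop X P' P)
    (hincr : ∀ᶠ n in atTop, ∀ ω, Y n ω ∈ incrPaths hT)
    (hmom : ∀ k : ℕ, ∃ C, ∀ᶠ n in atTop, Integrable (fun ω => clamp hT (Y n ω) T ^ k) (P' n) ∧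
      ∫ ω, clamp hT (Y n ω) T ^ k ∂P' n ≤ C)
    (hsq : ∀ t : ℝ, ∀ η > 0, ∀ᶠ ε in 𝓝[>] (0 : ℝ), ∀ᶠ n in atTop,
      ∫ ω, (clamp hT (Y n ω) (t + ε) - clamp hT (Y n ω) t) ^ 2 ∂P' n ≤ η)
    {ι : Type*} (s : Finset ι) (u v : ι → ℝ) (k : ι → ℕ) :
    Integrable (fun ω => ∏ i ∈ s, (clamp hT (X ω) (v i) - clamp hT (X ω) (u i)) ^ k i) P ∧
    Tendsto (fun n => ∫ ω, ∏ i ∈ s, (clamp hT (Y n ω) (v i) - clamp hT (Y n ω) (u i)) ^ k i ∂P' n)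
      atTop (𝓝 (∫ ω, ∏ i ∈ s, (clamp hT (X ω) (v i) - clamp hT (X ω) (u i)) ^ k i ∂P)) := by
  have hgood := ae_mem_incrPaths hT hX hincr
  have hXm : ∀ t, AEMeasurable (fun ω => clamp hT (X ω) t) P :=
    aemeasurable_clamp hT hX.aemeasurable_limit hgood
  have hYm : ∀ᶠ n in atTop, ∀ t, AEMeasurable (fun ω => clamp hT (Y n ω) t) (P' n) := by
    filter_upwards [hincr] with n hn
    exact aemeasurable_clamp hT (hX.forall_aemeasurable n) (Eventually.of_forall hn)
  -- Moments of `1 + x(T)` are bounded along the sequence and finite in the limit.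
  have hMmom : ∀ p : ℕ, ∃ C, ∀ᶠ n in atTop,
      Integrable (fun ω => (1 + clamp hT (Y n ω) T) ^ p) (P' n) ∧
      ∫ ω, (1 + clamp hT (Y n ω) T) ^ p ∂P' n ≤ C := by
    intro p
    obtain ⟨C, hC⟩ := hmom p
    refine ⟨2 ^ p * (1 + C), ?_⟩
    filter_upwards [hC, hincr, hYm] with n h1 h2 h3
    have hi : Integrable (fun ω => 2 ^ p * (1 + clamp hT (Y n ω) T ^ p)) (P' n) :=
      ((integrable_const 1).add h1.1).const_mul _
    have hle : ∀ ω, (1 + clamp hT (Y n ω) T) ^ p ≤ 2 ^ p * (1 + clamp hT (Y n ω) T ^ p) :=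
      fun ω => one_add_pow_le (clamp_nonneg hT (h2 ω) T) p
    have h0 : ∀ ω, 0 ≤ clamp hT (Y n ω) T := fun ω => clamp_nonneg hT (h2 ω) T
    have hi' : Integrable (fun ω => (1 + clamp hT (Y n ω) T) ^ p) (P' n) := by
      refine hi.mono' (((h3 T).const_add 1).pow_const p).aestronglyMeasurable
        (Eventually.of_forall fun ω => ?_)
      rw [Real.norm_eq_abs, abs_of_nonneg (pow_nonneg (by linarith [h0 ω]) _)]
      exact hle ω
    refine ⟨hi', (integral_mono hi' hi hle).trans ?_⟩
    rw [integral_const_mul, integral_add (integrable_const 1) h1.1]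
    simp only [integral_const, probReal_univ, smul_eq_mul, mul_one]
    gcongr
    exact h1.2
  have hMX : ∀ p : ℕ, Integrable (fun ω => (1 + clamp hT (X ω) T) ^ p) P := by
    intro p
    obtain ⟨C, hC⟩ := hMmom (p * 2)
    refine (hX.tendsto_integral_of_sq (G := fun x => (1 + clamp hT x T) ^ p)
      ((continuous_const.add (continuous_clamp_of_ge hT le_rfl)).pow p) (C := C) ?_).1
    simpa only [← pow_mul] using hC
  set K := ∑ i ∈ s, k i with hK
  -- Replacing values of the paths by infimal convolutions costs little, uniformly in `n`.
  have hrepl : ∀ t : ℝ, ∀ η > 0, ∀ᶠ ε in 𝓝[>] (0 : ℝ), ∀ᶠ n in atTop,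
      ∫ ω, (1 + clamp hT (Y n ω) T) ^ K *
        |infConv hT (1 / ε ^ 2) (t + ε) (Y n ω) - clamp hT (Y n ω) t| ∂P' n ≤ η := by
    intro t η hη
    obtain ⟨C₁, hC₁⟩ := hMmom (K * 2)
    obtain ⟨C₂, hC₂⟩ := hMmom (K + 2)
    set θ := η / (2 * (|C₁| + 1)) with hθ
    have hθ0 : 0 < θ := by positivity
    have hεsmall : ∀ᶠ ε in 𝓝[>] (0 : ℝ), ε < η / (4 * (|C₂| + 1)) :=
      nhdsWithin_le_nhds (Iio_mem_nhds (by positivity))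
    filter_upwards [hsq t (θ * η / 2) (by positivity), hεsmall, self_mem_nhdsWithin]
      with ε hε1 hε2 hε0
    simp only [mem_Ioi] at hε0
    filter_upwards [hε1, hC₁, hC₂, hincr, hYm] with n h1 h2 h3 h4 h5
    have hb : ∀ ω, 0 ≤ clamp hT (Y n ω) T := fun ω => clamp_nonneg hT (h4 ω) T
    have hbd : ∀ ω, 0 ≤ clamp hT (Y n ω) (t + ε) - clamp hT (Y n ω) t := fun ω =>
      sub_nonneg.2 ((h4 ω).2 (by linarith))
    have hbd' : ∀ ω, clamp hT (Y n ω) (t + ε) - clamp hT (Y n ω) t ≤ 1 + clamp hT (Y n ω) T :=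
      fun ω => by linarith [clamp_le_right hT (h4 ω) (t + ε), clamp_nonneg hT (h4 ω) t]
    have hi2 : Integrable (fun ω => (clamp hT (Y n ω) (t + ε) - clamp hT (Y n ω) t) ^ 2) (P' n) := by
      refine Integrable.mono' (h3.1) (((h5 _).sub (h5 _)).pow_const 2).aestronglyMeasurable
        (Eventually.of_forall fun ω => ?_)
      rw [Real.norm_eq_abs, abs_of_nonneg (sq_nonneg _)]
      calc _ ≤ (1 + clamp hT (Y n ω) T) ^ 2 := pow_le_pow_left₀ (hbd ω) (hbd' ω) 2
        _ ≤ _ := pow_le_pow_right₀ (by linarith [hb ω]) (by omega)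
    have hi : Integrable (fun ω => (θ / 2 * (1 + clamp hT (Y n ω) T) ^ (K * 2) +
        1 / (2 * θ) * (clamp hT (Y n ω) (t + ε) - clamp hT (Y n ω) t) ^ 2) +
        ε * (1 + clamp hT (Y n ω) T) ^ (K + 2)) (P' n) :=
      ((h2.1.const_mul _).add (hi2.const_mul _)).add (h3.1.const_mul _)
    refine (integral_mono_of_nonneg (Eventually.of_forall fun ω => ?_) hi
      (Eventually.of_forall fun ω => ?_)).trans ?_
    · exact mul_nonneg (pow_nonneg (by linarith [hb ω]) _) (abs_nonneg _)
    · simp only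
      have e1 := abs_infConv_sub_le hT (h4 ω) hε0 t
      set A := (1 + clamp hT (Y n ω) T) ^ K with hA
      set D := clamp hT (Y n ω) (t + ε) - clamp hT (Y n ω) t with hD
      have hA0 : 0 ≤ A := pow_nonneg (by linarith [hb ω]) _
      -- Young's inequality with weight `θ` separates the bounded moment from the increment.
      have e2 : A * D ≤ θ / 2 * A ^ 2 + 1 / (2 * θ) * D ^ 2 := by
        have : θ / 2 * A ^ 2 + 1 / (2 * θ) * D ^ 2 - A * D = 1 / (2 * θ) * (θ * A - D) ^ 2 := by
          field_simp; ring
        have h' : 0 ≤ 1 / (2 * θ) * (θ * A - D) ^ 2 := by positivity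
        linarith
      have e3 : A * (ε * clamp hT (Y n ω) T ^ 2) ≤ ε * (1 + clamp hT (Y n ω) T) ^ (K + 2) := by
        rw [pow_add, ← hA]
        have : clamp hT (Y n ω) T ^ 2 ≤ (1 + clamp hT (Y n ω) T) ^ 2 :=
          pow_le_pow_left₀ (hb ω) (by linarith) 2
        nlinarith [mul_le_mul_of_nonneg_left this (mul_nonneg hA0 hε0.le)]
      calc A * |infConv hT (1 / ε ^ 2) (t + ε) (Y n ω) - clamp hT (Y n ω) t|
          ≤ A * (D + ε * clamp hT (Y n ω) T ^ 2) := mul_le_mul_of_nonneg_left e1 hA0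
        _ ≤ _ := by rw [mul_add, pow_mul]; exact add_le_add e2 e3
    · rw [integral_comb₃ h2.1 hi2 h3.1]
      have f1 : θ / 2 * ∫ ω, (1 + clamp hT (Y n ω) T) ^ (K * 2) ∂P' n ≤ η / 4 := by
        calc _ ≤ θ / 2 * (|C₁| + 1) := by
              gcongr; exact h2.2.trans (by linarith [le_abs_self C₁])
          _ = η / 4 := by rw [hθ]; field_simp; norm_num
      have f2 : 1 / (2 * θ) * ∫ ω, (clamp hT (Y n ω) (t + ε) - clamp hT (Y n ω) t) ^ 2 ∂P' n
          ≤ η / 4 := by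
        calc _ ≤ 1 / (2 * θ) * (θ * η / 2) := by gcongr
          _ = η / 4 := by field_simp; norm_num
      have f3 : ε * ∫ ω, (1 + clamp hT (Y n ω) T) ^ (K + 2) ∂P' n ≤ η / 4 := by
        calc _ ≤ ε * (|C₂| + 1) := by
              gcongr; exact h3.2.trans (by linarith [le_abs_self C₂])
          _ ≤ η / (4 * (|C₂| + 1)) * (|C₂| + 1) := by gcongr
          _ = η / 4 := by field_simp
      linarith
  -- The continuous functional that approximates the product of increments.
  let Φ : ℝ → SkorokhodSpace T → ℝ := fun ε x =>
    ∏ i ∈ s, (infConv hT (1 / ε ^ 2) (v i + ε) x - infConv hT (1 / ε ^ 2) (u i + ε) x) ^ k i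
  have hΦc : ∀ ε, Continuous (Φ ε) := fun ε =>
    continuous_finsetProd s fun i _ => ((continuous_infConv hT (by positivity) _).sub
      (continuous_infConv hT (by positivity) _)).pow _
  have hinf : ∀ x ∈ incrPaths hT, ∀ ε t : ℝ, 0 ≤ infConv hT (1 / ε ^ 2) t x ∧
      infConv hT (1 / ε ^ 2) t x ≤ clamp hT x T := fun x hx ε t => by
    refine ⟨infConv_nonneg hT (by positivity) _ _, (infConv_le hT (by positivity) _ _).trans ?_⟩
    rw [abs_of_nonneg (clamp_nonneg hT hx _)]
    exact clamp_le_right hT hx _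
  have hdiff1 : ∀ x ∈ incrPaths hT, ∀ ε a b : ℝ,
      |infConv hT (1 / ε ^ 2) a x - infConv hT (1 / ε ^ 2) b x| ≤ 1 + clamp hT x T :=
    fun x hx ε a b => by
      have h1 := hinf x hx ε a
      have h2 := hinf x hx ε b
      rw [abs_le]; constructor <;> linarith [clamp_nonneg hT hx T]
  have hdiff2 : ∀ x ∈ incrPaths hT, ∀ a b : ℝ, |clamp hT x a - clamp hT x b| ≤ 1 + clamp hT x T :=
    fun x hx a b => by
      have h1 := clamp_le_right hT hx a
      have h2 := clamp_le_right hT hx b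
      have h3 := clamp_nonneg hT hx a
      have h4 := clamp_nonneg hT hx b
      rw [abs_le]; constructor <;> linarith [clamp_nonneg hT hx T]
  have hprod : ∀ x ∈ incrPaths hT, ∀ f : ι → ℝ, (∀ i ∈ s, |f i| ≤ 1 + clamp hT x T) →
      |∏ i ∈ s, f i ^ k i| ≤ (1 + clamp hT x T) ^ K := fun x hx f hf => by
    rw [Finset.abs_prod, hK, ← Finset.prod_pow_eq_pow_sum]
    refine Finset.prod_le_prod (fun _ _ => abs_nonneg _) fun i hi => ?_
    rw [abs_pow]
    exact pow_le_pow_left₀ (abs_nonneg _) (hf i hi) _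
  have hΦb : ∀ x ∈ incrPaths hT, ∀ ε, |Φ ε x| ≤ (1 + clamp hT x T) ^ K := fun x hx ε =>
    hprod x hx _ fun i _ => hdiff1 x hx ε _ _
  have hQb : ∀ x ∈ incrPaths hT, |∏ i ∈ s, (clamp hT x (v i) - clamp hT x (u i)) ^ k i| ≤
      (1 + clamp hT x T) ^ K := fun x hx => hprod x hx _ fun i _ => hdiff2 x hx _ _
  have hQX : Integrable (fun ω => ∏ i ∈ s, (clamp hT (X ω) (v i) - clamp hT (X ω) (u i)) ^ k i) P := by
    refine (hMX K).mono' ?_ (hgood.mono fun ω hω => hQb _ hω)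
    exact (Finset.aemeasurable_fun_prod s fun i _ =>
      ((hXm _).sub (hXm _)).pow_const _).aestronglyMeasurable
  refine ⟨hQX, tendsto_of_forall_approx fun η hη => ?_⟩
  have hFlim : Tendsto (fun ε : ℝ => ∫ ω, Φ ε (X ω) ∂P) (𝓝[>] 0)
      (𝓝 (∫ ω, ∏ i ∈ s, (clamp hT (X ω) (v i) - clamp hT (X ω) (u i)) ^ k i ∂P)) := by
    refine tendsto_integral_filter_of_dominated_convergence
      (fun ω => (1 + clamp hT (X ω) T) ^ K) ?_ ?_ (hMX K) ?_
    · exact Eventually.of_forall fun ε =>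
        ((hΦc ε).measurable.comp_aemeasurable hX.aemeasurable_limit).aestronglyMeasurable
    · exact Eventually.of_forall fun ε => hgood.mono fun ω hω => hΦb _ hω ε
    · filter_upwards [hgood] with ω hω
      exact tendsto_finsetProd s fun i _ =>
        ((tendsto_infConv hT hω _).sub (tendsto_infConv hT hω _)).pow _
  set η' := η / (2 * (∑ i ∈ s, (k i : ℝ) + 1)) with hη'
  have hS0 : 0 ≤ ∑ i ∈ s, (k i : ℝ) := Finset.sum_nonneg fun i _ => by positivity
  have hη'0 : 0 < η' := by positivity
  have hev1 : ∀ᶠ ε in 𝓝[>] (0 : ℝ), ∀ i ∈ s, ∀ᶠ n in atTop,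
      ∫ ω, (1 + clamp hT (Y n ω) T) ^ K *
        |infConv hT (1 / ε ^ 2) (v i + ε) (Y n ω) - clamp hT (Y n ω) (v i)| ∂P' n ≤ η' :=
    (Finset.eventually_all s).2 fun i _ => hrepl (v i) η' hη'0
  have hev2 : ∀ᶠ ε in 𝓝[>] (0 : ℝ), ∀ i ∈ s, ∀ᶠ n in atTop,
      ∫ ω, (1 + clamp hT (Y n ω) T) ^ K *
        |infConv hT (1 / ε ^ 2) (u i + ε) (Y n ω) - clamp hT (Y n ω) (u i)| ∂P' n ≤ η' :=
    (Finset.eventually_all s).2 fun i _ => hrepl (u i) η' hη'0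
  obtain ⟨ε, h1, h2, h3⟩ := (hev1.and (hev2.and (Metric.tendsto_nhds.1 hFlim η hη))).exists
  obtain ⟨C, hC⟩ := hMmom (K * 2)
  have hconv := (hX.tendsto_integral_of_sq (hΦc ε) (C := C) (by
    filter_upwards [hC, hincr] with n hn hn2
    have hle : ∀ ω, Φ ε (Y n ω) ^ 2 ≤ (1 + clamp hT (Y n ω) T) ^ (K * 2) := fun ω => by
      rw [← sq_abs, pow_mul]
      exact pow_le_pow_left₀ (abs_nonneg _) (hΦb _ (hn2 ω) ε) 2
    have hi : Integrable (fun ω => Φ ε (Y n ω) ^ 2) (P' n) := by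
      refine hn.1.mono' (((hΦc ε).measurable.comp_aemeasurable
        (hX.forall_aemeasurable n)).pow_const 2).aestronglyMeasurable
        (Eventually.of_forall fun ω => ?_)
      rw [Real.norm_eq_abs, abs_of_nonneg (sq_nonneg _)]
      exact hle ω
    exact ⟨hi, (integral_mono hi hn.1 hle).trans hn.2⟩)).2
  refine ⟨_, _, hconv, ?_, by rw [Real.dist_eq] at h3; exact h3.le⟩
  obtain ⟨C', hC'⟩ := hMmom (K + 1)
  obtain ⟨C'', hC''⟩ := hMmom K
  filter_upwards [(Finset.eventually_all s).2 h1, (Finset.eventually_all s).2 h2, hincr, hYm, hC', hC'']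
    with n g1 g2 g3 g4 g5 g6
  have hb : ∀ ω, 0 ≤ clamp hT (Y n ω) T := fun ω => clamp_nonneg hT (g3 ω) T
  have hinfm : ∀ t, AEMeasurable (fun ω => infConv hT (1 / ε ^ 2) t (Y n ω)) (P' n) := fun t =>
    (continuous_infConv hT (by positivity) t).measurable.comp_aemeasurable
      (hX.forall_aemeasurable n)
  have hI : ∀ t, Integrable (fun ω => (1 + clamp hT (Y n ω) T) ^ K *
      |infConv hT (1 / ε ^ 2) (t + ε) (Y n ω) - clamp hT (Y n ω) t|) (P' n) := fun t => by
    refine g5.1.mono' ?_ (Eventually.of_forall fun ω => ?_)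
    · exact ((((g4 T).const_add 1).pow_const K).mul
        (continuous_abs.measurable.comp_aemeasurable ((hinfm _).sub (g4 t)))).aestronglyMeasurable
    · have hM0 : 0 ≤ (1 + clamp hT (Y n ω) T) ^ K := pow_nonneg (by linarith [hb ω]) _
      rw [Real.norm_eq_abs, abs_of_nonneg (mul_nonneg hM0 (abs_nonneg _)), pow_succ _ K]
      refine mul_le_mul_of_nonneg_left ?_ hM0
      have f1 := hinf _ (g3 ω) ε (t + ε)
      have f2 := clamp_le_right hT (g3 ω) t
      have f3 := clamp_nonneg hT (g3 ω) t
      rw [abs_le]; constructor <;> linarith [hb ω]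
  have hΦi : Integrable (fun ω => Φ ε (Y n ω)) (P' n) :=
    g6.1.mono' ((hΦc ε).measurable.comp_aemeasurable
      (hX.forall_aemeasurable n)).aestronglyMeasurable
      (Eventually.of_forall fun ω => hΦb _ (g3 ω) ε)
  have hQi : Integrable (fun ω => ∏ i ∈ s, (clamp hT (Y n ω) (v i) - clamp hT (Y n ω) (u i)) ^ k i)
      (P' n) :=
    g6.1.mono' (Finset.aemeasurable_fun_prod s fun i _ =>
      ((g4 _).sub (g4 _)).pow_const _).aestronglyMeasurable
      (Eventually.of_forall fun ω => hQb _ (g3 ω))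
  rw [← integral_sub hQi hΦi]
  have hsumI : ∀ i ∈ s, Integrable (fun ω => (k i : ℝ) * ((1 + clamp hT (Y n ω) T) ^ K *
      |infConv hT (1 / ε ^ 2) (v i + ε) (Y n ω) - clamp hT (Y n ω) (v i)| +
      (1 + clamp hT (Y n ω) T) ^ K *
      |infConv hT (1 / ε ^ 2) (u i + ε) (Y n ω) - clamp hT (Y n ω) (u i)|)) (P' n) :=
    fun i _ => ((hI _).add (hI _)).const_mul _
  calc _ ≤ ∫ ω, |∏ i ∈ s, (clamp hT (Y n ω) (v i) - clamp hT (Y n ω) (u i)) ^ k i -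
          Φ ε (Y n ω)| ∂P' n := abs_integral_le_integral_abs
    _ ≤ ∫ ω, ∑ i ∈ s, (k i : ℝ) * ((1 + clamp hT (Y n ω) T) ^ K *
      |infConv hT (1 / ε ^ 2) (v i + ε) (Y n ω) - clamp hT (Y n ω) (v i)| +
      (1 + clamp hT (Y n ω) T) ^ K *
      |infConv hT (1 / ε ^ 2) (u i + ε) (Y n ω) - clamp hT (Y n ω) (u i)|) ∂P' n := by
        refine integral_mono (hQi.sub hΦi).abs (integrable_finsetSum s hsumI) fun ω => ?_
        have hM1 : 1 ≤ 1 + clamp hT (Y n ω) T := by linarith [hb ω]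
        have := abs_prod_pow_sub_prod_pow_le s hM1 k
          (fun i _ => hdiff2 _ (g3 ω) (v i) (u i))
          (fun i _ => hdiff1 _ (g3 ω) ε (v i + ε) (u i + ε))
        refine this.trans ?_
        rw [Finset.mul_sum]
        refine Finset.sum_le_sum fun i _ => ?_
        have hM0 : 0 ≤ (1 + clamp hT (Y n ω) T) ^ K := pow_nonneg (by linarith) _
        have h' : |clamp hT (Y n ω) (v i) - clamp hT (Y n ω) (u i) -
            (infConv hT (1 / ε ^ 2) (v i + ε) (Y n ω) - infConv hT (1 / ε ^ 2) (u i + ε) (Y n ω))| ≤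
            |infConv hT (1 / ε ^ 2) (v i + ε) (Y n ω) - clamp hT (Y n ω) (v i)| +
            |infConv hT (1 / ε ^ 2) (u i + ε) (Y n ω) - clamp hT (Y n ω) (u i)| := by
          rw [abs_sub_comm (infConv hT (1 / ε ^ 2) (v i + ε) (Y n ω))]
          refine le_trans (le_of_eq ?_) (abs_add_le _ _)
          congr 1; ring
        calc _ ≤ (1 + clamp hT (Y n ω) T) ^ K * ((k i : ℝ) * _) :=
              mul_le_mul_of_nonneg_left (mul_le_mul_of_nonneg_left h' (by positivity)) hM0
          _ = _ := by ring
    _ = ∑ i ∈ s, (k i : ℝ) * (∫ ω, (1 + clamp hT (Y n ω) T) ^ K *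
      |infConv hT (1 / ε ^ 2) (v i + ε) (Y n ω) - clamp hT (Y n ω) (v i)| ∂P' n +
      ∫ ω, (1 + clamp hT (Y n ω) T) ^ K *
      |infConv hT (1 / ε ^ 2) (u i + ε) (Y n ω) - clamp hT (Y n ω) (u i)| ∂P' n) := by
        rw [integral_finsetSum s hsumI]
        refine Finset.sum_congr rfl fun i _ => ?_
        rw [integral_const_mul, integral_add (hI _) (hI _)]
    _ ≤ ∑ i ∈ s, (k i : ℝ) * (η' + η') := by
        refine Finset.sum_le_sum fun i hi => ?_
        have := g1 i hi
        have := g2 i hi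
        gcongr
    _ ≤ η := by
        rw [← Finset.sum_mul, hη']
        calc _ = η * ((∑ i ∈ s, (k i : ℝ)) / (∑ i ∈ s, (k i : ℝ) + 1)) := by field_simp; norm_num
          _ ≤ η * 1 := by
              gcongr
              rw [div_le_one (by positivity)]; linarith
          _ = η := mul_one _

end PathMoments

/-! ### Sums over increasing chains of indices -/

namespace GBP

/-- The list `J i, …, J i, J (i+1), …, J (i+1), …` of `m` consecutive blocks starting at
index `i`, in which the `r`-th block is repeated `k r` times. -/
def flat {β : Type*} (J : ℕ → β) (k : ℕ → ℕ) : ℕ → ℕ → List β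
  | _, 0 => []
  | i, m + 1 => List.replicate (k i) (J i) ++ flat J k (i + 1) m

/-- For blocks `J₁, …, Jₚ`, each the integer interval `(a, b]`, the sum of
`w i j₁ * w j₁ j₂ * ⋯ * w jₚ₋₁ jₚ` over all chains `i < j₁ < ⋯ < jₚ` with `jᵣ ∈ Jᵣ`. -/
noncomputable def chainSum (w : ℕ → ℕ → ℝ) : List (ℕ × ℕ) → ℕ → ℝ
  | [], _ => 1
  | J :: l, i => ∑ j ∈ Finset.Ioc (max i J.1) J.2, w i j * chainSum w l j

lemma chainSum_congr {w w' : ℕ → ℕ → ℝ} {N : ℕ} (h : ∀ i, ∀ j ∈ Finset.Icc 1 N, w i j = w' i j)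
    (l : List (ℕ × ℕ)) (hl : ∀ J ∈ l, J.2 ≤ N) (i : ℕ) : chainSum w l i = chainSum w' l i := by
  induction l generalizing i with
  | nil => rfl
  | cons J l ih =>
    refine Finset.sum_congr rfl fun j hj => ?_
    have h1 := hl J (by simp)
    rw [Finset.mem_Ioc] at hj
    rw [h i j (Finset.mem_Icc.2 (by omega)), ih (fun J hJ => hl J (by simp [hJ]))]

lemma chainSum_eq_of_le (x : ℕ → ℝ) (l : List (ℕ × ℕ)) {i b : ℕ} (hib : i ≤ b)
    (hl : ∀ J ∈ l, b ≤ J.1) : chainSum (fun _ j => x j) l i = chainSum (fun _ j => x j) l b := by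
  cases l with
  | nil => rfl
  | cons J l =>
    have := hl J (by simp)
    simp only [chainSum]
    rw [max_eq_right (by omega), max_eq_right (by omega)]

/-- The hockey stick identity for the partial sums of a `0`-`1` sequence. -/
lemma sum_mul_choose (x : ℕ → ℕ) (hx : ∀ j, x j ≤ 1) (k n i : ℕ) :
    ∑ j ∈ Finset.Ioc i (i + n), x j * (∑ r ∈ Finset.Ioc j (i + n), x r).choose k =
      (∑ r ∈ Finset.Ioc i (i + n), x r).choose (k + 1) := by
  induction n generalizing i with
  | zero => simp
  | succ n ih =>
    have e : Finset.Ioc i (i + (n + 1)) = insert (i + 1) (Finset.Ioc (i + 1) (i + 1 + n)) := by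
      ext j; simp only [Finset.mem_Ioc, Finset.mem_insert]; omega
    have e' : i + (n + 1) = i + 1 + n := by omega
    rw [e, Finset.sum_insert (by simp), Finset.sum_insert (by simp), e', ih (i + 1)]
    rcases Nat.le_one_iff_eq_zero_or_eq_one.1 (hx (i + 1)) with h | h
    · simp [h]
    · rw [h, one_mul, add_comm 1, Nat.choose_succ_succ]

/-- `k` copies of one block at the head of the list contribute a binomial coefficient. -/
lemma chainSum_replicate_append (x : ℕ → ℕ) (hx : ∀ j, x j ≤ 1) (a b : ℕ) (l : List (ℕ × ℕ))
    (hl : ∀ J ∈ l, b ≤ J.1) (k i : ℕ) (hi : max i a ≤ b) :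
    chainSum (fun _ j => (x j : ℝ)) (List.replicate k (a, b) ++ l) i =
      ((∑ r ∈ Finset.Ioc (max i a) b, x r).choose k : ℝ) *
        chainSum (fun _ j => (x j : ℝ)) l b := by
  induction k generalizing i with
  | zero => simpa using chainSum_eq_of_le (fun j => (x j : ℝ)) l (le_of_max_le_left hi) hl
  | succ k ih =>
    obtain ⟨n, rfl⟩ := Nat.exists_eq_add_of_le hi
    rw [← sum_mul_choose x hx k n (max i a)]
    simp only [List.replicate_succ, List.cons_append, chainSum]
    push_cast
    rw [Finset.sum_mul]
    refine Finset.sum_congr rfl fun j hj => ?_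
    rw [Finset.mem_Ioc] at hj
    have hja : max j a = j := by omega
    rw [ih j (by omega), hja, mul_assoc]

lemma mem_flat {β : Type*} (J : ℕ → β) (k : ℕ → ℕ) {i m : ℕ} {z : β} (h : z ∈ flat J k i m) :
    ∃ r ∈ Finset.Ico i (i + m), z = J r := by
  induction m generalizing i with
  | zero => simp [flat] at h
  | succ m ih =>
    simp only [flat, List.mem_append, List.mem_replicate] at h
    rcases h with h | h
    · exact ⟨i, by simp, h.2⟩
    · obtain ⟨r, hr, rfl⟩ := ih h
      rw [Finset.mem_Ico] at hr
      exact ⟨r, Finset.mem_Ico.2 (by omega), rfl⟩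

/-- The chain sum of a `0`-`1` sequence over ordered blocks counts, block by block, the ways to
choose the prescribed number of ones. -/
lemma chainSum_flat (x : ℕ → ℕ) (hx : ∀ j, x j ≤ 1) (J : ℕ → ℕ × ℕ) (k : ℕ → ℕ) (i m s : ℕ)
    (hJ : ∀ r ∈ Finset.Ico i (i + m), (J r).1 ≤ (J r).2)
    (hJ' : ∀ r ∈ Finset.Ico i (i + m), ∀ r' ∈ Finset.Ico i (i + m), r < r' → (J r).2 ≤ (J r').1)
    (hs : 0 < m → s ≤ (J i).1) :
    chainSum (fun _ j => (x j : ℝ)) (flat J k i m) s =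
      ∏ r ∈ Finset.Ico i (i + m), ((∑ j ∈ Finset.Ioc (J r).1 (J r).2, x j).choose (k r) : ℝ) := by
  induction m generalizing i s with
  | zero => simp [flat, chainSum]
  | succ m ih =>
    have hs' := hs (by omega)
    have hi : (J i).1 ≤ (J i).2 := hJ i (by simp)
    rw [flat, show J i = ((J i).1, (J i).2) from rfl, chainSum_replicate_append x hx _ _ _ ?_ _ _ ?_,
      ih (i + 1), Finset.prod_eq_prod_Ico_succ_bot (a := i) (b := i + (m + 1)) (by omega),
      max_eq_right hs', show i + 1 + m = i + (m + 1) by omega]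
    · intro r hr
      exact hJ r (by rw [Finset.mem_Ico] at *; omega)
    · intro r hr r' hr'
      exact hJ' r (by rw [Finset.mem_Ico] at *; omega) r' (by rw [Finset.mem_Ico] at *; omega)
    · intro hm
      exact hJ' i (by simp) (i + 1) (by rw [Finset.mem_Ico]; omega) (by omega)
    · intro z hz
      obtain ⟨r, hr, rfl⟩ := mem_flat J k hz
      rw [Finset.mem_Ico] at hr
      exact hJ' i (by simp) r (by rw [Finset.mem_Ico]; omega) (by omega)
    · exact max_le (hs'.trans hi) hi

/-! ### Expectations of chain sums of a generalized Bernoulli process -/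

lemma gapProd_append (f : ℕ → ℝ) (l : List ℕ) (i j : ℕ) :
    gapProd f (l ++ [i, j]) = gapProd f (l ++ [i]) * f (j - i) := by
  induction l with
  | nil => simp [gapProd]
  | cons a l ih =>
    cases l with
    | nil => simp [gapProd]
    | cons c l =>
      simp only [List.cons_append, gapProd] at ih ⊢
      rw [ih, mul_assoc]

lemma sort_insert_max (B : Finset ℕ) {m : ℕ} (hB : ∀ i ∈ B, i < m) :
    (insert m B).sort (· ≤ ·) = B.sort (· ≤ ·) ++ [m] := by
  refine List.Perm.eq_of_pairwise' (r := (· ≤ ·)) (Finset.pairwise_sort _ _) ?_ ?_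
  · rw [List.pairwise_append]
    refine ⟨Finset.pairwise_sort _ _, by simp, ?_⟩
    intro a ha b hb
    rw [List.mem_singleton] at hb
    rw [Finset.mem_sort] at ha
    exact hb ▸ (hB a ha).le
  · rw [← Multiset.coe_eq_coe, ← Multiset.coe_add, Finset.sort_eq, Finset.sort_eq,
      Finset.insert_val_of_notMem (fun h => lt_irrefl _ (hB m h)), ← Multiset.singleton_add, add_comm]
    rfl

lemma L_insert (f : ℕ → ℝ) (b : ℝ) (N : ℕ) {B : Finset ℕ} {m j : ℕ} (hm : m ∈ B)
    (hB : ∀ i ∈ B, i ≤ m) (hj : m < j) : L f b N (insert j B) = L f b N B * f (j - m) := by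
  have hne : B ≠ ∅ := Finset.ne_empty_of_mem hm
  rw [L, L, if_neg (Finset.insert_ne_empty _ _), if_neg hne,
    sort_insert_max B (fun i hi => (hB i hi).trans_lt hj)]
  have hBe : B = insert m (B.erase m) := (Finset.insert_erase hm).symm
  have hs : B.sort (· ≤ ·) = (B.erase m).sort (· ≤ ·) ++ [m] := by
    conv_lhs => rw [hBe]
    refine sort_insert_max _ fun i hi => ?_
    rw [Finset.mem_erase] at hi
    exact lt_of_le_of_ne (hB i hi.2) hi.1
  rw [hs, List.append_assoc]
  exact gapProd_append f _ m j

section Expectation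

variable {Ω : Type*} [MeasurableSpace Ω] {P : Measure Ω} [IsProbabilityMeasure P] {f : ℕ → ℝ}
  {b : ℝ} {N : ℕ} {ξ : ℕ → Ω → ℝ}

/-- The defining probabilities with `F = ∅`. -/
lemma IsGBP.integral_prod (h : IsGBP f b N ξ P) {B : Finset ℕ} (hB : B ⊆ Finset.Icc 1 N) :
    Integrable (fun ω => ∏ i ∈ B, ξ i ω) P ∧ ∫ ω, ∏ i ∈ B, ξ i ω ∂P = b * f N * L f b N B := by
  have hms : MeasurableSet {ω | ∀ i ∈ B, ξ i ω = 1} := by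
    have : {ω | ∀ i ∈ B, ξ i ω = 1} = ⋂ i ∈ B, ξ i ⁻¹' {1} := by ext; simp
    rw [this]
    exact Finset.measurableSet_biInter B fun i hi => h.measurable i (hB hi) (measurableSet_singleton 1)
  have he : (fun ω => ∏ i ∈ B, ξ i ω) = {ω | ∀ i ∈ B, ξ i ω = 1}.indicator fun _ => (1 : ℝ) := by
    funext ω
    by_cases hω : ∀ i ∈ B, ξ i ω = 1
    · rw [indicator_of_mem (by exact hω)]
      exact Finset.prod_eq_one hω
    · rw [indicator_of_notMem (by exact hω)]
      push Not at hω
      obtain ⟨i, hi, hi'⟩ := hω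
      exact Finset.prod_eq_zero hi ((h.binary i (hB hi) ω).resolve_right hi')
  refine ⟨by rw [he]; exact (integrable_const 1).indicator hms, ?_⟩
  have hp := h.prob B ∅ hB (by simp) (by simp)
  simp only [Finset.notMem_empty, false_imp_iff, implies_true, and_true] at hp
  rw [he, integral_indicator_const _ hms, hp]
  simp [D]

/-- Each step of the chain adds a new largest index to `B`, which multiplies `L(B)` by the weight
of the new gap. -/
lemma IsGBP.integral_prod_mul_chainSum (h : IsGBP f b N ξ P) (l : List (ℕ × ℕ))
    (hl : ∀ J ∈ l, J.2 ≤ N) {B : Finset ℕ} (hB : B ⊆ Finset.Icc 1 N) {m : ℕ} (hm : m ∈ B)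
    (hBm : ∀ i ∈ B, i ≤ m) :
    Integrable (fun ω => (∏ i ∈ B, ξ i ω) * chainSum (fun _ j => ξ j ω) l m) P ∧
    ∫ ω, (∏ i ∈ B, ξ i ω) * chainSum (fun _ j => ξ j ω) l m ∂P =
      b * f N * L f b N B * chainSum (fun i j => f (j - i)) l m := by
  induction l generalizing B m with
  | nil => simpa [chainSum] using h.integral_prod hB
  | cons J l ih =>
    have hJ := hl J (by simp)
    have key : ∀ ω, (∏ i ∈ B, ξ i ω) * chainSum (fun _ j => ξ j ω) (J :: l) m =
        ∑ j ∈ Finset.Ioc (max m J.1) J.2,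
          (∏ i ∈ insert j B, ξ i ω) * chainSum (fun _ j => ξ j ω) l j := fun ω => by
      simp only [chainSum]
      rw [Finset.mul_sum]
      refine Finset.sum_congr rfl fun j hj => ?_
      rw [Finset.mem_Ioc] at hj
      rw [Finset.prod_insert (fun hjB => by have := hBm j hjB; omega)]
      ring
    have hstep : ∀ j ∈ Finset.Ioc (max m J.1) J.2,
        Integrable (fun ω => (∏ i ∈ insert j B, ξ i ω) * chainSum (fun _ j => ξ j ω) l j) P ∧
        ∫ ω, (∏ i ∈ insert j B, ξ i ω) * chainSum (fun _ j => ξ j ω) l j ∂P =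
          b * f N * L f b N (insert j B) * chainSum (fun i j => f (j - i)) l j := fun j hj => by
      rw [Finset.mem_Ioc] at hj
      refine ih (fun J hJ => hl J (by simp [hJ])) ?_ (Finset.mem_insert_self _ _) ?_
      · refine Finset.insert_subset (Finset.mem_Icc.2 (by omega)) hB
      · intro i hi
        rcases Finset.mem_insert.1 hi with rfl | hi
        · exact le_rfl
        · have := hBm i hi; omega
    simp only [key]
    refine ⟨integrable_finsetSum _ fun j hj => (hstep j hj).1, ?_⟩
    rw [integral_finsetSum _ fun j hj => (hstep j hj).1]
    simp only [chainSum]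
    rw [Finset.mul_sum]
    refine Finset.sum_congr rfl fun j hj => ?_
    rw [(hstep j hj).2]
    rw [Finset.mem_Ioc] at hj
    rw [L_insert f b N hm hBm (by omega)]
    ring

/-- The starting point `0` of the chain imposes no constraint and carries no weight, so the first
index is summed over the whole first block. -/
lemma IsGBP.integral_chainSum (h : IsGBP f b N ξ P) (J : ℕ × ℕ) (l : List (ℕ × ℕ))
    (hl : ∀ J' ∈ J :: l, J'.2 ≤ N) :
    Integrable (fun ω => chainSum (fun _ j => ξ j ω) (J :: l) 0) P ∧
    ∫ ω, chainSum (fun _ j => ξ j ω) (J :: l) 0 ∂P =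
      b * f N * ∑ j ∈ Finset.Ioc J.1 J.2, chainSum (fun i j => f (j - i)) l j := by
  have hJ := hl J (by simp)
  have hstep : ∀ j ∈ Finset.Ioc J.1 J.2,
      Integrable (fun ω => ξ j ω * chainSum (fun _ j => ξ j ω) l j) P ∧
      ∫ ω, ξ j ω * chainSum (fun _ j => ξ j ω) l j ∂P =
        b * f N * chainSum (fun i j => f (j - i)) l j := fun j hj => by
    rw [Finset.mem_Ioc] at hj
    have := h.integral_prod_mul_chainSum l (fun J hJ => hl J (by simp [hJ])) (B := {j})
      (by rw [Finset.singleton_subset_iff, Finset.mem_Icc]; omega) (Finset.mem_singleton_self j)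
      (by simp)
    simpa [L, gapProd] using this
  simp only [chainSum, Nat.zero_max]
  refine ⟨integrable_finsetSum _ fun j hj => (hstep j hj).1, ?_⟩
  rw [integral_finsetSum _ fun j hj => (hstep j hj).1, Finset.mul_sum]
  exact Finset.sum_congr rfl fun j hj => (hstep j hj).2

end Expectation

/-! ### The continuum limit of chain sums -/

/-- The kernel `g(u) = c e^{-λ u} u^{α - 1}` on `u > 0`, extended by `0`. -/
noncomputable def kern (c lam α u : ℝ) : ℝ :=
  if 0 < u then c * Real.exp (-lam * u) * u ^ (α - 1) else 0

/-- The continuum analogue of `chainSum`: the integral of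
`g(y₁ - x) g(y₂ - y₁) ⋯ g(yₚ - yₚ₋₁)` over `yᵣ ∈ Jᵣ`, each `Jᵣ` being the interval `(u, v]`.
As `g` vanishes on `(-∞, 0]`, only increasing chains contribute. -/
noncomputable def chainInt (g : ℝ → ℝ) : List (ℝ × ℝ) → ℝ → ℝ
  | [], _ => 1
  | J :: l, x => ∫ y in Ioc J.1 J.2, g (y - x) * chainInt g l y

lemma chainSum_smul (a : ℝ) (w : ℕ → ℕ → ℝ) (l : List (ℕ × ℕ)) (i : ℕ) :
    chainSum (fun i j => a * w i j) l i = a ^ l.length * chainSum w l i := by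
  induction l generalizing i with
  | nil => simp [chainSum]
  | cons J l ih =>
    simp only [chainSum, List.length_cons, Finset.mul_sum]
    refine Finset.sum_congr rfl fun j _ => ?_
    rw [ih]; ring

/-- A sum over an integer interval as the integral of a step function. -/
lemma integral_ceil_eq_sum (h : ℕ → ℝ) {n : ℕ} (hn : 0 < n) (a b : ℕ) :
    ∫ y in Ioc ((a : ℝ) / n) (b / n), h ⌈(n : ℝ) * y⌉₊ = (1 / n) * ∑ j ∈ Finset.Ioc a b, h j ∧
    IntegrableOn (fun y => h ⌈(n : ℝ) * y⌉₊) (Ioc ((a : ℝ) / n) (b / n)) := by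
  have hn' : (0 : ℝ) < n := by exact_mod_cast hn
  rcases le_total b a with hab | hab
  · have : ((b : ℝ) / n) ≤ a / n := by gcongr
    simp [Ioc_eq_empty (not_lt.2 this), Finset.Ioc_eq_empty (not_lt.2 hab)]
  induction b, hab using Nat.le_induction with
  | base => simp
  | succ b hab ih =>
    have h1 : (a : ℝ) / n ≤ b / n := by gcongr
    have h2 : (b : ℝ) / n ≤ (b + 1 : ℕ) / n := by gcongr; omega
    have hc : EqOn (fun y : ℝ => h ⌈(n : ℝ) * y⌉₊) (fun _ => h (b + 1))
        (Ioc ((b : ℝ) / n) ((b + 1 : ℕ) / n)) := by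
      intro y hy
      have : ⌈(n : ℝ) * y⌉₊ = b + 1 := by
        rw [Nat.ceil_eq_iff (by omega)]
        rw [mem_Ioc, div_lt_iff₀ hn', le_div_iff₀ hn'] at hy
        push_cast at hy ⊢
        constructor <;> linarith
      simp only [this]
    have hi : IntegrableOn (fun y => h ⌈(n : ℝ) * y⌉₊) (Ioc ((b : ℝ) / n) ((b + 1 : ℕ) / n)) :=
      (integrableOn_const (by simp)).congr_fun hc.symm measurableSet_Ioc
    rw [← Ioc_union_Ioc_eq_Ioc h1 h2]
    refine ⟨?_, ih.2.union hi⟩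
    rw [setIntegral_union (Ioc_disjoint_Ioc_of_le le_rfl) measurableSet_Ioc ih.2 hi, ih.1,
      setIntegral_congr_fun measurableSet_Ioc hc, setIntegral_const,
      ← Finset.insert_Ioc_right_eq_Ioc_add_one hab, Finset.sum_insert (by simp)]
    simp only [measureReal_def, Real.volume_Ioc, smul_eq_mul]
    rw [ENNReal.toReal_ofReal (by linarith)]
    push_cast; ring

section Kernel

variable {c lam α : ℝ}

lemma kern_nonneg (hc : 0 ≤ c) (u : ℝ) : 0 ≤ kern c lam α u := by
  unfold kern; split_ifs with h <;> positivity

lemma kern_of_pos {u : ℝ} (hu : 0 < u) :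
    kern c lam α u = c * Real.exp (-lam * u) * u ^ (α - 1) := if_pos hu

lemma kern_of_nonpos {u : ℝ} (hu : u ≤ 0) : kern c lam α u = 0 := if_neg (not_lt.2 hu)

lemma continuousAt_kern {u : ℝ} (hu : u ≠ 0) : ContinuousAt (kern c lam α) u := by
  rcases lt_or_gt_of_ne hu with h | h
  · refine (continuousAt_const (y := (0 : ℝ))).congr ?_
    filter_upwards [Iio_mem_nhds h] with v hv
    exact (kern_of_nonpos (le_of_lt hv)).symm
  · have : ContinuousAt (fun u : ℝ => c * Real.exp (-lam * u) * u ^ (α - 1)) u :=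
      ((by fun_prop : Continuous fun u : ℝ => c * Real.exp (-lam * u)).continuousAt).mul
        (Real.continuousAt_rpow_const _ _ (Or.inl hu))
    refine this.congr ?_
    filter_upwards [Ioi_mem_nhds h] with v hv
    exact (kern_of_pos hv).symm

@[fun_prop]
lemma measurable_kern : Measurable (kern c lam α) := by
  unfold kern
  exact Measurable.ite measurableSet_Ioi (by fun_prop) measurable_const

/-- An integrable function that dominates the kernel and its discretizations on `[0,T]`. -/
noncomputable def kernBound (c lam α T u : ℝ) : ℝ :=
  (Ioc 0 T).indicator (fun u => c * Real.exp (|lam| * (T + 1)) * (u / 2) ^ (α - 1)) u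

lemma kernBound_nonneg (hc : 0 ≤ c) (T u : ℝ) : 0 ≤ kernBound c lam α T u := by
  refine indicator_nonneg (fun u hu => ?_) u
  have := hu.1
  positivity

lemma integrable_kernBound (hα : 0 < α) (T : ℝ) : Integrable (kernBound c lam α T) := by
  unfold kernBound
  rw [integrable_indicator_iff measurableSet_Ioc]
  refine Integrable.const_mul ?_ _
  have h1 : IntegrableOn (fun u : ℝ => u ^ (α - 1)) (Ioc 0 T) :=
    (intervalIntegral.intervalIntegrable_rpow' (by linarith) (a := 0) (b := T)).1
  refine IntegrableOn.congr_fun (h1.mul_const ((2 : ℝ)⁻¹ ^ (α - 1))) (fun u hu => ?_) measurableSet_Ioc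
  rw [div_eq_mul_inv]
  exact (Real.mul_rpow hu.1.le (by norm_num)).symm

lemma kern_le_kernBound (hc : 0 ≤ c) (hα1 : α ≤ 1) {T x y z : ℝ} (hx : 0 ≤ x)
    (hy : y ≤ T) (hz : 0 < z → x < y ∧ (y - x) / 2 ≤ z ∧ z ≤ T + 1) :
    kern c lam α z ≤ kernBound c lam α T (y - x) := by
  rcases le_or_gt z 0 with h | h
  · rw [kern_of_nonpos h]; exact kernBound_nonneg hc T _
  · obtain ⟨h1, h2, h3⟩ := hz h
    rw [kern_of_pos h, kernBound, indicator_of_mem (by constructor <;> linarith)]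
    have e1 : -lam * z ≤ |lam| * (T + 1) := by
      calc -lam * z ≤ |lam| * z := by gcongr; exact neg_le_abs lam
        _ ≤ _ := by gcongr
    have e2 : z ^ (α - 1) ≤ ((y - x) / 2) ^ (α - 1) :=
      Real.rpow_le_rpow_of_nonpos (by linarith) h2 (by linarith)
    gcongr

/-- Rounding both endpoints up to the grid loses at most half of the gap `y - x`: a positive
rounded gap is at least `1/n`, and it differs from `y - x` by less than `1/n`. -/
lemma kern_ceil_le (hc : 0 ≤ c) (hα1 : α ≤ 1) {T x y : ℝ} (hx : 0 ≤ x) (hy : y ≤ T)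
    {n : ℕ} (hn : 0 < n) :
    kern c lam α (((⌈(n : ℝ) * y⌉₊ : ℝ) - ⌈(n : ℝ) * x⌉₊) / n) ≤ kernBound c lam α T (y - x) := by
  have hn' : (0 : ℝ) < n := by exact_mod_cast hn
  have hn1 : (1 : ℝ) ≤ n := by exact_mod_cast hn
  refine kern_le_kernBound hc hα1 hx hy fun hz => ?_
  have hlt : (⌈(n : ℝ) * x⌉₊ : ℝ) < ⌈(n : ℝ) * y⌉₊ := by
    rw [div_pos_iff_of_pos_right hn'] at hz; linarith
  have hlt' : (⌈(n : ℝ) * x⌉₊ : ℝ) + 1 ≤ ⌈(n : ℝ) * y⌉₊ := by exact_mod_cast hlt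
  have h1 : (n : ℝ) * x ≤ ⌈(n : ℝ) * x⌉₊ := Nat.le_ceil _
  have h2 : (⌈(n : ℝ) * x⌉₊ : ℝ) < n * x + 1 := Nat.ceil_lt_add_one (by positivity)
  have h3 : (n : ℝ) * y ≤ ⌈(n : ℝ) * y⌉₊ := Nat.le_ceil _
  have hxy : (n : ℝ) * x < n * y := by
    have : ⌈(n : ℝ) * x⌉₊ < ⌈(n : ℝ) * y⌉₊ := by exact_mod_cast hlt
    exact lt_of_le_of_lt h1 (Nat.lt_ceil.1 this)
  have hxy' : x < y := lt_of_mul_lt_mul_left hxy hn'.le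
  have h4 : (⌈(n : ℝ) * y⌉₊ : ℝ) < n * y + 1 := Nat.ceil_lt_add_one (by nlinarith)
  refine ⟨hxy', ?_, ?_⟩
  · rw [le_div_iff₀ hn']; nlinarith
  · rw [div_le_iff₀ hn']; nlinarith

lemma tendsto_ceil_div {x : ℝ} (hx : 0 ≤ x) :
    Tendsto (fun n : ℕ => (⌈(n : ℝ) * x⌉₊ : ℝ) / n) atTop (𝓝 x) := by
  have := (tendsto_nat_ceil_mul_div_atTop hx).comp tendsto_natCast_atTop_atTop
  refine this.congr fun n => ?_
  simp [mul_comm]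

lemma tendsto_floor_div {x : ℝ} (hx : 0 ≤ x) :
    Tendsto (fun n : ℕ => (⌊(n : ℝ) * x⌋₊ : ℝ) / n) atTop (𝓝 x) := by
  have := (tendsto_nat_floor_mul_div_atTop hx).comp tendsto_natCast_atTop_atTop
  refine this.congr fun n => ?_
  simp [mul_comm]

/-- The integer block `(⌊n u⌋, ⌊n v⌋]` that discretizes the interval `(u, v]`. -/
noncomputable def block (n : ℕ) (J : ℝ × ℝ) : ℕ × ℕ := (⌊(n : ℝ) * J.1⌋₊, ⌊(n : ℝ) * J.2⌋₊)

/-- The weight of a jump from `i` to `j` after rescaling space by `n`. -/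
noncomputable def weight (c lam α : ℝ) (n i j : ℕ) : ℝ := kern c lam α (((j : ℝ) - i) / n) / n

lemma weight_eq {n i j : ℕ} (hn : 0 < n) (hij : i < j) :
    weight c lam α n i j = ((n : ℝ) ^ α)⁻¹ * tempered c lam α n (j - i) := by
  have hn' : (0 : ℝ) < n := by exact_mod_cast hn
  have hij' : (0 : ℝ) < (j : ℝ) - i := by rw [sub_pos]; exact_mod_cast hij
  rw [weight, kern_of_pos (by positivity), tempered, Nat.cast_sub hij.le,
    Real.div_rpow hij'.le hn'.le, Real.rpow_sub hn', Real.rpow_one]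
  field_simp

/-- On the grid cell `((j - 1)/n, j/n]` the ceiling `⌈n y⌉` is `j`, and the terms with `j ≤ i`
vanish because the kernel does. -/
lemma chainSum_cons_eq_integral {n : ℕ} (hn : 0 < n) (J : ℝ × ℝ) (l : List (ℕ × ℕ)) (i : ℕ) :
    chainSum (weight c lam α n) (block n J :: l) i =
      ∫ y in Ioc ((⌊(n : ℝ) * J.1⌋₊ : ℝ) / n) ((⌊(n : ℝ) * J.2⌋₊ : ℝ) / n),
        kern c lam α (((⌈(n : ℝ) * y⌉₊ : ℝ) - i) / n) *
          chainSum (weight c lam α n) l ⌈(n : ℝ) * y⌉₊ := by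
  have hn' : (0 : ℝ) < n := by exact_mod_cast hn
  rw [(integral_ceil_eq_sum (fun j => kern c lam α (((j : ℝ) - i) / n) *
    chainSum (weight c lam α n) l j) hn _ _).1, Finset.mul_sum]
  simp only [chainSum, block]
  have hsub : Finset.Ioc (max i ⌊(n : ℝ) * J.1⌋₊) ⌊(n : ℝ) * J.2⌋₊ ⊆
      Finset.Ioc ⌊(n : ℝ) * J.1⌋₊ ⌊(n : ℝ) * J.2⌋₊ :=
    Finset.Ioc_subset_Ioc_left (le_max_right _ _)
  rw [← Finset.sum_subset hsub]
  · refine Finset.sum_congr rfl fun j _ => ?_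
    rw [weight]; ring
  · intro j hj hj'
    rw [Finset.mem_Ioc] at hj hj'
    have : j ≤ i := by by_contra h; exact hj' (by omega)
    have h2 : ((j : ℝ) - i) / n ≤ 0 :=
      div_nonpos_of_nonpos_of_nonneg (by rw [sub_nonpos]; exact_mod_cast this) hn'.le
    rw [kern_of_nonpos h2]; simp

lemma chainSum_weight_nonneg (hc : 0 ≤ c) (n : ℕ) (l : List (ℕ × ℕ)) (i : ℕ) :
    0 ≤ chainSum (weight c lam α n) l i := by
  induction l generalizing i with
  | nil => simp [chainSum]
  | cons J l ih =>
    exact Finset.sum_nonneg fun j _ =>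
      mul_nonneg (div_nonneg (kern_nonneg hc _) (by positivity)) (ih j)

lemma chainSum_weight_bdd (hc : 0 ≤ c) (hα0 : 0 < α) (hα1 : α ≤ 1) {T : ℝ} (l : List (ℝ × ℝ))
    (hl : ∀ J ∈ l, 0 ≤ J.1 ∧ J.2 ≤ T) :
    ∃ C : ℝ, 0 ≤ C ∧ ∀ n : ℕ, 0 < n → ∀ i : ℕ,
      chainSum (weight c lam α n) (l.map (block n)) i ≤ C := by
  induction l with
  | nil => exact ⟨1, by norm_num, fun n _ i => by simp [chainSum]⟩
  | cons J l ih =>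
    obtain ⟨C, hC0, hC⟩ := ih fun J hJ => hl J (by simp [hJ])
    have hI := integrable_kernBound (c := c) (lam := lam) hα0 T
    refine ⟨(∫ u, kernBound c lam α T u) * C,
      mul_nonneg (integral_nonneg fun u => kernBound_nonneg hc T u) hC0, fun n hn i => ?_⟩
    have hn' : (0 : ℝ) < n := by exact_mod_cast hn
    rw [List.map_cons, chainSum_cons_eq_integral hn,
      ← integral_sub_right_eq_self (kernBound c lam α T) ((i : ℝ) / n),
      ← integral_mul_const]
    have hI' : Integrable fun y : ℝ => kernBound c lam α T (y - i / n) * C :=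
      (hI.comp_sub_right _).mul_const C
    refine (integral_mono_of_nonneg ?_ hI'.integrableOn ?_).trans
      (setIntegral_le_integral hI' (Eventually.of_forall fun y =>
        mul_nonneg (kernBound_nonneg hc T _) hC0))
    · exact Eventually.of_forall fun y =>
        mul_nonneg (kern_nonneg hc _) (chainSum_weight_nonneg hc _ _ _)
    · rw [EventuallyLE, ae_restrict_iff' measurableSet_Ioc]
      refine Eventually.of_forall fun y hy => ?_
      have hJ := hl J (by simp)
      have hJ2 : 0 < J.2 := by
        by_contra h
        have : (⌊(n : ℝ) * J.2⌋₊ : ℝ) = 0 := by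
          rw [Nat.floor_of_nonpos (by nlinarith)]; simp
        rw [this, zero_div] at hy
        have : (0 : ℝ) ≤ (⌊(n : ℝ) * J.1⌋₊ : ℝ) / n := by positivity
        linarith [hy.1, hy.2]
      have hyT : y ≤ T := by
        refine hy.2.trans (le_trans ?_ hJ.2)
        rw [div_le_iff₀ hn', mul_comm]
        exact Nat.floor_le (by positivity)
      have hi : ⌈(n : ℝ) * ((i : ℝ) / n)⌉₊ = i := by
        rw [mul_div_cancel₀ _ hn'.ne', Nat.ceil_natCast]
      have := kern_ceil_le (lam := lam) hc hα1 (x := (i : ℝ) / n) (by positivity) hyT hn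
      rw [hi] at this
      exact mul_le_mul this (hC n hn _) (chainSum_weight_nonneg hc _ _ _)
        (kernBound_nonneg hc T _)

/-- One step of the passage to the limit: the discretized integral of `κₙ hₙ` over a block
converges when `κₙ → κ` almost everywhere under an integrable bound and `hₙ → h` boundedly. -/
lemma tendsto_block_integral {T C : ℝ} {J : ℝ × ℝ} (hJ1 : 0 ≤ J.1) (hJT : J.2 ≤ T)
    {κ : ℕ → ℕ → ℝ} {κ' : ℝ → ℝ} {Φ : ℝ → ℝ} (hΦ : Integrable Φ)
    (hκ : ∀ n : ℕ, 0 < n → ∀ y, 0 ≤ y → y ≤ T → |κ n ⌈(n : ℝ) * y⌉₊| ≤ Φ y) (hΦ0 : ∀ y, 0 ≤ Φ y)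
    (hκ' : ∀ᵐ y, 0 ≤ y → Tendsto (fun n : ℕ => κ n ⌈(n : ℝ) * y⌉₊) atTop (𝓝 (κ' y)))
    {h : ℕ → ℕ → ℝ} {h' : ℝ → ℝ} (hh : ∀ n : ℕ, 0 < n → ∀ i, |h n i| ≤ C)
    (hh' : ∀ y, 0 ≤ y → Tendsto (fun n : ℕ => h n ⌈(n : ℝ) * y⌉₊) atTop (𝓝 (h' y))) :
    Tendsto (fun n : ℕ => ∫ y in Ioc ((⌊(n : ℝ) * J.1⌋₊ : ℝ) / n) ((⌊(n : ℝ) * J.2⌋₊ : ℝ) / n),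
      κ n ⌈(n : ℝ) * y⌉₊ * h n ⌈(n : ℝ) * y⌉₊) atTop
      (𝓝 (∫ y in Ioc J.1 J.2, κ' y * h' y)) := by
  have hC0 : 0 ≤ C := (abs_nonneg _).trans (hh 1 one_pos 0)
  simp_rw [← integral_indicator measurableSet_Ioc]
  refine tendsto_integral_filter_of_dominated_convergence (fun y => Φ y * C) ?_ ?_ (hΦ.mul_const C) ?_
  · refine Eventually.of_forall fun n => ?_
    refine Measurable.aestronglyMeasurable (Measurable.indicator ?_ measurableSet_Ioc)
    exact (measurable_of_countable (fun j : ℕ => κ n j * h n j)).comp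
      (Nat.measurable_ceil.comp (measurable_const_mul _))
  · filter_upwards [eventually_gt_atTop 0] with n hn
    refine Eventually.of_forall fun y => ?_
    have hn' : (0 : ℝ) < n := by exact_mod_cast hn
    by_cases hy : y ∈ Ioc ((⌊(n : ℝ) * J.1⌋₊ : ℝ) / n) ((⌊(n : ℝ) * J.2⌋₊ : ℝ) / n)
    · rw [indicator_of_mem hy, Real.norm_eq_abs, abs_mul]
      have hJ2 : 0 < J.2 := by
        by_contra h
        have : (⌊(n : ℝ) * J.2⌋₊ : ℝ) = 0 := by
          rw [Nat.floor_of_nonpos (by nlinarith)]; simp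
        rw [this, zero_div] at hy
        have : (0 : ℝ) ≤ (⌊(n : ℝ) * J.1⌋₊ : ℝ) / n := by positivity
        linarith [hy.1, hy.2]
      have hyT : y ≤ T := by
        refine hy.2.trans (le_trans ?_ hJT)
        rw [div_le_iff₀ hn', mul_comm]
        exact Nat.floor_le (by positivity)
      have hy0 : 0 ≤ y := le_trans (by positivity) hy.1.le
      exact mul_le_mul (hκ n hn y hy0 hyT) (hh n hn _) (abs_nonneg _) (hΦ0 y)
    · rw [indicator_of_notMem hy]; simpa using mul_nonneg (hΦ0 y) hC0
  · have hne1 : ∀ᵐ y : ℝ, y ≠ J.1 := by simp [ae_iff, measure_singleton]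
    have hne2 : ∀ᵐ y : ℝ, y ≠ J.2 := by simp [ae_iff, measure_singleton]
    filter_upwards [hne1, hne2, hκ'] with y h1 h2 h3
    have hf1 := tendsto_floor_div hJ1
    by_cases hy : y ∈ Ioc J.1 J.2
    · have hy0 : 0 ≤ y := hJ1.trans hy.1.le
      have hf2 := tendsto_floor_div (hJ1.trans (hy.1.le.trans hy.2))
      rw [indicator_of_mem hy]
      refine ((h3 hy0).mul (hh' y hy0)).congr' ?_
      filter_upwards [hf1.eventually_lt_const hy.1,
        hf2.eventually_const_lt (lt_of_le_of_ne hy.2 h2)] with n e1 e2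
      rw [indicator_of_mem (show y ∈ Ioc _ _ from ⟨e1, e2.le⟩)]
    · rw [indicator_of_notMem hy]
      refine tendsto_const_nhds.congr' ?_
      rcases lt_or_ge y J.1 with h | h
      · filter_upwards [hf1.eventually_const_lt h] with n e1
        rw [indicator_of_notMem (fun hy => by linarith [hy.1])]
      · have hlt : J.2 < y := by
          by_contra h'
          exact hy ⟨lt_of_le_of_ne h (Ne.symm h1), not_lt.1 h'⟩
        filter_upwards [eventually_gt_atTop 0] with n hn
        have hn' : (0 : ℝ) < n := by exact_mod_cast hn
        rw [indicator_of_notMem]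
        rintro ⟨e1, e2⟩
        rcases le_or_gt 0 J.2 with h0 | h0
        · have : (⌊(n : ℝ) * J.2⌋₊ : ℝ) / n ≤ J.2 := by
            rw [div_le_iff₀ hn', mul_comm]; exact Nat.floor_le (by positivity)
          linarith
        · have : (⌊(n : ℝ) * J.2⌋₊ : ℝ) = 0 := by
            rw [Nat.floor_of_nonpos (by nlinarith)]; simp
          rw [this, zero_div] at e2
          have : (0 : ℝ) ≤ (⌊(n : ℝ) * J.1⌋₊ : ℝ) / n := by positivity
          linarith

lemma tendsto_chainSum (hc : 0 ≤ c) (hα0 : 0 < α) (hα1 : α ≤ 1) {T : ℝ} (l : List (ℝ × ℝ))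
    (hl : ∀ J ∈ l, 0 ≤ J.1 ∧ J.2 ≤ T) {x : ℝ} (hx : 0 ≤ x) :
    Tendsto (fun n : ℕ => chainSum (weight c lam α n) (l.map (block n)) ⌈(n : ℝ) * x⌉₊) atTop
      (𝓝 (chainInt (kern c lam α) l x)) := by
  induction l generalizing x with
  | nil => simp [chainSum, chainInt]
  | cons J l ih =>
    have hl' : ∀ J ∈ l, 0 ≤ J.1 ∧ J.2 ≤ T := fun J hJ => hl J (by simp [hJ])
    obtain ⟨C, hC0, hC⟩ := chainSum_weight_bdd (lam := lam) hc hα0 hα1 l hl'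
    have hJ := hl J (by simp)
    have key := tendsto_block_integral (J := J) (T := T) (C := C) hJ.1 hJ.2
      (κ := fun n j => kern c lam α (((j : ℝ) - ⌈(n : ℝ) * x⌉₊) / n))
      (κ' := fun y => kern c lam α (y - x)) (Φ := fun y => kernBound c lam α T (y - x))
      ((integrable_kernBound hα0 T).comp_sub_right x)
      (fun n hn y _ hy => by
        rw [abs_of_nonneg (kern_nonneg hc _)]; exact kern_ceil_le hc hα1 hx hy hn)
      (fun y => kernBound_nonneg hc T _) ?_
      (h := fun n => chainSum (weight c lam α n) (l.map (block n)))
      (h' := chainInt (kern c lam α) l)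
      (fun n hn i => by
        rw [abs_of_nonneg (chainSum_weight_nonneg hc _ _ _)]; exact hC n hn i)
      (fun y hy => ih hl' hy)
    · refine key.congr' ?_
      filter_upwards [eventually_gt_atTop 0] with n hn
      rw [List.map_cons, chainSum_cons_eq_integral hn]
    · have hne : ∀ᵐ y : ℝ, y ≠ x := by simp [ae_iff, measure_singleton]
      filter_upwards [hne] with y hy hy0
      refine (continuousAt_kern (sub_ne_zero.2 hy)).tendsto.comp ?_
      refine ((tendsto_ceil_div hy0).sub (tendsto_ceil_div hx)).congr fun n => ?_
      ring

/-- The factor `f(N)` contributes the value of the kernel at the terminal time. -/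
lemma tendsto_scaled_tempered {T : ℝ} (hT : 0 < T) :
    Tendsto (fun n : ℕ => (n : ℝ) / (n : ℝ) ^ α * tempered c lam α n ⌊(n : ℝ) * T⌋₊) atTop
      (𝓝 (kern c lam α T)) := by
  have h1 := (continuousAt_kern (c := c) (lam := lam) (α := α) hT.ne').tendsto.comp
    (tendsto_floor_div hT.le)
  refine h1.congr' ?_
  filter_upwards [eventually_gt_atTop 0, (tendsto_floor_div hT.le).eventually_const_lt hT]
    with n hn hpos
  have hn' : (0 : ℝ) < n := by exact_mod_cast hn
  have hN : (0 : ℝ) < ⌊(n : ℝ) * T⌋₊ := by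
    rwa [div_pos_iff_of_pos_right hn'] at hpos
  simp only [Function.comp]
  rw [kern_of_pos hpos, tempered, Real.div_rpow hN.le hn'.le, Real.rpow_sub hn', Real.rpow_one]
  field_simp

lemma aT_eq (b T : ℝ) (hT : 0 < T) : aT α b c lam T = b * kern c lam α T := by
  rw [aT, kern_of_pos hT]; ring

/-- The rescaled expected chain sum of a generalized Bernoulli process converges to the
corresponding iterated integral. -/
lemma tendsto_expected_chainSum (hc : 0 ≤ c) (hα0 : 0 < α) (hα1 : α ≤ 1) {T : ℝ} (hT : 0 < T)
    (b : ℝ) (J : ℝ × ℝ) (l : List (ℝ × ℝ)) (hl : ∀ J' ∈ J :: l, 0 ≤ J'.1 ∧ J'.2 ≤ T) :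
    Tendsto (fun n : ℕ => (((n : ℝ) ^ α)⁻¹) ^ (l.length + 1) *
        (b * tempered c lam α n ⌊(n : ℝ) * T⌋₊ *
          ∑ j ∈ Finset.Ioc (block n J).1 (block n J).2,
            chainSum (fun i j => tempered c lam α n (j - i)) (l.map (block n)) j)) atTop
      (𝓝 (aT α b c lam T * ∫ y in Ioc J.1 J.2, chainInt (kern c lam α) l y)) := by
  have hl' : ∀ J ∈ l, 0 ≤ J.1 ∧ J.2 ≤ T := fun J hJ => hl J (by simp [hJ])
  obtain ⟨C, hC0, hC⟩ := chainSum_weight_bdd (lam := lam) hc hα0 hα1 l hl'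
  have hJ := hl J (by simp)
  have key := tendsto_block_integral (J := J) (T := T) (C := C) hJ.1 hJ.2
    (κ := fun _ _ => 1) (κ' := fun _ => 1) (Φ := (Icc 0 T).indicator fun _ => (1 : ℝ))
    ((integrable_indicator_iff measurableSet_Icc).2 (integrableOn_const (by simp)))
    (fun n hn y hy0 hy => by rw [indicator_of_mem (show y ∈ Icc 0 T from ⟨hy0, hy⟩)]; simp)
    (fun y => indicator_nonneg (fun _ _ => zero_le_one) _)
    (Eventually.of_forall fun y _ => tendsto_const_nhds)
    (h := fun n => chainSum (weight c lam α n) (l.map (block n)))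
    (h' := chainInt (kern c lam α) l)
    (fun n hn i => by
      rw [abs_of_nonneg (chainSum_weight_nonneg hc _ _ _)]; exact hC n hn i)
    (fun y hy => tendsto_chainSum hc hα0 hα1 l hl' hy)
  simp only [one_mul] at key
  rw [aT_eq b T hT]
  refine (((tendsto_scaled_tempered hT).const_mul b).mul key).congr' ?_
  filter_upwards [eventually_gt_atTop 0] with n hn
  have hn' : (0 : ℝ) < n := by exact_mod_cast hn
  rw [(integral_ceil_eq_sum (fun j => chainSum (weight c lam α n) (l.map (block n)) j) hn _ _).1]
  have e2 : ∀ j, chainSum (weight c lam α n) (l.map (block n)) j =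
      (((n : ℝ) ^ α)⁻¹) ^ l.length *
        chainSum (fun i j => tempered c lam α n (j - i)) (l.map (block n)) j := by
    intro j
    have := chainSum_smul ((n : ℝ) ^ α)⁻¹ (fun i j => tempered c lam α n (j - i))
      (l.map (block n)) j
    rw [List.length_map] at this
    rw [← this]
    clear this
    generalize l.map (block n) = l₀
    induction l₀ generalizing j with
    | nil => rfl
    | cons J₀ l₀ ih =>
      refine Finset.sum_congr rfl fun r hr => ?_
      rw [Finset.mem_Ioc] at hr
      rw [weight_eq hn (by omega), ih]
  simp only [e2, ← Finset.mul_sum, block]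
  rw [pow_succ]
  field_simp

end Kernel

open SkorokhodSpace

/-! ### Moments of the random walk -/

lemma map_flat {β γ : Type*} (g : β → γ) (J : ℕ → β) (k : ℕ → ℕ) (i m : ℕ) :
    (flat J k i m).map g = flat (fun r => g (J r)) k i m := by
  induction m generalizing i with
  | zero => rfl
  | succ m ih => simp [flat, ih]

lemma length_flat {β : Type*} (J : ℕ → β) (k : ℕ → ℕ) (i m : ℕ) :
    (flat J k i m).length = ∑ r ∈ Finset.Ico i (i + m), k r := by
  induction m generalizing i with
  | zero => simp [flat]
  | succ m ih =>
    rw [flat, List.length_append, List.length_replicate, ih,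
      Finset.sum_eq_sum_Ico_succ_bot (a := i) (b := i + (m + 1)) (by omega),
      show i + 1 + m = i + (m + 1) by omega]

/-- Powers and falling factorials differ by a term of lower order. -/
lemma pow_succ_le_descFactorial (S k : ℕ) :
    (S : ℝ) ^ (k + 1) ≤ S.descFactorial (k + 1) + ((k + 1 : ℕ) : ℝ) ^ 2 * (S : ℝ) ^ k := by
  induction k with
  | zero => simp
  | succ k ih =>
    have h2 : (S.descFactorial (k + 1) : ℝ) ≤ (S : ℝ) ^ (k + 1) := by
      exact_mod_cast Nat.descFactorial_le_pow S (k + 1)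
    have h3 : (S : ℝ) * S.descFactorial (k + 1) ≤
        S.descFactorial (k + 2) + (k + 1 : ℕ) * S.descFactorial (k + 1) := by
      rw [Nat.descFactorial_succ S (k + 1)]
      rcases le_total (k + 1) S with h | h
      · push_cast [Nat.cast_sub h]; linarith
      · rw [Nat.sub_eq_zero_of_le h]
        have : (S : ℝ) ≤ (k + 1 : ℕ) := by exact_mod_cast h
        rw [zero_mul, Nat.cast_zero, zero_add]
        gcongr
    calc (S : ℝ) ^ (k + 1 + 1) = S * (S : ℝ) ^ (k + 1) := by ring
      _ ≤ S * (S.descFactorial (k + 1) + ((k + 1 : ℕ) : ℝ) ^ 2 * (S : ℝ) ^ k) := by gcongr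
      _ ≤ (S.descFactorial (k + 2) + (k + 1 : ℕ) * (S : ℝ) ^ (k + 1)) +
            ((k + 1 : ℕ) : ℝ) ^ 2 * (S : ℝ) ^ (k + 1) := by
          rw [mul_add, pow_succ (S : ℝ) k]
          refine add_le_add (h3.trans ?_) (le_of_eq (by ring))
          rw [← pow_succ]
          gcongr
      _ ≤ _ := by
          push_cast
          have : (0 : ℝ) ≤ (k + 2) * (S : ℝ) ^ (k + 1) := by positivity
          nlinarith

lemma scaled_pow_succ_le (S k : ℕ) {a : ℝ} (ha : 0 < a) :
    ((S : ℝ) / a) ^ (k + 1) ≤ S.descFactorial (k + 1) / a ^ (k + 1) +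
      ((k + 1 : ℕ) : ℝ) ^ 2 / a * ((S : ℝ) / a) ^ k := by
  have h := div_le_div_of_nonneg_right (pow_succ_le_descFactorial S k) (pow_nonneg ha.le (k + 1))
  rw [div_pow]
  refine h.trans (le_of_eq ?_)
  rw [add_div, div_pow, pow_succ a k]
  field_simp

lemma abs_pow_sub_descFactorial_le (S k : ℕ) {a : ℝ} (ha : 0 < a) :
    |((S : ℝ) / a) ^ k - S.descFactorial k / a ^ k| ≤ (1 + (S : ℝ) / a) ^ k * (k ^ 2 / a) := by
  have h0 : (S.descFactorial k : ℝ) ≤ (S : ℝ) ^ k := by exact_mod_cast Nat.descFactorial_le_pow S k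
  have h1 : (S.descFactorial k : ℝ) / a ^ k ≤ ((S : ℝ) / a) ^ k := by rw [div_pow]; gcongr
  rw [abs_of_nonneg (by linarith)]
  cases k with
  | zero => simp
  | succ k =>
    have h2 := scaled_pow_succ_le S k ha
    have hy : (0 : ℝ) ≤ (S : ℝ) / a := by positivity
    have h3 : ((S : ℝ) / a) ^ k ≤ (1 + (S : ℝ) / a) ^ (k + 1) := by
      calc ((S : ℝ) / a) ^ k ≤ (1 + (S : ℝ) / a) ^ k := by gcongr; linarith
        _ ≤ _ := pow_le_pow_right₀ (by linarith) (by omega)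
    have h4 : ((k + 1 : ℕ) : ℝ) ^ 2 / a * ((S : ℝ) / a) ^ k ≤
        ((k + 1 : ℕ) : ℝ) ^ 2 / a * (1 + (S : ℝ) / a) ^ (k + 1) := by gcongr
    linarith

/-- The `0`-`1` sequence of natural numbers underlying the process. -/
noncomputable def bit {Ω : Type*} (ξ : ℕ → Ω → ℝ) (ω : Ω) (j : ℕ) : ℕ :=
  open Classical in if ξ j ω = 1 then 1 else 0

lemma bit_le_one {Ω : Type*} (ξ : ℕ → Ω → ℝ) (ω : Ω) (j : ℕ) : bit ξ ω j ≤ 1 := by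
  unfold bit; split_ifs <;> simp

lemma clamp_walk {Ω : Type*} {ξ : ℕ → Ω → ℝ} {α T : ℝ} {n : ℕ} (hT : 0 ≤ T) (ω : Ω) (t : ℝ) :
    clamp hT (walk α T n ξ ω) t =
      (∑ i ∈ Finset.Ioc 0 ⌊(n : ℝ) * max 0 (min T t)⌋₊, ξ i ω) / (n : ℝ) ^ α := by
  rw [walk, clamp_step]; rfl

section Walk

variable {Ω : Type*} [MeasurableSpace Ω] {P : Measure Ω} {f : ℕ → ℝ}
  {b : ℝ} {N : ℕ} {ξ : ℕ → Ω → ℝ} {α T : ℝ} {n : ℕ}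

lemma IsGBP.coe_bit (h : IsGBP f b N ξ P) (ω : Ω) {j : ℕ} (hj : j ∈ Finset.Icc 1 N) :
    (bit ξ ω j : ℝ) = ξ j ω := by
  unfold bit
  rcases h.binary j hj ω with h | h <;> simp [h]

lemma floor_clamp_le (hT : 0 ≤ T) (t : ℝ) : ⌊(n : ℝ) * max 0 (min T t)⌋₊ ≤ ⌊(n : ℝ) * T⌋₊ := by
  apply Nat.floor_le_floor
  gcongr
  exact max_le hT (min_le_left _ _)

/-- An increment of the walk is the rescaled number of ones in a block. -/
lemma IsGBP.clamp_walk_sub (h : IsGBP f b ⌊(n : ℝ) * T⌋₊ ξ P) (hT : 0 ≤ T) (ω : Ω) {u v : ℝ}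
    (hu : 0 ≤ u) (huv : u ≤ v) (hv : v ≤ T) :
    clamp hT (walk α T n ξ ω) v - clamp hT (walk α T n ξ ω) u =
      ((∑ j ∈ Finset.Ioc (block n (u, v)).1 (block n (u, v)).2, bit ξ ω j : ℕ) : ℝ) /
        (n : ℝ) ^ α := by
  have hle : ⌊(n : ℝ) * u⌋₊ ≤ ⌊(n : ℝ) * v⌋₊ := Nat.floor_le_floor (by gcongr)
  have hle' : ⌊(n : ℝ) * v⌋₊ ≤ ⌊(n : ℝ) * T⌋₊ := Nat.floor_le_floor (by gcongr)
  rw [clamp_walk, clamp_walk, min_eq_right hv, min_eq_right (huv.trans hv), max_eq_right hu,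
    max_eq_right (hu.trans huv), ← sub_div, ← Finset.sum_Ioc_consecutive _ (Nat.zero_le _) hle,
    add_sub_cancel_left]
  congr 1
  push_cast
  refine Finset.sum_congr rfl fun j hj => (h.coe_bit ω ?_).symm
  rw [Finset.mem_Ioc] at hj
  rw [Finset.mem_Icc]
  simp only [block] at hj
  omega

lemma IsGBP.walk_mem_incrPaths (h : IsGBP f b ⌊(n : ℝ) * T⌋₊ ξ P) (hT : 0 ≤ T) (ω : Ω) :
    walk α T n ξ ω ∈ incrPaths hT := by
  constructor
  · rw [clamp_walk, min_eq_right hT, max_self]; simp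
  · intro s t hst
    rw [clamp_walk, clamp_walk]
    have := floor_clamp_le (n := n) hT t
    refine div_le_div_of_nonneg_right ?_ (by positivity)
    refine Finset.sum_le_sum_of_subset_of_nonneg (Finset.Ioc_subset_Ioc_right
      (Nat.floor_le_floor (by gcongr))) fun j hj _ => ?_
    rw [Finset.mem_Ioc] at hj
    rw [← h.coe_bit ω (Finset.mem_Icc.2 (by omega))]
    positivity

lemma IsGBP.measurable_clamp_walk (h : IsGBP f b ⌊(n : ℝ) * T⌋₊ ξ P) (hT : 0 ≤ T) (t : ℝ) :
    Measurable fun ω => clamp hT (walk α T n ξ ω) t := by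
  simp only [clamp_walk]
  refine Measurable.div_const (Finset.measurable_sum _ fun j hj => h.measurable j ?_) _
  have := floor_clamp_le (n := n) hT t
  rw [Finset.mem_Ioc] at hj
  rw [Finset.mem_Icc]
  omega

/-- The expectation of a product of falling factorials of block counts. -/
lemma IsGBP.integral_prod_descFactorial [IsProbabilityMeasure P] (h : IsGBP f b N ξ P)
    (J : ℕ → ℕ × ℕ) (k : ℕ → ℕ) (i m : ℕ)
    (hJ : ∀ r ∈ Finset.Ico i (i + m), (J r).1 ≤ (J r).2 ∧ (J r).2 ≤ N)
    (hJ' : ∀ r ∈ Finset.Ico i (i + m), ∀ r' ∈ Finset.Ico i (i + m), r < r' → (J r).2 ≤ (J r').1)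
    {J₀ : ℕ × ℕ} {l : List (ℕ × ℕ)} (hl : flat J k i m = J₀ :: l) :
    Integrable (fun ω => ∏ r ∈ Finset.Ico i (i + m),
      (((∑ j ∈ Finset.Ioc (J r).1 (J r).2, bit ξ ω j).descFactorial (k r) : ℕ) : ℝ)) P ∧
    ∫ ω, ∏ r ∈ Finset.Ico i (i + m),
      (((∑ j ∈ Finset.Ioc (J r).1 (J r).2, bit ξ ω j).descFactorial (k r) : ℕ) : ℝ) ∂P =
      (∏ r ∈ Finset.Ico i (i + m), ((k r).factorial : ℝ)) *
        (b * f N * ∑ j ∈ Finset.Ioc J₀.1 J₀.2, chainSum (fun i j => f (j - i)) l j) := by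
  have hN : ∀ z ∈ J₀ :: l, z.2 ≤ N := fun z hz => by
    rw [← hl] at hz
    obtain ⟨r, hr, rfl⟩ := mem_flat J k hz
    exact (hJ r hr).2
  have e : ∀ ω, ∏ r ∈ Finset.Ico i (i + m),
      (((∑ j ∈ Finset.Ioc (J r).1 (J r).2, bit ξ ω j).descFactorial (k r) : ℕ) : ℝ) =
      (∏ r ∈ Finset.Ico i (i + m), ((k r).factorial : ℝ)) *
        chainSum (fun _ j => ξ j ω) (J₀ :: l) 0 := fun ω => by
    rw [chainSum_congr (w' := fun _ j => (bit ξ ω j : ℝ))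
      (fun _ j hj => (h.coe_bit ω hj).symm) _ hN, ← hl,
      chainSum_flat (bit ξ ω) (bit_le_one ξ ω) J k i m 0 (fun r hr => (hJ r hr).1) hJ'
        (fun _ => Nat.zero_le _), ← Finset.prod_mul_distrib]
    refine Finset.prod_congr rfl fun r _ => ?_
    rw [Nat.descFactorial_eq_factorial_mul_choose]
    push_cast; rfl
  have key := h.integral_chainSum J₀ l hN
  simp only [e]
  exact ⟨key.1.const_mul _, by rw [integral_const_mul, key.2]⟩

end Walk

section Limit

variable {Ω' : ℕ → Type*} [∀ n, MeasurableSpace (Ω' n)] {P' : ∀ n, Measure (Ω' n)}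
  [∀ n, IsProbabilityMeasure (P' n)] {ξ : ∀ n, ℕ → Ω' n → ℝ} {α b c lam T : ℝ}

/-- Rescaled mixed factorial moments of the counts in ordered blocks converge. -/
lemma tendsto_factorialMoment (hT : 0 < T) (hα0 : 0 < α) (hα1 : α ≤ 1) (hc : 0 ≤ c)
    (hξ : ∀ᶠ n in atTop, IsGBP (tempered c lam α n) b ⌊(n : ℝ) * T⌋₊ (ξ n) (P' n))
    (J : ℕ → ℝ × ℝ) (k : ℕ → ℕ) (i m : ℕ)
    (hJ : ∀ r ∈ Finset.Ico i (i + m), 0 ≤ (J r).1 ∧ (J r).1 ≤ (J r).2 ∧ (J r).2 ≤ T)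
    (hJ' : ∀ r ∈ Finset.Ico i (i + m), ∀ r' ∈ Finset.Ico i (i + m), r < r' → (J r).2 ≤ (J r').1)
    {J₀ : ℝ × ℝ} {l : List (ℝ × ℝ)} (hl : flat J k i m = J₀ :: l) :
    (∀ᶠ n in atTop, Integrable (fun ω => ∏ r ∈ Finset.Ico i (i + m),
      ((∑ j ∈ Finset.Ioc (block n (J r)).1 (block n (J r)).2, bit (ξ n) ω j).descFactorial (k r) : ℝ)
        / ((n : ℝ) ^ α) ^ k r) (P' n)) ∧
    Tendsto (fun n : ℕ => ∫ ω, ∏ r ∈ Finset.Ico i (i + m),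
      ((∑ j ∈ Finset.Ioc (block n (J r)).1 (block n (J r)).2, bit (ξ n) ω j).descFactorial (k r) : ℝ)
        / ((n : ℝ) ^ α) ^ k r ∂P' n) atTop
      (𝓝 ((∏ r ∈ Finset.Ico i (i + m), ((k r).factorial : ℝ)) *
        (aT α b c lam T * ∫ y in Ioc J₀.1 J₀.2, chainInt (kern c lam α) l y))) := by
  have hll : ∀ z ∈ J₀ :: l, 0 ≤ z.1 ∧ z.2 ≤ T := fun z hz => by
    rw [← hl] at hz
    obtain ⟨r, hr, rfl⟩ := mem_flat J k hz
    exact ⟨(hJ r hr).1, (hJ r hr).2.2⟩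
  have hlen : l.length + 1 = ∑ r ∈ Finset.Ico i (i + m), k r := by
    rw [← length_flat J, hl]; rfl
  have main : ∀ᶠ n in atTop, Integrable (fun ω => ∏ r ∈ Finset.Ico i (i + m),
      ((∑ j ∈ Finset.Ioc (block n (J r)).1 (block n (J r)).2, bit (ξ n) ω j).descFactorial (k r) : ℝ)
        / ((n : ℝ) ^ α) ^ k r) (P' n) ∧
      ∫ ω, ∏ r ∈ Finset.Ico i (i + m),
      ((∑ j ∈ Finset.Ioc (block n (J r)).1 (block n (J r)).2, bit (ξ n) ω j).descFactorial (k r) : ℝ)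
        / ((n : ℝ) ^ α) ^ k r ∂P' n = (∏ r ∈ Finset.Ico i (i + m), ((k r).factorial : ℝ)) *
        ((((n : ℝ) ^ α)⁻¹) ^ (l.length + 1) *
        (b * tempered c lam α n ⌊(n : ℝ) * T⌋₊ *
          ∑ j ∈ Finset.Ioc (block n J₀).1 (block n J₀).2,
            chainSum (fun i j => tempered c lam α n (j - i)) (l.map (block n)) j)) := by
    filter_upwards [hξ] with n hn
    have hfl : ∀ {x y : ℝ}, x ≤ y → ⌊(n : ℝ) * x⌋₊ ≤ ⌊(n : ℝ) * y⌋₊ := fun hxy =>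
      Nat.floor_le_floor (by gcongr)
    have key := hn.integral_prod_descFactorial (fun r => block n (J r)) k i m
      (fun r hr => ⟨hfl (hJ r hr).2.1, hfl (hJ r hr).2.2⟩)
      (fun r hr r' hr' hrr => hfl (hJ' r hr r' hr' hrr))
      (J₀ := block n J₀) (l := l.map (block n)) (by rw [← map_flat, hl]; rfl)
    simp only [Finset.prod_div_distrib, Finset.prod_pow_eq_pow_sum, ← hlen]
    refine ⟨key.1.div_const _, ?_⟩
    rw [integral_div, key.2, inv_pow]
    ring
  refine ⟨main.mono fun n hn => hn.1, ?_⟩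
  refine ((tendsto_expected_chainSum hc hα0 hα1 hT b J₀ l hll).const_mul _).congr' ?_
  exact main.mono fun n hn => hn.2.symm

/-- The moments of the rescaled walk at the terminal time are bounded. -/
lemma walk_moment_bdd (hT : 0 < T) (hα0 : 0 < α) (hα1 : α ≤ 1) (hc : 0 ≤ c)
    (hξ : ∀ᶠ n in atTop, IsGBP (tempered c lam α n) b ⌊(n : ℝ) * T⌋₊ (ξ n) (P' n)) (k : ℕ) :
    ∃ C, ∀ᶠ n in atTop, Integrable (fun ω => clamp hT.le (walk α T n (ξ n) ω) T ^ k) (P' n) ∧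
      ∫ ω, clamp hT.le (walk α T n (ξ n) ω) T ^ k ∂P' n ≤ C := by
  induction k with
  | zero => exact ⟨1, Eventually.of_forall fun n => by simp⟩
  | succ k ih =>
    obtain ⟨C, hC⟩ := ih
    have hlim := tendsto_factorialMoment (b := b) (lam := lam) hT hα0 hα1 hc hξ (fun _ => (0, T))
      (fun _ => k + 1) 0 1 (by simp [hT.le]) (by simp) (J₀ := (0, T))
      (l := List.replicate k (0, T)) (by simp [flat, List.replicate_succ])
    simp only [zero_add, Nat.Ico_zero_eq_range, Finset.prod_range_one] at hlim
    obtain ⟨hi, hlim⟩ := hlim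
    obtain ⟨C', hC'⟩ := hlim.isBoundedUnder_le
    rw [eventually_map] at hC'
    refine ⟨C' + (k + 1 : ℕ) ^ 2 * C, ?_⟩
    filter_upwards [hC, hi, hC', hξ, eventually_ge_atTop 1] with n h1 h2 h3 h4 h5
    have hn1 : (1 : ℝ) ≤ n := by exact_mod_cast h5
    have ha : 1 ≤ (n : ℝ) ^ α := Real.one_le_rpow hn1 hα0.le
    have hy : ∀ ω, clamp hT.le (walk α T n (ξ n) ω) T =
        ((∑ j ∈ Finset.Ioc (block n (0, T)).1 (block n (0, T)).2, bit (ξ n) ω j : ℕ) : ℝ) /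
          (n : ℝ) ^ α := fun ω => by
      rw [← h4.clamp_walk_sub hT.le ω le_rfl hT.le le_rfl, (h4.walk_mem_incrPaths hT.le ω).1,
        sub_zero]
    have h0 : ∀ ω, 0 ≤ clamp hT.le (walk α T n (ξ n) ω) T := fun ω => by rw [hy]; positivity
    have hle : ∀ ω, clamp hT.le (walk α T n (ξ n) ω) T ^ (k + 1) ≤
        ((∑ j ∈ Finset.Ioc (block n (0, T)).1 (block n (0, T)).2,
          bit (ξ n) ω j).descFactorial (k + 1) : ℝ) / ((n : ℝ) ^ α) ^ (k + 1) +
        ((k + 1 : ℕ) : ℝ) ^ 2 * clamp hT.le (walk α T n (ξ n) ω) T ^ k := fun ω => by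
      have := scaled_pow_succ_le (∑ j ∈ Finset.Ioc (block n (0, T)).1 (block n (0, T)).2,
        bit (ξ n) ω j) k (a := (n : ℝ) ^ α) (by positivity)
      rw [← hy] at this
      refine this.trans ?_
      gcongr
      · exact pow_nonneg (h0 ω) k
      · exact div_le_self (by positivity) ha
    have hint := h2.add (h1.1.const_mul (((k + 1 : ℕ) : ℝ) ^ 2))
    have hint' : Integrable (fun ω => clamp hT.le (walk α T n (ξ n) ω) T ^ (k + 1)) (P' n) := by
      refine hint.mono' ((h4.measurable_clamp_walk hT.le T).pow_const _).aestronglyMeasurable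
        (Eventually.of_forall fun ω => ?_)
      rw [Real.norm_eq_abs, abs_of_nonneg (pow_nonneg (h0 ω) _)]
      exact hle ω
    refine ⟨hint', (integral_mono hint' hint hle).trans ?_⟩
    simp only [Pi.add_apply]
    rw [integral_add h2 (h1.1.const_mul _), integral_const_mul]
    refine add_le_add h3 ?_
    gcongr
    exact h1.2

/-- The mixed moments of increments of the rescaled walk over ordered intervals converge to
iterated integrals. -/
theorem tendsto_walk_moment (hT : 0 < T) (hα0 : 0 < α) (hα1 : α ≤ 1) (hc : 0 ≤ c)
    (hξ : ∀ᶠ n in atTop, IsGBP (tempered c lam α n) b ⌊(n : ℝ) * T⌋₊ (ξ n) (P' n))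
    (J : ℕ → ℝ × ℝ) (k : ℕ → ℕ) (i m : ℕ)
    (hJ : ∀ r ∈ Finset.Ico i (i + m), 0 ≤ (J r).1 ∧ (J r).1 ≤ (J r).2 ∧ (J r).2 ≤ T)
    (hJ' : ∀ r ∈ Finset.Ico i (i + m), ∀ r' ∈ Finset.Ico i (i + m), r < r' → (J r).2 ≤ (J r').1)
    {J₀ : ℝ × ℝ} {l : List (ℝ × ℝ)} (hl : flat J k i m = J₀ :: l) :
    Tendsto (fun n : ℕ => ∫ ω, ∏ r ∈ Finset.Ico i (i + m),
      (clamp hT.le (walk α T n (ξ n) ω) (J r).2 - clamp hT.le (walk α T n (ξ n) ω) (J r).1) ^ k r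
        ∂P' n) atTop
      (𝓝 ((∏ r ∈ Finset.Ico i (i + m), ((k r).factorial : ℝ)) *
        (aT α b c lam T * ∫ y in Ioc J₀.1 J₀.2, chainInt (kern c lam α) l y))) := by
  obtain ⟨hi, hlim⟩ := tendsto_factorialMoment (b := b) (lam := lam) hT hα0 hα1 hc hξ J k i m hJ hJ' hl
  set s := Finset.Ico i (i + m) with hs
  set K := ∑ r ∈ s, k r with hK
  have hmom := walk_moment_bdd (b := b) (lam := lam) hT hα0 hα1 hc hξ
  obtain ⟨C, hC⟩ := hmom K
  have hnα : Tendsto (fun n : ℕ => (n : ℝ) ^ α) atTop atTop :=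
    (tendsto_rpow_atTop hα0).comp tendsto_natCast_atTop_atTop
  have hsmall : Tendsto (fun n : ℕ => 2 ^ K * (1 + C) * (∑ r ∈ s, ((k r : ℝ)) ^ 2) / (n : ℝ) ^ α)
      atTop (𝓝 0) := tendsto_const_nhds.div_atTop hnα
  -- Replacing powers by falling factorials costs an error of order `n^{-α}`.
  have hdiff : Tendsto (fun n : ℕ => (∫ ω, ∏ r ∈ s,
      (clamp hT.le (walk α T n (ξ n) ω) (J r).2 - clamp hT.le (walk α T n (ξ n) ω) (J r).1) ^ k r
        ∂P' n) - ∫ ω, ∏ r ∈ s,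
      ((∑ j ∈ Finset.Ioc (block n (J r)).1 (block n (J r)).2, bit (ξ n) ω j).descFactorial (k r) : ℝ)
        / ((n : ℝ) ^ α) ^ k r ∂P' n) atTop (𝓝 0) := by
    refine squeeze_zero_norm' ?_ hsmall
    filter_upwards [hi, hξ, hC, eventually_gt_atTop 0] with n h1 h2 h3 h4
    have hn' : (0 : ℝ) < n := by exact_mod_cast h4
    have ha : 0 < (n : ℝ) ^ α := by positivity
    set Y := fun ω => walk α T n (ξ n) ω with hY
    have hgood : ∀ ω, Y ω ∈ incrPaths hT.le := h2.walk_mem_incrPaths hT.le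
    have h0 : ∀ ω, 0 ≤ clamp hT.le (Y ω) T := fun ω => clamp_nonneg hT.le (hgood ω) T
    have hinc : ∀ ω, ∀ r ∈ s, clamp hT.le (Y ω) (J r).2 - clamp hT.le (Y ω) (J r).1 =
        ((∑ j ∈ Finset.Ioc (block n (J r)).1 (block n (J r)).2, bit (ξ n) ω j : ℕ) : ℝ) /
          (n : ℝ) ^ α := fun ω r hr =>
      h2.clamp_walk_sub hT.le ω (hJ r hr).1 (hJ r hr).2.1 (hJ r hr).2.2
    have hincle : ∀ ω, ∀ r ∈ s,
        ((∑ j ∈ Finset.Ioc (block n (J r)).1 (block n (J r)).2, bit (ξ n) ω j : ℕ) : ℝ) /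
          (n : ℝ) ^ α ≤ clamp hT.le (Y ω) T := fun ω r hr => by
      rw [← hinc ω r hr]
      have := clamp_le_right hT.le (hgood ω) (J r).2
      have := clamp_nonneg hT.le (hgood ω) (J r).1
      linarith
    have hpt : ∀ ω, |∏ r ∈ s, (clamp hT.le (Y ω) (J r).2 - clamp hT.le (Y ω) (J r).1) ^ k r -
        ∏ r ∈ s, ((∑ j ∈ Finset.Ioc (block n (J r)).1 (block n (J r)).2,
          bit (ξ n) ω j).descFactorial (k r) : ℝ) / ((n : ℝ) ^ α) ^ k r| ≤
        2 ^ K * (1 + clamp hT.le (Y ω) T ^ K) * ((∑ r ∈ s, ((k r : ℝ)) ^ 2) / (n : ℝ) ^ α) :=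
        fun ω => by
      rw [Finset.prod_congr rfl (fun r hr => by rw [hinc ω r hr])]
      refine (abs_prod_sub_prod_le s (M := 1 + clamp hT.le (Y ω) T) (by linarith [h0 ω]) k
        (δ := fun r => (k r : ℝ) ^ 2 / (n : ℝ) ^ α) (fun r hr => ?_) (fun r hr => ?_)
        (fun r hr => ?_)).trans ?_
      · rw [abs_of_nonneg (by positivity)]
        exact pow_le_pow_left₀ (by positivity) (by linarith [hincle ω r hr]) _
      · rw [abs_of_nonneg (by positivity)]
        have h5 := hincle ω r hr
        set S := ∑ j ∈ Finset.Ioc (block n (J r)).1 (block n (J r)).2, bit (ξ n) ω j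
        calc (S.descFactorial (k r) : ℝ) / ((n : ℝ) ^ α) ^ k r
            ≤ (S : ℝ) ^ k r / ((n : ℝ) ^ α) ^ k r := by
              gcongr; exact_mod_cast Nat.descFactorial_le_pow S (k r)
          _ = ((S : ℝ) / (n : ℝ) ^ α) ^ k r := (div_pow _ _ _).symm
          _ ≤ _ := pow_le_pow_left₀ (by positivity) (by linarith) _
      · refine (abs_pow_sub_descFactorial_le _ (k r) ha).trans ?_
        gcongr
        exact hincle ω r hr
      · rw [← hK, Finset.sum_div]
        gcongr
        exact one_add_pow_le (h0 ω) K
    have hmeas : ∀ t, Measurable fun ω => clamp hT.le (Y ω) t := h2.measurable_clamp_walk hT.le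
    have hbint : Integrable (fun ω => 2 ^ K * (1 + clamp hT.le (Y ω) T ^ K) *
        ((∑ r ∈ s, ((k r : ℝ)) ^ 2) / (n : ℝ) ^ α)) (P' n) :=
      (((integrable_const 1).add h3.1).const_mul _).mul_const _
    have hprodm : AEStronglyMeasurable (fun ω => ∏ r ∈ s,
        (clamp hT.le (Y ω) (J r).2 - clamp hT.le (Y ω) (J r).1) ^ k r) (P' n) :=
      (Finset.measurable_prod s fun r _ =>
        ((hmeas _).sub (hmeas _)).pow_const _).aestronglyMeasurable
    have hd : Integrable (fun ω => ∏ r ∈ s, (clamp hT.le (Y ω) (J r).2 -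
        clamp hT.le (Y ω) (J r).1) ^ k r - ∏ r ∈ s,
        ((∑ j ∈ Finset.Ioc (block n (J r)).1 (block n (J r)).2,
          bit (ξ n) ω j).descFactorial (k r) : ℝ) / ((n : ℝ) ^ α) ^ k r) (P' n) :=
      hbint.mono' (hprodm.sub h1.aestronglyMeasurable) (Eventually.of_forall hpt)
    have hprodi : Integrable (fun ω => ∏ r ∈ s,
        (clamp hT.le (Y ω) (J r).2 - clamp hT.le (Y ω) (J r).1) ^ k r) (P' n) := by
      refine (hd.add h1).congr (Eventually.of_forall fun ω => ?_)
      simp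
    rw [← integral_sub hprodi h1, Real.norm_eq_abs]
    refine abs_integral_le_integral_abs.trans ((integral_mono hd.abs hbint hpt).trans ?_)
    rw [integral_mul_const, integral_const_mul, integral_add (integrable_const 1) h3.1]
    simp only [integral_const, probReal_univ, smul_eq_mul, mul_one]
    rw [← mul_div_assoc]
    gcongr
    exact h3.2
  simpa using hdiff.add hlim

end Limit

/-! ### Regularity and bounds for iterated integrals -/

section ChainInt

variable {c lam α : ℝ}

lemma measurable_chainInt {g : ℝ → ℝ} (hg : Measurable g) (l : List (ℝ × ℝ)) :
    Measurable (chainInt g l) := by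
  induction l with
  | nil => exact measurable_const
  | cons J l ih =>
    refine StronglyMeasurable.measurable
      (StronglyMeasurable.integral_prod_right (f := fun x y => g (y - x) * chainInt g l y) ?_)
    have : Measurable (Function.uncurry fun x y => g (y - x) * chainInt g l y) := by
      unfold Function.uncurry
      fun_prop
    exact this.stronglyMeasurable

lemma chainInt_nonneg {g : ℝ → ℝ} (hg : ∀ u, 0 ≤ g u) (l : List (ℝ × ℝ)) (x : ℝ) :
    0 ≤ chainInt g l x := by
  induction l generalizing x with
  | nil => exact zero_le_one
  | cons J l ih => exact integral_nonneg fun y => mul_nonneg (hg _) (ih y)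

lemma kern_sub_le_kernBound (hc : 0 ≤ c) (hα1 : α ≤ 1) {T x y : ℝ} (hx : 0 ≤ x) (hy : y ≤ T) :
    kern c lam α (y - x) ≤ kernBound c lam α T (y - x) :=
  kern_le_kernBound hc hα1 hx hy fun h => ⟨by linarith, by linarith, by linarith⟩

lemma chainInt_le (hc : 0 ≤ c) (hα0 : 0 < α) (hα1 : α ≤ 1) {T : ℝ} (l : List (ℝ × ℝ))
    (hl : ∀ J ∈ l, 0 ≤ J.1 ∧ J.2 ≤ T) {x : ℝ} (hx : 0 ≤ x) :
    chainInt (kern c lam α) l x ≤ (∫ u, kernBound c lam α T u) ^ l.length := by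
  have hD : 0 ≤ ∫ u, kernBound c lam α T u := integral_nonneg fun u => kernBound_nonneg hc T u
  induction l generalizing x with
  | nil => simp [chainInt]
  | cons J l ih =>
    have hJ := hl J (by simp)
    have hI : Integrable fun y : ℝ => kernBound c lam α T (y - x) *
        (∫ u, kernBound c lam α T u) ^ l.length :=
      ((integrable_kernBound hα0 T).comp_sub_right x).mul_const _
    rw [List.length_cons, pow_succ', chainInt,
      ← integral_sub_right_eq_self (kernBound c lam α T) x, ← integral_mul_const,
      integral_sub_right_eq_self (kernBound c lam α T) x]
    refine (integral_mono_of_nonneg ?_ hI.integrableOn ?_).trans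
      (setIntegral_le_integral hI (Eventually.of_forall fun y =>
        mul_nonneg (kernBound_nonneg hc T _) (pow_nonneg hD _)))
    · exact Eventually.of_forall fun y =>
        mul_nonneg (kern_nonneg hc _) (chainInt_nonneg (kern_nonneg hc) _ _)
    · rw [EventuallyLE, ae_restrict_iff' measurableSet_Ioc]
      refine Eventually.of_forall fun y hy => ?_
      exact mul_le_mul (kern_sub_le_kernBound hc hα1 hx (hy.2.trans hJ.2))
        (ih (fun J hJ => hl J (by simp [hJ])) (hJ.1.trans hy.1.le))
        (chainInt_nonneg (kern_nonneg hc) _ _) (kernBound_nonneg hc T _)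

lemma integrableOn_chainInt (hc : 0 ≤ c) (hα0 : 0 < α) (hα1 : α ≤ 1) {T : ℝ} (l : List (ℝ × ℝ))
    (hl : ∀ J ∈ l, 0 ≤ J.1 ∧ J.2 ≤ T) {a b : ℝ} (ha : 0 ≤ a) :
    IntegrableOn (chainInt (kern c lam α) l) (Ioc a b) := by
  refine Measure.integrableOn_of_bounded (M := (∫ u, kernBound c lam α T u) ^ l.length)
    (by simp) (measurable_chainInt measurable_kern l).aestronglyMeasurable ?_
  rw [ae_restrict_iff' measurableSet_Ioc]
  refine Eventually.of_forall fun y hy => ?_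
  rw [Real.norm_eq_abs, abs_of_nonneg (chainInt_nonneg (kern_nonneg hc) _ _)]
  exact chainInt_le hc hα0 hα1 l hl (ha.trans hy.1.le)

lemma integrableOn_kern_mul_chainInt (hc : 0 ≤ c) (hα0 : 0 < α) (hα1 : α ≤ 1) {T : ℝ}
    (l : List (ℝ × ℝ)) (hl : ∀ J ∈ l, 0 ≤ J.1 ∧ J.2 ≤ T) {a b x : ℝ} (hx : 0 ≤ x) (ha : 0 ≤ a)
    (hb : b ≤ T) :
    IntegrableOn (fun y => kern c lam α (y - x) * chainInt (kern c lam α) l y) (Ioc a b) := by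
  refine Integrable.mono' (g := fun y => kernBound c lam α T (y - x) *
    (∫ u, kernBound c lam α T u) ^ l.length)
    (((integrable_kernBound hα0 T).comp_sub_right x).mul_const _).integrableOn ?_ ?_
  · have := measurable_chainInt (measurable_kern (c := c) (lam := lam) (α := α)) l
    exact Measurable.aestronglyMeasurable (by fun_prop)
  · rw [ae_restrict_iff' measurableSet_Ioc]
    refine Eventually.of_forall fun y hy => ?_
    rw [Real.norm_eq_abs, abs_of_nonneg (mul_nonneg (kern_nonneg hc _)
      (chainInt_nonneg (kern_nonneg hc) _ _))]
    exact mul_le_mul (kern_sub_le_kernBound hc hα1 hx (hy.2.trans hb))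
      (chainInt_le hc hα0 hα1 l hl (ha.trans hy.1.le))
      (chainInt_nonneg (kern_nonneg hc) _ _) (kernBound_nonneg hc T _)

end ChainInt

/-! ### Moments of the limit process -/

section LimitProcess

variable {Ω' : ℕ → Type*} [∀ n, MeasurableSpace (Ω' n)] {P' : ∀ n, Measure (Ω' n)}
  [∀ n, IsProbabilityMeasure (P' n)] {ξ : ∀ n, ℕ → Ω' n → ℝ} {α b c lam T : ℝ}
  {Ω : Type*} [MeasurableSpace Ω] {P : Measure Ω} [IsProbabilityMeasure P]
  {X : Ω → SkorokhodSpace T}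

lemma clamp_proj (hT : 0 ≤ T) (x : SkorokhodSpace T) (t : ℝ) :
    clamp hT x t = clamp hT x (max 0 (min T t)) := by
  have : projIcc 0 T hT (max 0 (min T t)) = projIcc 0 T hT t := by
    rw [← coe_projIcc 0 T hT]; exact projIcc_val hT _
  rw [clamp, clamp, this]

/-- Mean square increments of the walk over short intervals are uniformly small. -/
lemma eventually_walk_sq_le (hT : 0 < T) (hα0 : 0 < α) (hα1 : α ≤ 1) (hc : 0 ≤ c) (hb : 0 ≤ b)
    (hξ : ∀ᶠ n in atTop, IsGBP (tempered c lam α n) b ⌊(n : ℝ) * T⌋₊ (ξ n) (P' n))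
    (t η : ℝ) (hη : 0 < η) :
    ∀ᶠ ε in 𝓝[>] (0 : ℝ), ∀ᶠ n in atTop, ∫ ω, (clamp hT.le (walk α T n (ξ n) ω) (t + ε) -
      clamp hT.le (walk α T n (ξ n) ω) t) ^ 2 ∂P' n ≤ η := by
  set D := ∫ u, kernBound c lam α T u with hD
  have hD0 : 0 ≤ D := integral_nonneg fun u => kernBound_nonneg hc T u
  have haT : 0 ≤ aT α b c lam T := by unfold aT; positivity
  have hlim0 : Tendsto (fun ε : ℝ => 2 * (aT α b c lam T * (ε * D))) (𝓝[>] 0) (𝓝 0) := by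
    have : Tendsto (fun ε : ℝ => 2 * (aT α b c lam T * (ε * D))) (𝓝 0)
        (𝓝 (2 * (aT α b c lam T * (0 * D)))) :=
      (by fun_prop : Continuous fun ε : ℝ => 2 * (aT α b c lam T * (ε * D))).tendsto 0
    rw [zero_mul, mul_zero, mul_zero] at this
    exact this.mono_left nhdsWithin_le_nhds
  filter_upwards [hlim0.eventually_lt_const hη, self_mem_nhdsWithin] with ε hε hε0
  simp only [mem_Ioi] at hε0
  -- The walk is frozen outside `[0, T]`, so only the part of `(t, t + ε]` inside counts.
  set u := max 0 (min T t) with hu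
  set v := max 0 (min T (t + ε)) with hv
  have hu0 : 0 ≤ u := le_max_left _ _
  have huv : u ≤ v := by
    rw [hu, hv]; gcongr; linarith
  have hvT : v ≤ T := max_le hT.le (min_le_left _ _)
  have hvu : v - u ≤ ε := by
    rw [hu, hv]
    rcases max_cases 0 (min T t) with h | h <;> rcases max_cases 0 (min T (t + ε)) with h' | h' <;>
    rcases min_cases T t with h'' | h'' <;> rcases min_cases T (t + ε) with h''' | h''' <;> linarith
  have hlim := tendsto_walk_moment (b := b) (lam := lam) hT hα0 hα1 hc hξ (fun _ => (u, v))
    (fun _ => 2) 0 1 (by simp [hu0, huv, hvT]) (by simp) (J₀ := (u, v)) (l := [(u, v)])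
    (by simp [flat, List.replicate_succ])
  simp only [zero_add, Nat.Ico_zero_eq_range, Finset.prod_range_one] at hlim
  have hle : ((Nat.factorial 2 : ℕ) : ℝ) * (aT α b c lam T *
      ∫ y in Ioc u v, chainInt (kern c lam α) [(u, v)] y) < η := by
    refine lt_of_le_of_lt ?_ hε
    have h1 : ∫ y in Ioc u v, chainInt (kern c lam α) [(u, v)] y ≤ ε * D := by
      have hl : ∀ J ∈ [(u, v)], 0 ≤ J.1 ∧ J.2 ≤ T := by simp [hu0, hvT]
      calc ∫ y in Ioc u v, chainInt (kern c lam α) [(u, v)] y ≤ ∫ y in Ioc u v, D := by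
            refine setIntegral_mono_on (integrableOn_chainInt hc hα0 hα1 _ hl hu0)
              (integrableOn_const (by simp)) measurableSet_Ioc fun y hy => ?_
            simpa using chainInt_le (lam := lam) hc hα0 hα1 _ hl (hu0.trans hy.1.le)
        _ = (v - u) * D := by
            rw [setIntegral_const, smul_eq_mul, measureReal_def, Real.volume_Ioc,
              ENNReal.toReal_ofReal (by linarith)]
        _ ≤ ε * D := by gcongr
    simp only [Nat.factorial_two, Nat.cast_ofNat]
    gcongr
  filter_upwards [hlim.eventually_le_const hle] with n hn
  simp only [clamp_proj hT.le _ (t + ε), clamp_proj hT.le _ t]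
  exact hn

/-- Mixed moments of increments of the limit process over arbitrary intervals are finite, and are
the limits of those of the walks. -/
theorem integrable_prod_incr (hT : 0 < T) (hα0 : 0 < α) (hα1 : α ≤ 1) (hc : 0 ≤ c) (hb : 0 ≤ b)
    (hξ : ∀ᶠ n in atTop, IsGBP (tempered c lam α n) b ⌊(n : ℝ) * T⌋₊ (ξ n) (P' n))
    (hX : TendstoInDistribution (fun n => walk α T n (ξ n)) atTop X P' P)
    {ι : Type*} (s : Finset ι) (u v : ι → ℝ) (k : ι → ℕ) :
    Integrable (fun ω => ∏ i ∈ s, (clamp hT.le (X ω) (v i) - clamp hT.le (X ω) (u i)) ^ k i) P ∧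
    Tendsto (fun n => ∫ ω, ∏ i ∈ s, (clamp hT.le (walk α T n (ξ n) ω) (v i) -
      clamp hT.le (walk α T n (ξ n) ω) (u i)) ^ k i ∂P' n) atTop
      (𝓝 (∫ ω, ∏ i ∈ s, (clamp hT.le (X ω) (v i) - clamp hT.le (X ω) (u i)) ^ k i ∂P)) :=
  tendsto_integral_prod_incr hT.le hX (hξ.mono fun _ hn => hn.walk_mem_incrPaths hT.le)
    (walk_moment_bdd hT hα0 hα1 hc hξ) (eventually_walk_sq_le hT hα0 hα1 hc hb hξ) s u v k

/-- Mixed moments of increments of the limit process over ordered intervals as iterated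
integrals of the kernel. -/
theorem integral_prod_incr (hT : 0 < T) (hα0 : 0 < α) (hα1 : α ≤ 1) (hc : 0 ≤ c) (hb : 0 ≤ b)
    (hξ : ∀ᶠ n in atTop, IsGBP (tempered c lam α n) b ⌊(n : ℝ) * T⌋₊ (ξ n) (P' n))
    (hX : TendstoInDistribution (fun n => walk α T n (ξ n)) atTop X P' P)
    (J : ℕ → ℝ × ℝ) (k : ℕ → ℕ) (i m : ℕ)
    (hJ : ∀ r ∈ Finset.Ico i (i + m), 0 ≤ (J r).1 ∧ (J r).1 ≤ (J r).2 ∧ (J r).2 ≤ T)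
    (hJ' : ∀ r ∈ Finset.Ico i (i + m), ∀ r' ∈ Finset.Ico i (i + m), r < r' → (J r).2 ≤ (J r').1)
    {J₀ : ℝ × ℝ} {l : List (ℝ × ℝ)} (hl : flat J k i m = J₀ :: l) :
    ∫ ω, ∏ r ∈ Finset.Ico i (i + m),
      (clamp hT.le (X ω) (J r).2 - clamp hT.le (X ω) (J r).1) ^ k r ∂P =
      (∏ r ∈ Finset.Ico i (i + m), ((k r).factorial : ℝ)) *
        (aT α b c lam T * ∫ y in Ioc J₀.1 J₀.2, chainInt (kern c lam α) l y) :=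
  tendsto_nhds_unique
    (integrable_prod_incr hT hα0 hα1 hc hb hξ hX (Finset.Ico i (i + m)) (fun r => (J r).1)
      (fun r => (J r).2) k).2
    (tendsto_walk_moment hT hα0 hα1 hc hξ J k i m hJ hJ' hl)

end LimitProcess

/-! ### Iterated integrals over a single block -/

lemma integral_rpow_mul_rpow {p q w : ℝ} (hp : 0 < p) (hq : 0 < q) (hw : 0 < w) :
    ∫ s in (0 : ℝ)..w, s ^ (p - 1) * (w - s) ^ (q - 1) =
      w ^ (p + q - 1) * (Real.Gamma p * Real.Gamma q / Real.Gamma (p + q)) := by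
  have h := Complex.betaIntegral_scaled (p : ℂ) (q : ℂ) hw
  rw [Complex.betaIntegral_eq_Gamma_mul_div _ _ (by simpa using hp) (by simpa using hq)] at h
  have e : ∫ s in (0 : ℝ)..w, (s : ℂ) ^ ((p : ℂ) - 1) * ((w : ℂ) - s) ^ ((q : ℂ) - 1) =
      ((∫ s in (0 : ℝ)..w, s ^ (p - 1) * (w - s) ^ (q - 1) : ℝ) : ℂ) := by
    rw [← intervalIntegral.integral_ofReal]
    refine intervalIntegral.integral_congr fun s hs => ?_
    rw [uIcc_of_le hw.le] at hs
    rw [Complex.ofReal_mul, Complex.ofReal_cpow hs.1, Complex.ofReal_cpow (by linarith [hs.2])]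
    push_cast; rfl
  rw [e] at h
  have : ((w : ℂ) ^ ((p : ℂ) + q - 1) * (Complex.Gamma p * Complex.Gamma q / Complex.Gamma (p + q))) =
      ((w ^ (p + q - 1) * (Real.Gamma p * Real.Gamma q / Real.Gamma (p + q)) : ℝ) : ℂ) := by
    push_cast
    rw [Complex.ofReal_cpow hw.le, ← Complex.Gamma_ofReal, ← Complex.Gamma_ofReal,
      ← Complex.Gamma_ofReal]
    push_cast; rfl
  rw [this] at h
  exact_mod_cast h

section Block

variable {c lam α : ℝ}

/-- Tempered power kernels are closed under convolution, by the beta integral. -/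
lemma integral_kern_mul_kern {c₁ c₂ p q : ℝ} (hp : 0 < p) (hq : 0 < q) (x z a b : ℝ) (hax : a ≤ x)
    (hzb : z ≤ b) :
    ∫ y in Ioc a b, kern c₁ lam p (y - x) * kern c₂ lam q (z - y) =
      kern (c₁ * c₂ * (Real.Gamma p * Real.Gamma q / Real.Gamma (p + q))) lam (p + q) (z - x) := by
  have hzero : ∀ y, y ∉ Ioo x z → kern c₁ lam p (y - x) * kern c₂ lam q (z - y) = 0 := by
    intro y hy
    rcases le_or_gt y x with h | h
    · rw [kern_of_nonpos (by linarith), zero_mul]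
    · rw [kern_of_nonpos (u := z - y) (by
        by_contra h'; exact hy ⟨h, by linarith⟩), mul_zero]
  rcases le_or_gt z x with hzx | hxz
  · rw [kern_of_nonpos (by linarith)]
    refine integral_eq_zero_of_ae (Eventually.of_forall fun y => hzero y fun hy => ?_)
    linarith [hy.1, hy.2]
  · have e1 : ∫ y in Ioc a b, kern c₁ lam p (y - x) * kern c₂ lam q (z - y) =
        ∫ y in Ioc x z, kern c₁ lam p (y - x) * kern c₂ lam q (z - y) := by
      rw [setIntegral_eq_of_subset_of_forall_sdiff_eq_zero measurableSet_Ioc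
        (Ioc_subset_Ioc hax hzb)]
      intro y hy
      exact hzero y fun h => hy.2 ⟨h.1, h.2.le⟩
    have hw : 0 < z - x := by linarith
    rw [e1, ← intervalIntegral.integral_of_le hxz.le, kern_of_pos hw]
    have e2 : ∫ y in x..z, kern c₁ lam p (y - x) * kern c₂ lam q (z - y) =
        ∫ s in (0 : ℝ)..(z - x), kern c₁ lam p s * kern c₂ lam q (z - x - s) := by
      rw [← sub_self x, ← intervalIntegral.integral_comp_sub_right
        (fun s => kern c₁ lam p s * kern c₂ lam q (z - x - s)) x]
      refine intervalIntegral.integral_congr fun y _ => ?_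
      rw [show z - x - (y - x) = z - y by ring]
    have e3 : ∫ s in (0 : ℝ)..(z - x), kern c₁ lam p s * kern c₂ lam q (z - x - s) =
        ∫ s in (0 : ℝ)..(z - x), (c₁ * c₂ * Real.exp (-lam * (z - x))) *
          (s ^ (p - 1) * (z - x - s) ^ (q - 1)) := by
      refine intervalIntegral.integral_congr_ae ?_
      have hne : ∀ᵐ s : ℝ, s ≠ z - x := by simp [ae_iff, measure_singleton]
      filter_upwards [hne] with s hs hmem
      rw [uIoc_of_le hw.le] at hmem
      have hlt : s < z - x := lt_of_le_of_ne hmem.2 hs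
      rw [kern_of_pos hmem.1, kern_of_pos (by linarith)]
      have : Real.exp (-lam * (z - x)) = Real.exp (-lam * s) * Real.exp (-lam * (z - x - s)) := by
        rw [← Real.exp_add]; congr 1; ring
      rw [this]; ring
    rw [e2, e3, intervalIntegral.integral_const_mul, integral_rpow_mul_rpow hp hq hw]
    ring

lemma integrableOn_kern (c lam : ℝ) {p : ℝ} (hp : 0 < p) (a M : ℝ) :
    IntegrableOn (kern c lam p) (Ioc a M) := by
  have h0 : IntegrableOn (kern c lam p) (Ioc 0 (max 0 M)) := by
    have h1 : IntervalIntegrable (fun u : ℝ => c * Real.exp (-lam * u) * u ^ (p - 1)) volume 0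
        (max 0 M) :=
      (intervalIntegral.intervalIntegrable_rpow' (by linarith)).continuousOn_mul (by fun_prop)
    rw [intervalIntegrable_iff_integrableOn_Ioc_of_le (le_max_left _ _)] at h1
    exact h1.congr_fun (fun u hu => (kern_of_pos hu.1).symm) measurableSet_Ioc
  have h2 : IntegrableOn (kern c lam p) (Iic 0) :=
    (integrableOn_zero (ε' := ℝ)).congr_fun (fun u hu => (kern_of_nonpos hu).symm) measurableSet_Iic
  refine (h2.union h0).mono_set fun u hu => ?_
  rcases le_or_gt u 0 with h | h
  · exact Or.inl h
  · exact Or.inr ⟨h, hu.2.trans (le_max_right _ _)⟩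

lemma integrable_indicator_kern (c lam : ℝ) {p : ℝ} (hp : 0 < p) (M : ℝ) :
    Integrable ((Iic M).indicator (kern c lam p)) := by
  rw [integrable_indicator_iff measurableSet_Iic]
  have h2 : IntegrableOn (kern c lam p) (Iic 0) :=
    (integrableOn_zero (ε' := ℝ)).congr_fun (fun u hu => (kern_of_nonpos hu).symm) measurableSet_Iic
  refine (h2.union (integrableOn_kern c lam hp 0 M)).mono_set fun u hu => ?_
  rcases le_or_gt u 0 with h | h
  · exact Or.inl h
  · exact Or.inr ⟨h, hu⟩

/-- The `k`-fold convolution power of the kernel. -/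
noncomputable def kernPow (c lam α : ℝ) (k : ℕ) (u : ℝ) : ℝ :=
  kern (nu α c ^ k / Real.Gamma (k * α)) lam (k * α) u

lemma kernPow_one (hα0 : 0 < α) (u : ℝ) : kernPow c lam α 1 u = kern c lam α u := by
  have := (Real.Gamma_pos_of_pos hα0).ne'
  rw [kernPow, Nat.cast_one, one_mul, pow_one, nu, mul_div_assoc, div_self this, mul_one]

lemma integral_kern_mul_kernPow (hα0 : 0 < α) {k : ℕ} (hk : 0 < k) {x z a b : ℝ} (hax : a ≤ x)
    (hzb : z ≤ b) :
    ∫ y in Ioc a b, kern c lam α (y - x) * kernPow c lam α k (z - y) =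
      kernPow c lam α (k + 1) (z - x) := by
  have hkα : 0 < (k : ℝ) * α := by positivity
  simp only [kernPow]
  rw [integral_kern_mul_kern hα0 hkα x z a b hax hzb]
  have h1 := (Real.Gamma_pos_of_pos hkα).ne'
  have e : α + k * α = ((k + 1 : ℕ) : ℝ) * α := by push_cast; ring
  rw [e]
  congr 1
  rw [pow_succ, nu]
  field_simp

/-- Iterated integrals over `k` copies of one interval are given by the `k`-fold convolution
power of the kernel. -/
lemma chainInt_replicate (hα0 : 0 < α) {a b : ℝ} (k : ℕ) {x : ℝ} (hax : a ≤ x) :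
    chainInt (kern c lam α) (List.replicate (k + 1) (a, b)) x =
      ∫ z in Ioc a b, kernPow c lam α (k + 1) (z - x) := by
  induction k generalizing x with
  | zero => simp [chainInt, kernPow_one hα0]
  | succ k ih =>
    have hkα : 0 < ((k + 1 : ℕ) : ℝ) * α := by positivity
    rw [List.replicate_succ, chainInt]
    have e1 : ∫ y in Ioc a b, kern c lam α (y - x) *
        chainInt (kern c lam α) (List.replicate (k + 1) (a, b)) y =
        ∫ y in Ioc a b, ∫ z in Ioc a b, kern c lam α (y - x) * kernPow c lam α (k + 1) (z - y) := by
      refine setIntegral_congr_fun measurableSet_Ioc fun y hy => ?_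
      rw [ih hy.1.le, integral_const_mul]
    simp only
    rw [e1, integral_integral_swap]
    · refine setIntegral_congr_fun measurableSet_Ioc fun z hz => ?_
      exact integral_kern_mul_kernPow hα0 (by omega) hax hz.2
    · set M := b - a
      have hf : Integrable fun y => (Iic M).indicator (kern c lam α) (y - x) :=
        (integrable_indicator_kern c lam hα0 M).comp_sub_right x
      have hg := integrable_indicator_kern (nu α c ^ (k + 1) / Real.Gamma ((k + 1 : ℕ) * α)) lam hkα M
      have hfg := (hf.convolution_integrand (ContinuousLinearMap.mul ℝ ℝ) hg).swap
      rw [Measure.prod_restrict]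
      refine (hfg.mono_measure Measure.restrict_le_self).congr ?_
      rw [EventuallyEq,
        ae_restrict_iff' (measurableSet_Ioc.prod measurableSet_Ioc)]
      refine Eventually.of_forall fun p hp => ?_
      obtain ⟨hp1, hp2⟩ := hp
      simp only [Function.comp, Prod.swap, ContinuousLinearMap.mul_apply', Function.uncurry, kernPow]
      rw [indicator_of_mem (show p.1 - x ∈ Iic M by
          simp only [mem_Iic, M]; linarith [hp1.2]),
        indicator_of_mem (show p.2 - p.1 ∈ Iic M by
          simp only [mem_Iic, M]; linarith [hp2.2, hp1.1])]

/-- The integral of the product of the kernel at the `k` successive gaps over the increasing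
`(k+1)`-tuples of points of `(a, b]`. -/
noncomputable def blockInt (c lam α : ℝ) (k : ℕ) (a b : ℝ) : ℝ :=
  ∫ y in Ioc a b, chainInt (kern c lam α) (List.replicate k (a, b)) y

lemma blockInt_zero {a b : ℝ} (hab : a ≤ b) : blockInt c lam α 0 a b = b - a := by
  simp [blockInt, chainInt, hab]

lemma integral_kern_sub {C p x a b : ℝ} (hax : a ≤ x) (hxb : x ≤ b) :
    ∫ z in Ioc a b, kern C lam p (z - x) = ∫ u in (0 : ℝ)..(b - x), kern C lam p u := by
  rw [setIntegral_eq_of_subset_of_forall_sdiff_eq_zero measurableSet_Ioc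
    (Ioc_subset_Ioc_left hax) (fun z hz => kern_of_nonpos (by
      by_contra h; exact hz.2 ⟨by linarith, hz.1.2⟩)),
    ← intervalIntegral.integral_of_le hxb, ← sub_self x,
    ← intervalIntegral.integral_comp_sub_right (fun s => kern C lam p s) x]

lemma blockInt_succ (hα0 : 0 < α) (k : ℕ) {a b : ℝ} (hab : a ≤ b) :
    blockInt c lam α (k + 1) a b =
      ∫ x in (0 : ℝ)..(b - a), ∫ u in (0 : ℝ)..x, kernPow c lam α (k + 1) u := by
  have hkα : 0 < ((k + 1 : ℕ) : ℝ) * α := by positivity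
  have e : blockInt c lam α (k + 1) a b =
      ∫ x in a..b, ∫ u in (0 : ℝ)..(b - x), kernPow c lam α (k + 1) u := by
    rw [blockInt, intervalIntegral.integral_of_le hab]
    refine setIntegral_congr_fun measurableSet_Ioc fun x hx => ?_
    rw [chainInt_replicate hα0 k hx.1.le]
    exact integral_kern_sub hx.1.le hx.2
  rw [e, intervalIntegral.integral_comp_sub_left
    (fun x => ∫ u in (0 : ℝ)..x, kernPow c lam α (k + 1) u) b, sub_self]

/-- The double integral of the tempered power kernel, rescaled to the unit interval. -/
lemma integral_integral_kern (C : ℝ) {p t : ℝ} (ht : 0 < t) :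
    ∫ x in (0 : ℝ)..t, ∫ u in (0 : ℝ)..x, kern C lam p u =
      t ^ (p + 1) * C * ∫ x in (0 : ℝ)..1, ∫ y in (0 : ℝ)..x,
        Real.exp (-lam * t * y) * y ^ (p - 1) := by
  have h1 : ∀ f : ℝ → ℝ, ∀ x, ∫ u in (0 : ℝ)..(t * x), f u = t * ∫ y in (0 : ℝ)..x, f (t * y) := by
    intro f x
    rw [intervalIntegral.integral_comp_mul_left f ht.ne', mul_zero, smul_eq_mul,
      mul_inv_cancel_left₀ ht.ne']
  have h2 := h1 (fun x => ∫ u in (0 : ℝ)..x, kern C lam p u) 1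
  rw [mul_one] at h2
  rw [h2]
  simp only [h1]
  rw [intervalIntegral.integral_const_mul, ← intervalIntegral.integral_const_mul,
    ← intervalIntegral.integral_const_mul, ← intervalIntegral.integral_const_mul]
  refine intervalIntegral.integral_congr fun x hx => ?_
  rw [uIcc_of_le zero_le_one] at hx
  rw [← intervalIntegral.integral_const_mul, ← intervalIntegral.integral_const_mul,
    ← intervalIntegral.integral_const_mul]
  rw [intervalIntegral.integral_of_le hx.1, intervalIntegral.integral_of_le hx.1]
  refine setIntegral_congr_fun measurableSet_Ioc fun y hy => ?_
  rw [kern_of_pos (mul_pos ht hy.1), Real.mul_rpow ht.le hy.1.le, Real.rpow_sub ht,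
    Real.rpow_add ht, Real.rpow_one, show -lam * (t * y) = -lam * t * y by ring]
  field_simp

lemma blockInt_succ_eq (hα0 : 0 < α) (k : ℕ) {a b : ℝ} (hab : a < b) :
    blockInt c lam α (k + 1) a b = (b - a) ^ (((k + 1 : ℕ) : ℝ) * α + 1) *
      (nu α c ^ (k + 1) / Real.Gamma (((k + 1 : ℕ) : ℝ) * α)) *
      ∫ x in (0 : ℝ)..1, ∫ y in (0 : ℝ)..x,
        Real.exp (-lam * (b - a) * y) * y ^ (((k + 1 : ℕ) : ℝ) * α - 1) := by
  rw [blockInt_succ hα0 k hab.le]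
  exact integral_integral_kern _ (sub_pos.2 hab)

end Block

section Asymptotics

variable {c lam α T : ℝ}

/-! ### Monotonicity of the kernel and positivity of block integrals -/

lemma kern_pos (hc : 0 < c) {u : ℝ} (hu : 0 < u) : 0 < kern c lam α u := by
  rw [kern_of_pos hu]; positivity

/-- The condition `λ > (α - 1) / T` makes the kernel strictly decreasing on `(0, T]`. -/
lemma kern_strictAntiOn (hc : 0 < c) (hT : 0 < T) (hα1 : α ≤ 1) (hlam : (α - 1) / T < lam) :
    StrictAntiOn (kern c lam α) (Ioc 0 T) := by
  intro u hu v hv huv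
  have hu0 := hu.1
  have hv0 := hv.1
  rw [kern_of_pos hu0, kern_of_pos hv0, mul_assoc, mul_assoc]
  refine mul_lt_mul_of_pos_left ?_ hc
  rw [Real.rpow_def_of_pos hu0, Real.rpow_def_of_pos hv0, ← Real.exp_add, ← Real.exp_add,
    Real.exp_lt_exp]
  -- By `log x ≤ x - 1` the power contributes at least `(α - 1)(u - v) / v` to the difference
  -- of logarithms.
  have h1 : Real.log (u / v) ≤ u / v - 1 := Real.log_le_sub_one_of_pos (by positivity)
  rw [Real.log_div hu0.ne' hv0.ne'] at h1
  have h2 : (α - 1) / v ≤ (α - 1) / T := by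
    rw [div_le_div_iff₀ hv0 hT]
    nlinarith [hv.2]
  have h3 : (α - 1) * (Real.log u - Real.log v) ≥ (α - 1) * (u / v - 1) :=
    mul_le_mul_of_nonpos_left h1 (by linarith)
  have h4 : (α - 1) * (u / v - 1) = (α - 1) / v * (u - v) := by field_simp
  have h5 : lam * (v - u) > (α - 1) / v * (v - u) :=
    mul_lt_mul_of_pos_right (by linarith) (by linarith)
  nlinarith

lemma integral_exp_mul_rpow_pos {p : ℝ} (hp : 0 < p) (t : ℝ) :
    0 < ∫ x in (0 : ℝ)..1, ∫ y in (0 : ℝ)..x, Real.exp (-lam * t * y) * y ^ (p - 1) := by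
  have hi : ∀ x, IntervalIntegrable (fun y : ℝ => Real.exp (-lam * t * y) * y ^ (p - 1))
      volume 0 x := fun x =>
    (intervalIntegral.intervalIntegrable_rpow' (by linarith)).continuousOn_mul (by fun_prop)
  refine intervalIntegral.intervalIntegral_pos_of_pos_on ?_ (fun x hx => ?_) one_pos
  · refine ContinuousOn.intervalIntegrable ?_
    exact intervalIntegral.continuousOn_primitive_interval
      ((intervalIntegrable_iff' (by simp)).1 (hi 1))
  · refine intervalIntegral.intervalIntegral_pos_of_pos_on (hi x) (fun y hy => ?_) hx.1
    have := hy.1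
    positivity

lemma blockInt_pos (hc : 0 < c) (hα0 : 0 < α) (k : ℕ) {a b : ℝ} (hab : a < b) :
    0 < blockInt c lam α k a b := by
  cases k with
  | zero => rw [blockInt_zero hab.le]; linarith
  | succ k =>
    have hkα : 0 < ((k + 1 : ℕ) : ℝ) * α := by positivity
    rw [blockInt_succ_eq hα0 k hab]
    have h1 := integral_exp_mul_rpow_pos (lam := lam) hkα (b - a)
    have h2 := Real.Gamma_pos_of_pos hkα
    have h3 : 0 < nu α c := mul_pos hc (Real.Gamma_pos_of_pos hα0)
    have h4 : 0 < b - a := sub_pos.2 hab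
    positivity

/-! ### Two-sided bounds for iterated integrals over distant short blocks -/

/-- Bounds for the integral over later blocks pass through the integrals over copies of one
block. -/
lemma chainInt_replicate_append_mem_Icc (hc : 0 ≤ c) (hα0 : 0 < α) (hα1 : α ≤ 1) {a b : ℝ}
    (ha : 0 ≤ a) (hb : b ≤ T) (l : List (ℝ × ℝ)) (hl : ∀ J ∈ l, 0 ≤ J.1 ∧ J.2 ≤ T) {lo hi : ℝ}
    (h : ∀ y ∈ Ioc a b, chainInt (kern c lam α) l y ∈ Icc lo hi) (k : ℕ) :
    ∀ y ∈ Ioc a b, chainInt (kern c lam α) (List.replicate k (a, b) ++ l) y ∈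
      Icc (chainInt (kern c lam α) (List.replicate k (a, b)) y * lo)
        (chainInt (kern c lam α) (List.replicate k (a, b)) y * hi) := by
  induction k with
  | zero => simpa [chainInt] using h
  | succ k ih =>
    intro x hx
    have hx0 : 0 ≤ x := ha.trans hx.1.le
    have hrep : ∀ J ∈ List.replicate k (a, b), 0 ≤ J.1 ∧ J.2 ≤ T := fun J hJ => by
      rw [List.mem_replicate] at hJ; rw [hJ.2]; exact ⟨ha, hb⟩
    have hI := integrableOn_kern_mul_chainInt (lam := lam) hc hα0 hα1 (T := T) (b := b)
      (List.replicate k (a, b) ++ l) (fun J hJ => (List.mem_append.1 hJ).elim (hrep J) (hl J))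
      hx0 ha hb
    have hI' := integrableOn_kern_mul_chainInt (lam := lam) hc hα0 hα1 (T := T) (b := b)
      (List.replicate k (a, b)) hrep hx0 ha hb
    simp only [List.replicate_succ, List.cons_append, chainInt]
    rw [← integral_mul_const, ← integral_mul_const]
    constructor
    · refine setIntegral_mono_on (hI'.mul_const _) hI measurableSet_Ioc fun y hy => ?_
      rw [mul_assoc]
      exact mul_le_mul_of_nonneg_left (ih y hy).1 (kern_nonneg hc _)
    · refine setIntegral_mono_on hI (hI'.mul_const _) measurableSet_Ioc fun y hy => ?_
      rw [mul_assoc]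
      exact mul_le_mul_of_nonneg_left (ih y hy).2 (kern_nonneg hc _)

lemma integral_chainInt_replicate_append_mem_Icc (hc : 0 ≤ c) (hα0 : 0 < α) (hα1 : α ≤ 1)
    {a b : ℝ} (ha : 0 ≤ a) (hb : b ≤ T) (l : List (ℝ × ℝ)) (hl : ∀ J ∈ l, 0 ≤ J.1 ∧ J.2 ≤ T)
    {lo hi : ℝ} (h : ∀ y ∈ Ioc a b, chainInt (kern c lam α) l y ∈ Icc lo hi) (k : ℕ) :
    ∫ y in Ioc a b, chainInt (kern c lam α) (List.replicate k (a, b) ++ l) y ∈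
      Icc (blockInt c lam α k a b * lo) (blockInt c lam α k a b * hi) := by
  have hrep : ∀ J ∈ List.replicate k (a, b), 0 ≤ J.1 ∧ J.2 ≤ T := fun J hJ => by
    rw [List.mem_replicate] at hJ; rw [hJ.2]; exact ⟨ha, hb⟩
  have hI := integrableOn_chainInt (lam := lam) hc hα0 hα1 (T := T) (a := a) (b := b)
    (List.replicate k (a, b) ++ l) (fun J hJ => (List.mem_append.1 hJ).elim (hrep J) (hl J)) ha
  have hI' := integrableOn_chainInt (lam := lam) hc hα0 hα1 (T := T) (a := a) (b := b)
    (List.replicate k (a, b)) hrep ha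
  have key := chainInt_replicate_append_mem_Icc hc hα0 hα1 ha hb l hl h k
  rw [blockInt, ← integral_mul_const, ← integral_mul_const]
  exact ⟨setIntegral_mono_on (hI'.mul_const _) hI measurableSet_Ioc fun y hy => (key y hy).1,
    setIntegral_mono_on hI (hI'.mul_const _) measurableSet_Ioc fun y hy => (key y hy).2⟩

/-- The block of length `d` that ends at `t r`. -/
def shortBlock (t : ℕ → ℝ) (d : ℝ) (r : ℕ) : ℝ × ℝ := (t r - d, t r)

/-- As the kernel is decreasing, iterated integrals over short blocks lie between products in
which every gap between consecutive blocks is replaced by its largest or its smallest value. -/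
lemma chainInt_flat_mem_Icc (hc : 0 < c) (hα0 : 0 < α) (hα1 : α ≤ 1) (hT : 0 < T)
    (hlam : (α - 1) / T < lam) (t : ℕ → ℝ) (k : ℕ → ℕ) {d : ℝ} (hd : 0 < d) (m i : ℕ)
    (h0 : 0 ≤ t i - d)
    (h : ∀ r ∈ Finset.Ico (i + 1) (i + 1 + m), 0 ≤ t r - d ∧ t r ≤ T ∧ 0 < t r - t (r - 1) - d ∧
      t r - t (r - 1) + d ≤ T ∧ 1 ≤ k r) :
    ∀ x ∈ Ioc (t i - d) (t i),
      chainInt (kern c lam α) (flat (shortBlock t d) k (i + 1) m) x ∈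
      Icc (∏ r ∈ Finset.Ico (i + 1) (i + 1 + m),
          kern c lam α (t r - t (r - 1) + d) * blockInt c lam α (k r - 1) (t r - d) (t r))
        (∏ r ∈ Finset.Ico (i + 1) (i + 1 + m),
          kern c lam α (t r - t (r - 1) - d) * blockInt c lam α (k r - 1) (t r - d) (t r)) := by
  induction m generalizing i with
  | zero => intro x _; simp [flat, chainInt]
  | succ m ih =>
    intro x hx
    have hi := h (i + 1) (by simp)
    have hr : ∀ r ∈ Finset.Ico (i + 1 + 1) (i + 1 + 1 + m), 0 ≤ t r - d ∧ t r ≤ T ∧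
        0 < t r - t (r - 1) - d ∧ t r - t (r - 1) + d ≤ T ∧ 1 ≤ k r := fun r hr => by
      rw [Finset.mem_Ico] at hr
      exact h r (Finset.mem_Ico.2 (by omega))
    have ih' := ih (i + 1) hi.1 hr
    obtain ⟨q, hq⟩ : ∃ q, k (i + 1) = q + 1 := ⟨k (i + 1) - 1, by omega⟩
    have hl : ∀ J ∈ flat (shortBlock t d) k (i + 1 + 1) m, 0 ≤ J.1 ∧ J.2 ≤ T := fun J hJ => by
      obtain ⟨r, hr', rfl⟩ := mem_flat _ _ hJ
      exact ⟨(hr r hr').1, (hr r hr').2.1⟩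
    have key := integral_chainInt_replicate_append_mem_Icc hc.le hα0 hα1 hi.1 hi.2.1 _ hl ih' q
    have hx0 : 0 ≤ x := h0.trans hx.1.le
    have hl' : ∀ J ∈ List.replicate q (t (i + 1) - d, t (i + 1)) ++
        flat (shortBlock t d) k (i + 1 + 1) m, 0 ≤ J.1 ∧ J.2 ≤ T := fun J hJ => by
      rcases List.mem_append.1 hJ with hJ | hJ
      · rw [List.mem_replicate] at hJ; rw [hJ.2]; exact ⟨hi.1, hi.2.1⟩
      · exact hl J hJ
    have hI := integrableOn_kern_mul_chainInt (lam := lam) hc.le hα0 hα1 (T := T)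
      _ hl' hx0 hi.1 hi.2.1
    have hI' := integrableOn_chainInt (lam := lam) hc.le hα0 hα1 (T := T) (b := t (i + 1)) _ hl' hi.1
    rw [flat, hq, List.replicate_succ, List.cons_append,
      show i + 1 + (m + 1) = i + 1 + 1 + m by omega,
      Finset.prod_eq_prod_Ico_succ_bot (a := i + 1) (b := i + 1 + 1 + m) (by omega),
      Finset.prod_eq_prod_Ico_succ_bot (a := i + 1) (b := i + 1 + 1 + m) (by omega), hq,
      Nat.add_sub_cancel, Nat.add_sub_cancel, chainInt, mul_assoc, mul_assoc]
    have hanti := (kern_strictAntiOn hc hT hα1 hlam).antitoneOn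
    simp only [shortBlock]
    have hgap := hi.2.2.1
    have hgap' := hi.2.2.2.1
    rw [Nat.add_sub_cancel] at hgap hgap'
    constructor
    · refine (mul_le_mul_of_nonneg_left key.1 (kern_nonneg hc.le _)).trans ?_
      rw [← integral_const_mul]
      refine setIntegral_mono_on (hI'.const_mul _) hI measurableSet_Ioc fun y hy => ?_
      refine mul_le_mul_of_nonneg_right ?_ (chainInt_nonneg (kern_nonneg hc.le) _ _)
      exact hanti ⟨by linarith [hy.1, hx.2], by linarith [hy.2, hx.1]⟩ ⟨by linarith, hgap'⟩
        (by linarith [hy.2, hx.1])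
    · refine le_trans ?_ (mul_le_mul_of_nonneg_left key.2 (kern_nonneg hc.le _))
      rw [← integral_const_mul]
      refine setIntegral_mono_on hI (hI'.const_mul _) measurableSet_Ioc fun y hy => ?_
      refine mul_le_mul_of_nonneg_right ?_ (chainInt_nonneg (kern_nonneg hc.le) _ _)
      exact hanti ⟨hgap, by linarith⟩ ⟨by linarith [hy.1, hx.2], by linarith [hy.2, hx.1]⟩
        (by linarith [hy.1, hx.2])

end Asymptotics

/-! ### Moments of the limit process in closed form -/

/-- The path starts at `0` almost surely, mixed moments of its increments are finite, and over
ordered intervals they are given by iterated integrals of the kernel. -/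
structure HasIncrementMoments {Ω : Type*} [MeasurableSpace Ω] {T : ℝ} (hT : 0 ≤ T)
    (α b c lam : ℝ) (X : Ω → SkorokhodSpace T) (P : Measure Ω) : Prop where
  clamp_zero : ∀ᵐ ω ∂P, clamp hT (X ω) 0 = 0
  integrable_prod : ∀ (s : Finset ℕ) (u v : ℕ → ℝ) (k : ℕ → ℕ),
    Integrable (fun ω => ∏ i ∈ s, (clamp hT (X ω) (v i) - clamp hT (X ω) (u i)) ^ k i) P
  integral_prod : ∀ (J : ℕ → ℝ × ℝ) (k : ℕ → ℕ) (i m : ℕ),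
    (∀ r ∈ Finset.Ico i (i + m), 0 ≤ (J r).1 ∧ (J r).1 ≤ (J r).2 ∧ (J r).2 ≤ T) →
    (∀ r ∈ Finset.Ico i (i + m), ∀ r' ∈ Finset.Ico i (i + m), r < r' → (J r).2 ≤ (J r').1) →
    ∀ (J₀ : ℝ × ℝ) (l : List (ℝ × ℝ)), flat J k i m = J₀ :: l →
    ∫ ω, ∏ r ∈ Finset.Ico i (i + m),
      (clamp hT (X ω) (J r).2 - clamp hT (X ω) (J r).1) ^ k r ∂P =
      (∏ r ∈ Finset.Ico i (i + m), ((k r).factorial : ℝ)) *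
        (aT α b c lam T * ∫ y in Ioc J₀.1 J₀.2, chainInt (kern c lam α) l y)

section

variable {α b c lam T : ℝ} {Ω : Type*} {X : Ω → SkorokhodSpace T}

lemma at_eq_clamp (hT : 0 ≤ T) {t : ℝ} (ht : t ∈ Icc 0 T) (ω : Ω) :
    at_ X t ω = clamp hT (X ω) t := eval_eq_clamp hT _ ht

lemma incr_eq_clamp (hT : 0 ≤ T) {d t : ℝ} (hd : 0 ≤ d) (h0 : 0 ≤ t - d) (ht : t ≤ T) (ω : Ω) :
    incr X d t ω = clamp hT (X ω) t - clamp hT (X ω) (t - d) := by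
  rw [incr, at_eq_clamp hT ⟨by linarith, ht⟩, at_eq_clamp hT ⟨h0, by linarith⟩]

variable [MeasurableSpace Ω] {P : Measure Ω} {hT : 0 ≤ T}

lemma HasIncrementMoments.integrable_pow (H : HasIncrementMoments hT α b c lam X P) (u v : ℝ)
    (k : ℕ) : Integrable (fun ω => (clamp hT (X ω) v - clamp hT (X ω) u) ^ k) P := by
  simpa using H.integrable_prod {0} (fun _ => u) (fun _ => v) (fun _ => k)

lemma HasIncrementMoments.integrable_mul (H : HasIncrementMoments hT α b c lam X P)
    (u v u' v' : ℝ) : Integrable (fun ω => (clamp hT (X ω) v - clamp hT (X ω) u) *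
      (clamp hT (X ω) v' - clamp hT (X ω) u')) P := by
  have := H.integrable_prod {0, 1} (fun i => if i = 0 then u else u')
    (fun i => if i = 0 then v else v') (fun _ => 1)
  simpa using this

lemma HasIncrementMoments.integral_pow (H : HasIncrementMoments hT α b c lam X P) {u v : ℝ}
    (hu : 0 ≤ u) (huv : u ≤ v) (hv : v ≤ T) {k : ℕ} (hk : 1 ≤ k) :
    ∫ ω, (clamp hT (X ω) v - clamp hT (X ω) u) ^ k ∂P =
      k.factorial * (aT α b c lam T * blockInt c lam α (k - 1) u v) := by
  obtain ⟨q, rfl⟩ : ∃ q, k = q + 1 := ⟨k - 1, by omega⟩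
  have := H.integral_prod (fun _ => (u, v)) (fun _ => q + 1) 0 1 (by simp [hu, huv, hv]) (by simp)
    (u, v) (List.replicate q (u, v)) (by simp [flat, List.replicate_succ])
  simpa [blockInt] using this

lemma HasIncrementMoments.integral_mul (H : HasIncrementMoments hT α b c lam X P) {u v u' v' : ℝ}
    (hu : 0 ≤ u) (huv : u ≤ v) (hvu : v ≤ u') (huv' : u' ≤ v') (hv : v' ≤ T) :
    ∫ ω, (clamp hT (X ω) v - clamp hT (X ω) u) * (clamp hT (X ω) v' - clamp hT (X ω) u') ∂P =
      aT α b c lam T * ∫ x in Ioc u v, ∫ y in Ioc u' v', kern c lam α (y - x) := by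
  have := H.integral_prod (fun i => if i = 0 then (u, v) else (u', v')) (fun _ => 1) 0 2
    (fun r _ => by
      by_cases h : r = 0
      · simp only [h, if_true]; exact ⟨hu, huv, by linarith⟩
      · simp only [h, if_false]; exact ⟨by linarith, huv', hv⟩)
    (fun r hr r' hr' hrr => by
      rw [Finset.mem_Ico] at hr hr'
      obtain rfl : r = 0 := by omega
      obtain rfl : r' = 1 := by omega
      simpa using hvu)
    (u, v) [(u', v')] (by simp [flat])
  simpa [Finset.prod_range_succ, chainInt] using this

lemma HasIncrementMoments.integral_incr (H : HasIncrementMoments hT α b c lam X P) {d t : ℝ}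
    (hd : 0 ≤ d) (h0 : 0 ≤ t - d) (ht : t ≤ T) {k : ℕ} (hk : 1 ≤ k) :
    ∫ ω, incr X d t ω ^ k ∂P =
      k.factorial * (aT α b c lam T * blockInt c lam α (k - 1) (t - d) t) := by
  simp only [incr_eq_clamp hT hd h0 ht]
  exact H.integral_pow h0 (by linarith) ht hk

/-! ### Moments of the values of the process -/

lemma HasIncrementMoments.at_ae_eq (H : HasIncrementMoments hT α b c lam X P) {t : ℝ}
    (ht : t ∈ Icc 0 T) : at_ X t =ᵐ[P] fun ω => clamp hT (X ω) t - clamp hT (X ω) 0 := by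
  filter_upwards [H.clamp_zero] with ω hω
  rw [at_eq_clamp hT ht, hω, sub_zero]

lemma HasIncrementMoments.integrable_at_pow (H : HasIncrementMoments hT α b c lam X P) {t : ℝ}
    (ht : t ∈ Icc 0 T) (k : ℕ) : Integrable (fun ω => at_ X t ω ^ k) P := by
  refine (H.integrable_pow 0 t k).congr ?_
  filter_upwards [H.at_ae_eq ht] with ω hω
  rw [hω]

lemma HasIncrementMoments.integral_at_pow (H : HasIncrementMoments hT α b c lam X P) {t : ℝ}
    (ht : t ∈ Icc 0 T) {k : ℕ} (hk : 1 ≤ k) :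
    ∫ ω, at_ X t ω ^ k ∂P =
      k.factorial * (aT α b c lam T * blockInt c lam α (k - 1) 0 t) := by
  rw [← H.integral_pow le_rfl ht.1 ht.2 hk]
  refine integral_congr_ae ?_
  filter_upwards [H.at_ae_eq ht] with ω hω
  rw [hω]

lemma HasIncrementMoments.integral_at (H : HasIncrementMoments hT α b c lam X P) {t : ℝ}
    (ht : t ∈ Icc 0 T) : ∫ ω, at_ X t ω ∂P = t * aT α b c lam T := by
  have := H.integral_at_pow ht le_rfl
  simp only [pow_one] at this
  rw [this, Nat.sub_self, blockInt_zero ht.1]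
  simp [mul_comm]

lemma HasIncrementMoments.integral_at_pow_eq (H : HasIncrementMoments hT α b c lam X P)
    (hα0 : 0 < α) {t : ℝ} (ht0 : 0 < t) (htT : t ≤ T) {k : ℕ} (hk : 2 ≤ k) :
    ∫ ω, at_ X t ω ^ k ∂P =
      t ^ (α * ((k : ℝ) - 1) + 1) *
        (aT α b c lam T * (k.factorial : ℝ) * nu α c ^ (k - 1) / Real.Gamma (((k : ℝ) - 1) * α)) *
        ∫ x in (0 : ℝ)..1, ∫ y in (0 : ℝ)..x,
          Real.exp (-lam * t * y) * y ^ (α * ((k : ℝ) - 1) - 1) := by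
  obtain ⟨q, rfl⟩ : ∃ q, k = q + 1 + 1 := ⟨k - 2, by omega⟩
  rw [H.integral_at_pow ⟨ht0.le, htT⟩ (by omega), Nat.add_sub_cancel, blockInt_succ_eq hα0 q ht0,
    sub_zero]
  have e : ((q + 1 + 1 : ℕ) : ℝ) - 1 = ((q + 1 : ℕ) : ℝ) := by push_cast; ring
  rw [e, mul_comm α]
  ring

lemma integral_integral_kern_eq (hα0 : 0 < α) {t s : ℝ} (ht : 0 < t) (hts : t < s) :
    ∫ x in Ioc 0 t, ∫ y in Ioc t s, kern c lam α (y - x) =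
      s ^ (α + 1) * c * ∫ x₂ in (t / s)..1, ∫ x₁ in (0 : ℝ)..(t / s),
        (x₂ - x₁) ^ (α - 1) * Real.exp (-lam * s * (x₂ - x₁)) := by
  have hs : 0 < s := ht.trans hts
  have hts1 : t / s ≤ 1 := by rw [div_le_one hs]; exact hts.le
  have hts0 : 0 ≤ t / s := by positivity
  rw [integral_integral_swap]
  · rw [← intervalIntegral.integral_of_le hts.le]
    simp only [← intervalIntegral.integral_of_le ht.le]
    have h1 : ∀ (f : ℝ → ℝ) (p q : ℝ), ∫ y in p..q, f y = s * ∫ y in (p / s)..(q / s), f (s * y) := by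
      intro f p q
      rw [intervalIntegral.integral_comp_mul_left f hs.ne', smul_eq_mul, mul_inv_cancel_left₀ hs.ne',
        mul_div_cancel₀ _ hs.ne', mul_div_cancel₀ _ hs.ne']
    rw [h1, div_self hs.ne']
    simp only [h1 _ 0 t, zero_div]
    rw [← intervalIntegral.integral_const_mul, ← intervalIntegral.integral_const_mul,
      intervalIntegral.integral_of_le hts1, intervalIntegral.integral_of_le hts1]
    refine setIntegral_congr_fun measurableSet_Ioc fun y hy => ?_
    rw [← intervalIntegral.integral_const_mul, ← intervalIntegral.integral_const_mul,
      ← intervalIntegral.integral_const_mul, intervalIntegral.integral_of_le hts0,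
      intervalIntegral.integral_of_le hts0]
    refine setIntegral_congr_fun measurableSet_Ioc fun x hx => ?_
    have hxy : 0 < y - x := by linarith [hx.2, hy.1]
    rw [← mul_sub, kern_of_pos (mul_pos hs hxy), Real.mul_rpow hs.le hxy.le, Real.rpow_sub hs,
      Real.rpow_add hs, Real.rpow_one, ← mul_assoc (-lam)]
    field_simp
  · have hf : Integrable ((Ioc 0 t).indicator fun _ => (1 : ℝ)) :=
      (integrable_indicator_iff measurableSet_Ioc).2 (integrableOn_const (by simp))
    have hg := integrable_indicator_kern c lam hα0 s
    have hfg := (hf.convolution_integrand (ContinuousLinearMap.mul ℝ ℝ) hg).swap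
    rw [Measure.prod_restrict]
    refine (hfg.mono_measure Measure.restrict_le_self).congr ?_
    rw [EventuallyEq, ae_restrict_iff' (measurableSet_Ioc.prod measurableSet_Ioc)]
    refine Eventually.of_forall fun p hp => ?_
    obtain ⟨hp1, hp2⟩ := hp
    simp only [Function.comp, Prod.swap, ContinuousLinearMap.mul_apply', Function.uncurry]
    rw [indicator_of_mem hp1, indicator_of_mem (show p.2 - p.1 ∈ Iic s by
      simp only [mem_Iic]; linarith [hp1.1, hp2.2]), one_mul]

lemma HasIncrementMoments.at_mul_at (H : HasIncrementMoments hT α b c lam X P) (hα0 : 0 < α)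
    {t s : ℝ} (ht : 0 < t) (hts : t < s) (hs : s ≤ T) :
    Integrable (fun ω => at_ X t ω * at_ X s ω) P ∧
    ∫ ω, at_ X t ω * at_ X s ω ∂P =
      s ^ (α + 1) * c * aT α b c lam T *
            (∫ x₂ in (t / s)..1, ∫ x₁ in (0 : ℝ)..(t / s),
              (x₂ - x₁) ^ (α - 1) * Real.exp (-lam * s * (x₂ - x₁))) +
          t ^ (α + 1) * (2 * c * aT α b c lam T) *
            (∫ x in (0 : ℝ)..1, ∫ y in (0 : ℝ)..x, Real.exp (-lam * t * y) * y ^ (α - 1)) := by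
  have htm : t ∈ Icc 0 T := ⟨ht.le, hts.le.trans hs⟩
  have hsm : s ∈ Icc 0 T := ⟨(ht.trans hts).le, hs⟩
  -- `X_t X_s = X_t (X_s - X_t) + X_t²`, with `X_0 = 0`.
  have e : (fun ω => at_ X t ω * at_ X s ω) =ᵐ[P] fun ω =>
      (clamp hT (X ω) t - clamp hT (X ω) 0) * (clamp hT (X ω) s - clamp hT (X ω) t) +
      (clamp hT (X ω) t - clamp hT (X ω) 0) ^ 2 := by
    filter_upwards [H.at_ae_eq htm, H.at_ae_eq hsm] with ω h1 h2
    rw [h1, h2]; ring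
  have i1 := H.integrable_mul 0 t t s
  have i2 := H.integrable_pow 0 t 2
  refine ⟨(i1.add i2).congr e.symm, ?_⟩
  rw [integral_congr_ae e, integral_add i1 i2, H.integral_mul le_rfl ht.le le_rfl hts.le hs,
    H.integral_pow le_rfl ht.le htm.2 (by norm_num), integral_integral_kern_eq hα0 ht hts,
    show 2 - 1 = 0 + 1 by norm_num, blockInt_succ_eq hα0 0 ht, sub_zero]
  have hΓ := (Real.Gamma_pos_of_pos hα0).ne'
  simp only [zero_add, Nat.cast_one, one_mul, pow_one, nu, Nat.factorial_two, Nat.cast_ofNat]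
  rw [mul_div_cancel_right₀ _ hΓ]
  ring

lemma HasIncrementMoments.memLp_at (H : HasIncrementMoments hT α b c lam X P) {t : ℝ}
    (ht : t ∈ Icc 0 T) : MemLp (at_ X t) 2 P := by
  have h1 := H.integrable_at_pow ht 1
  simp only [pow_one] at h1
  exact (memLp_two_iff_integrable_sq h1.aestronglyMeasurable).2 (H.integrable_at_pow ht 2)

lemma HasIncrementMoments.memLp_incr (H : HasIncrementMoments hT α b c lam X P) {d t : ℝ}
    (hd : 0 ≤ d) (h0 : 0 ≤ t - d) (ht : t ≤ T) : MemLp (incr X d t) 2 P :=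
  (H.memLp_at ⟨by linarith, ht⟩).sub (H.memLp_at ⟨h0, by linarith⟩)

end

/-! ### Short increments at distinct times -/

lemma le_of_steps_lt {t : ℕ → ℝ} {m : ℕ} (h : ∀ i ∈ Finset.Icc 2 m, t (i - 1) < t i) {r s : ℕ}
    (hr : 1 ≤ r) (hrs : r ≤ s) (hs : s ≤ m) : t r ≤ t s := by
  induction s, hrs using Nat.le_induction with
  | base => exact le_rfl
  | succ s hrs ih =>
    have := h (s + 1) (Finset.mem_Icc.2 (by omega))
    rw [Nat.add_sub_cancel] at this
    exact (ih (by omega)).trans this.le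

/-- The exponential factors of the kernel telescope. -/
lemma prod_kern_div (c lam α A : ℝ) (t : ℕ → ℝ) (q : ℕ)
    (h : ∀ i ∈ Finset.Ico 2 (2 + q), t (i - 1) < t i) :
    ∏ r ∈ Finset.Ico 2 (2 + q), kern c lam α (t r - t (r - 1)) / A =
      Real.exp (-lam * (t (q + 1) - t 1)) * (c / A) ^ q *
        ∏ r ∈ Finset.Ico 2 (2 + q), (t r - t (r - 1)) ^ (α - 1) := by
  induction q with
  | zero => simp
  | succ q ih =>
    have hq := h (2 + q) (Finset.mem_Ico.2 (by omega))
    rw [show 2 + (q + 1) = 2 + q + 1 by omega, Finset.prod_Ico_succ_top (by omega),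
      Finset.prod_Ico_succ_top (by omega), ih (fun i hi => h i (by rw [Finset.mem_Ico] at *; omega)),
      kern_of_pos (by linarith), show 2 + q - 1 = q + 1 by omega, show 2 + q = q + 1 + 1 by omega,
      pow_succ]
    have e : Real.exp (-lam * (t (q + 1 + 1) - t 1)) =
        Real.exp (-lam * (t (q + 1) - t 1)) * Real.exp (-lam * (t (q + 1 + 1) - t (q + 1))) := by
      rw [← Real.exp_add]; congr 1; ring
    rw [e]; ring

section

variable {α b c lam T : ℝ} {Ω : Type*} [MeasurableSpace Ω] {P : Measure Ω}
  {X : Ω → SkorokhodSpace T} {hT : 0 ≤ T}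

/-- The normalized mixed moment of increments over short blocks lies between the products of
kernel values at the smallest and largest gaps between consecutive blocks. -/
lemma HasIncrementMoments.ratio_mem_Icc (H : HasIncrementMoments hT α b c lam X P) (hT0 : 0 < T)
    (hb : 0 < b) (hc : 0 < c) (hα0 : 0 < α) (hα1 : α ≤ 1) (hlam : (α - 1) / T < lam) (t : ℕ → ℝ)
    (k : ℕ → ℕ) (q : ℕ) {d : ℝ} (hd : 0 < d) (h1 : 0 ≤ t 1 - d) (h1T : t 1 ≤ T) (hk1 : 1 ≤ k 1)
    (h : ∀ r ∈ Finset.Ico 2 (2 + q), 0 ≤ t r - d ∧ t r ≤ T ∧ 0 < t r - t (r - 1) - d ∧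
      t r - t (r - 1) + d ≤ T ∧ 1 ≤ k r) :
    (∫ ω, ∏ i ∈ Finset.Ico 1 (1 + (q + 1)), incr X d (t i) ω ^ k i ∂P) /
        ∏ i ∈ Finset.Ico 1 (1 + (q + 1)), ∫ ω, incr X d (t i) ω ^ k i ∂P ∈
      Icc (∏ r ∈ Finset.Ico 2 (2 + q), kern c lam α (t r - t (r - 1) + d) / aT α b c lam T)
        (∏ r ∈ Finset.Ico 2 (2 + q), kern c lam α (t r - t (r - 1) - d) / aT α b c lam T) := by
  have haT : 0 < aT α b c lam T := by rw [aT_eq b T hT0]; exact mul_pos hb (kern_pos hc hT0)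
  have hall : ∀ r ∈ Finset.Ico 1 (1 + (q + 1)), 0 ≤ t r - d ∧ t r ≤ T ∧ 1 ≤ k r := fun r hr => by
    rw [Finset.mem_Ico] at hr
    rcases Nat.eq_or_lt_of_le hr.1 with rfl | h2
    · exact ⟨h1, h1T, hk1⟩
    · have := h r (Finset.mem_Ico.2 (by omega))
      exact ⟨this.1, this.2.1, this.2.2.2.2⟩
  have hstep : ∀ r ∈ Finset.Ico 2 (2 + q), t (r - 1) ≤ t r := fun r hr => by
    have := (h r hr).2.2.1
    linarith
  have hord : ∀ r ∈ Finset.Ico 1 (1 + (q + 1)), ∀ r' ∈ Finset.Ico 1 (1 + (q + 1)), r < r' →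
      t r ≤ t r' - d := fun r hr r' hr' hrr => by
    rw [Finset.mem_Ico] at hr hr'
    have h2 := (h r' (Finset.mem_Ico.2 (by omega))).2.2.1
    have h3 : t r ≤ t (r' - 1) := by
      have hle : r ≤ r' - 1 := by omega
      have hr'q : r' - 1 ≤ q + 1 := by omega
      generalize r' - 1 = s at hle hr'q
      induction s, hle using Nat.le_induction with
      | base => exact le_rfl
      | succ s hs ih =>
        have := hstep (s + 1) (Finset.mem_Ico.2 (by omega))
        rw [Nat.add_sub_cancel] at this
        exact (ih (by omega)).trans this
    linarith
  obtain ⟨p, hp⟩ : ∃ p, k 1 = p + 1 := ⟨k 1 - 1, by omega⟩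
  have hnum : ∫ ω, ∏ i ∈ Finset.Ico 1 (1 + (q + 1)), incr X d (t i) ω ^ k i ∂P =
      (∏ r ∈ Finset.Ico 1 (1 + (q + 1)), ((k r).factorial : ℝ)) * (aT α b c lam T *
        ∫ y in Ioc (t 1 - d) (t 1), chainInt (kern c lam α)
          (List.replicate p (t 1 - d, t 1) ++ flat (shortBlock t d) k (1 + 1) q) y) := by
    rw [← H.integral_prod (shortBlock t d) k 1 (q + 1)
      (fun r hr => ⟨(hall r hr).1, by simp only [shortBlock]; linarith, (hall r hr).2.1⟩) hord
      (t 1 - d, t 1)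
      (List.replicate p (t 1 - d, t 1) ++ flat (shortBlock t d) k (1 + 1) q)
      (by rw [flat, hp, List.replicate_succ]; rfl)]
    refine integral_congr_ae (Eventually.of_forall fun ω => Finset.prod_congr rfl fun r hr => ?_)
    rw [incr_eq_clamp hT hd.le (hall r hr).1 (hall r hr).2.1]
    rfl
  have hden : ∏ i ∈ Finset.Ico 1 (1 + (q + 1)), ∫ ω, incr X d (t i) ω ^ k i ∂P =
      (∏ r ∈ Finset.Ico 1 (1 + (q + 1)), ((k r).factorial : ℝ)) *
        ∏ r ∈ Finset.Ico 1 (1 + (q + 1)),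
          (aT α b c lam T * blockInt c lam α (k r - 1) (t r - d) (t r)) := by
    rw [← Finset.prod_mul_distrib]
    exact Finset.prod_congr rfl fun r hr =>
      H.integral_incr hd.le (hall r hr).1 (hall r hr).2.1 (hall r hr).2.2
  have hF : (0 : ℝ) < ∏ r ∈ Finset.Ico 1 (1 + (q + 1)), ((k r).factorial : ℝ) :=
    Finset.prod_pos fun r _ => by positivity
  have hB : ∀ r, 0 < blockInt c lam α (k r - 1) (t r - d) (t r) := fun r =>
    blockInt_pos hc hα0 _ (by linarith)
  have hl : ∀ J ∈ flat (shortBlock t d) k (1 + 1) q, 0 ≤ J.1 ∧ J.2 ≤ T := fun J hJ => by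
    obtain ⟨r, hr, rfl⟩ := mem_flat _ _ hJ
    exact ⟨(h r hr).1, (h r hr).2.1⟩
  have key := integral_chainInt_replicate_append_mem_Icc hc.le hα0 hα1 h1 h1T _ hl
    (chainInt_flat_mem_Icc hc hα0 hα1 hT0 hlam t k hd q 1 h1 h) p
  have hsplit : ∏ r ∈ Finset.Ico 1 (1 + (q + 1)),
      (aT α b c lam T * blockInt c lam α (k r - 1) (t r - d) (t r)) =
      aT α b c lam T * blockInt c lam α p (t 1 - d) (t 1) *
      ∏ r ∈ Finset.Ico 2 (2 + q),
        (aT α b c lam T * blockInt c lam α (k r - 1) (t r - d) (t r)) := by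
    rw [Finset.prod_eq_prod_Ico_succ_bot (by omega), hp, Nat.add_sub_cancel,
      show 1 + (q + 1) = 2 + q by omega]
  have hQ : 0 < ∏ r ∈ Finset.Ico 2 (2 + q),
      (aT α b c lam T * blockInt c lam α (k r - 1) (t r - d) (t r)) :=
    Finset.prod_pos fun r _ => mul_pos haT (hB r)
  have hB1 : 0 < blockInt c lam α p (t 1 - d) (t 1) := blockInt_pos hc hα0 _ (by linarith)
  have hcomb : ∀ f : ℕ → ℝ, ∏ r ∈ Finset.Ico 2 (2 + q), f r / aT α b c lam T =
      (∏ r ∈ Finset.Ico 2 (2 + q), f r * blockInt c lam α (k r - 1) (t r - d) (t r)) /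
      ∏ r ∈ Finset.Ico 2 (2 + q),
        (aT α b c lam T * blockInt c lam α (k r - 1) (t r - d) (t r)) := fun f => by
    rw [← Finset.prod_div_distrib]
    exact Finset.prod_congr rfl fun r _ => (mul_div_mul_right _ _ (hB r).ne').symm
  rw [hnum, hden, mul_div_mul_left _ _ hF.ne', hsplit, mul_assoc (aT α b c lam T),
    mul_div_mul_left _ _ haT.ne', hcomb, hcomb]
  constructor
  · rw [div_le_div_iff₀ hQ (mul_pos hB1 hQ)]
    calc _ = (blockInt c lam α p (t 1 - d) (t 1) * ∏ r ∈ Finset.Ico 2 (2 + q),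
          kern c lam α (t r - t (r - 1) + d) * blockInt c lam α (k r - 1) (t r - d) (t r)) *
          ∏ r ∈ Finset.Ico 2 (2 + q),
            (aT α b c lam T * blockInt c lam α (k r - 1) (t r - d) (t r)) := by ring
      _ ≤ _ := mul_le_mul_of_nonneg_right key.1 hQ.le
  · rw [div_le_div_iff₀ (mul_pos hB1 hQ) hQ]
    calc _ ≤ (blockInt c lam α p (t 1 - d) (t 1) * ∏ r ∈ Finset.Ico 2 (2 + q),
          kern c lam α (t r - t (r - 1) - d) * blockInt c lam α (k r - 1) (t r - d) (t r)) *
          ∏ r ∈ Finset.Ico 2 (2 + q),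
            (aT α b c lam T * blockInt c lam α (k r - 1) (t r - d) (t r)) :=
          mul_le_mul_of_nonneg_right key.2 hQ.le
      _ = _ := by ring

theorem HasIncrementMoments.tendsto_ratio (H : HasIncrementMoments hT α b c lam X P) (hT0 : 0 < T)
    (hb : 0 < b) (hc : 0 < c) (hα0 : 0 < α) (hα1 : α ≤ 1) (hlam : (α - 1) / T < lam)
    (m : ℕ) (hm : 1 ≤ m) (t : ℕ → ℝ) (k : ℕ → ℕ) (ht1 : 0 < t 1)
    (ht : ∀ i ∈ Finset.Icc 2 m, t (i - 1) < t i) (htm : t m ≤ T)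
    (hk : ∀ i ∈ Finset.Icc 1 m, 1 ≤ k i) :
    Tendsto (fun d : ℝ =>
      (∫ ω, ∏ i ∈ Finset.Icc 1 m, incr X d (t i) ω ^ k i ∂P) /
        ∏ i ∈ Finset.Icc 1 m, ∫ ω, incr X d (t i) ω ^ k i ∂P)
      (𝓝[>] 0)
      (𝓝 (Real.exp (-lam * (t m - t 1)) * (c / aT α b c lam T) ^ (m - 1) *
        ∏ i ∈ Finset.Icc 2 m, (t i - t (i - 1)) ^ (α - 1))) := by
  obtain ⟨q, rfl⟩ : ∃ q, m = q + 1 := ⟨m - 1, by omega⟩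
  have e1 : Finset.Icc 1 (q + 1) = Finset.Ico 1 (1 + (q + 1)) := by
    ext; simp only [Finset.mem_Icc, Finset.mem_Ico]; omega
  have e2 : Finset.Icc 2 (q + 1) = Finset.Ico 2 (2 + q) := by
    ext; simp only [Finset.mem_Icc, Finset.mem_Ico]; omega
  have hmono : ∀ {r s : ℕ}, 1 ≤ r → r ≤ s → s ≤ q + 1 → t r ≤ t s :=
    fun hr hrs hs => le_of_steps_lt ht hr hrs hs
  rw [Nat.add_sub_cancel]
  rw [e1] at hk ⊢
  rw [e2] at ht ⊢
  rw [← prod_kern_div c lam α (aT α b c lam T) t q ht]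
  have hid : Tendsto (fun d : ℝ => d) (𝓝[>] 0) (𝓝 0) := nhdsWithin_le_nhds
  have hlimk : ∀ σ : ℝ, Tendsto (fun d : ℝ => ∏ r ∈ Finset.Ico 2 (2 + q),
      kern c lam α (t r - t (r - 1) + σ * d) / aT α b c lam T) (𝓝[>] 0)
      (𝓝 (∏ r ∈ Finset.Ico 2 (2 + q), kern c lam α (t r - t (r - 1)) / aT α b c lam T)) := by
    intro σ
    refine tendsto_finsetProd _ fun r hr => Tendsto.div_const ?_ _
    refine (continuousAt_kern (sub_pos.2 (ht r hr)).ne').tendsto.comp ?_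
    simpa using (hid.const_mul σ).const_add (t r - t (r - 1))
  have hev : ∀ᶠ d in 𝓝[>] (0 : ℝ), ∀ r ∈ Finset.Ico 2 (2 + q), 0 < t r - t (r - 1) - d ∧
      t r - t (r - 1) + d ≤ T := by
    rw [Finset.eventually_all]
    intro r hr
    have hr' := Finset.mem_Ico.1 hr
    have g1 : 0 < t r - t (r - 1) := sub_pos.2 (ht r hr)
    have g2 : 0 < T - (t r - t (r - 1)) := by
      have := hmono (r := 1) (s := r - 1) le_rfl (by omega) (by omega)
      have := hmono (r := r) (s := q + 1) (by omega) (by omega) le_rfl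
      linarith
    filter_upwards [hid.eventually_lt_const g1, hid.eventually_lt_const g2] with d e1 e2
    constructor <;> linarith
  have hmem : ∀ᶠ d in 𝓝[>] (0 : ℝ),
      (∫ ω, ∏ i ∈ Finset.Ico 1 (1 + (q + 1)), incr X d (t i) ω ^ k i ∂P) /
        ∏ i ∈ Finset.Ico 1 (1 + (q + 1)), ∫ ω, incr X d (t i) ω ^ k i ∂P ∈
      Icc (∏ r ∈ Finset.Ico 2 (2 + q), kern c lam α (t r - t (r - 1) + d) / aT α b c lam T)
        (∏ r ∈ Finset.Ico 2 (2 + q), kern c lam α (t r - t (r - 1) - d) / aT α b c lam T) := by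
    filter_upwards [hev, hid.eventually_lt_const ht1, self_mem_nhdsWithin] with d hd1 hd2 hd0
    refine H.ratio_mem_Icc hT0 hb hc hα0 hα1 hlam t k q hd0 (by linarith)
      ((hmono le_rfl hm le_rfl).trans htm) (hk 1 (by simp)) fun r hr => ?_
    have hr' := Finset.mem_Ico.1 hr
    have g1 := hmono (r := 1) (s := r) le_rfl (by omega) (by omega)
    have g2 := hmono (r := r) (s := q + 1) (by omega) (by omega) le_rfl
    exact ⟨by linarith, by linarith, (hd1 r hr).1, (hd1 r hr).2,
      hk r (Finset.mem_Ico.2 (by omega))⟩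
  refine tendsto_of_tendsto_of_tendsto_of_le_of_le' (by simpa using hlimk 1)
    (by simpa [sub_eq_add_neg] using hlimk (-1)) (hmem.mono fun d hd => hd.1)
    (hmem.mono fun d hd => hd.2)

/-! ### Covariance and correlation of short increments -/

/-- As `d → 0` the exponential tends to `1` uniformly on the domain of integration. -/
lemma tendsto_integral_exp_mul_rpow (hα0 : 0 < α) :
    Tendsto (fun d : ℝ => ∫ x in (0 : ℝ)..1, ∫ y in (0 : ℝ)..x,
      Real.exp (-lam * d * y) * y ^ (α - 1)) (𝓝[>] 0) (𝓝 (1 / (α * (α + 1)))) := by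
  have hJ : ∫ x in (0 : ℝ)..1, ∫ y in (0 : ℝ)..x, y ^ (α - 1) = 1 / (α * (α + 1)) := by
    have : ∀ x : ℝ, ∫ y in (0 : ℝ)..x, y ^ (α - 1) = x ^ α / α := fun x => by
      rw [integral_rpow (Or.inl (by linarith)), sub_add_cancel, Real.zero_rpow hα0.ne', sub_zero]
    simp only [this]
    rw [intervalIntegral.integral_div, integral_rpow (Or.inl (by linarith)), Real.one_rpow,
      Real.zero_rpow (by linarith), sub_zero, div_div, mul_comm]
  have hi : ∀ d x, IntervalIntegrable (fun y : ℝ => Real.exp (-lam * d * y) * y ^ (α - 1))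
      volume 0 x := fun d x =>
    (intervalIntegral.intervalIntegrable_rpow' (by linarith)).continuousOn_mul (by fun_prop)
  have hi0 : ∀ x, IntervalIntegrable (fun y : ℝ => y ^ (α - 1)) volume 0 x := fun x =>
    intervalIntegral.intervalIntegrable_rpow' (by linarith)
  have hii : ∀ d, IntervalIntegrable (fun x : ℝ => ∫ y in (0 : ℝ)..x,
      Real.exp (-lam * d * y) * y ^ (α - 1)) volume 0 1 := fun d =>
    ContinuousOn.intervalIntegrable (intervalIntegral.continuousOn_primitive_interval
      ((intervalIntegrable_iff' (by simp)).1 (hi d 1)))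
  have hii0 : IntervalIntegrable (fun x : ℝ => ∫ y in (0 : ℝ)..x, y ^ (α - 1)) volume 0 1 :=
    ContinuousOn.intervalIntegrable (intervalIntegral.continuousOn_primitive_interval
      ((intervalIntegrable_iff' (by simp)).1 (hi0 1)))
  have hexp : ∀ d y : ℝ, 0 < d → 0 ≤ y → y ≤ 1 →
      Real.exp (-|lam| * d) ≤ Real.exp (-lam * d * y) ∧
      Real.exp (-lam * d * y) ≤ Real.exp (|lam| * d) := fun d y hd hy hy1 => by
    have h1 : |lam * (d * y)| ≤ |lam| * d := by
      rw [abs_mul, abs_of_nonneg (by positivity : 0 ≤ d * y)]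
      gcongr
      nlinarith
    rw [abs_le] at h1
    constructor <;> rw [Real.exp_le_exp] <;> nlinarith [h1.1, h1.2]
  have hlim : ∀ σ : ℝ, Tendsto (fun d : ℝ => Real.exp (σ * d) * (1 / (α * (α + 1)))) (𝓝[>] 0)
      (𝓝 (1 / (α * (α + 1)))) := fun σ => by
    have : Tendsto (fun d : ℝ => Real.exp (σ * d) * (1 / (α * (α + 1)))) (𝓝 0)
        (𝓝 (Real.exp (σ * 0) * (1 / (α * (α + 1))))) :=
      (by fun_prop : Continuous fun d : ℝ => Real.exp (σ * d) * (1 / (α * (α + 1)))).tendsto 0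
    rw [mul_zero, Real.exp_zero, one_mul] at this
    exact this.mono_left nhdsWithin_le_nhds
  refine tendsto_of_tendsto_of_tendsto_of_le_of_le' (hlim (-|lam|)) (hlim |lam|) ?_ ?_
  · filter_upwards [self_mem_nhdsWithin] with d hd
    rw [← hJ, ← intervalIntegral.integral_const_mul]
    refine intervalIntegral.integral_mono_on zero_le_one (hii0.const_mul _) (hii d) fun x hx => ?_
    rw [← intervalIntegral.integral_const_mul]
    refine intervalIntegral.integral_mono_on hx.1 ((hi0 x).const_mul _) (hi d x) fun y hy => ?_
    have := (hexp d y hd hy.1 (hy.2.trans hx.2)).1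
    have := Real.rpow_nonneg hy.1 (α - 1)
    gcongr
  · filter_upwards [self_mem_nhdsWithin] with d hd
    rw [← hJ, ← intervalIntegral.integral_const_mul]
    refine intervalIntegral.integral_mono_on zero_le_one (hii d) (hii0.const_mul _) fun x hx => ?_
    rw [← intervalIntegral.integral_const_mul]
    refine intervalIntegral.integral_mono_on hx.1 (hi d x) ((hi0 x).const_mul _) fun y hy => ?_
    have := (hexp d y hd hy.1 (hy.2.trans hx.2)).2
    have := Real.rpow_nonneg hy.1 (α - 1)
    gcongr

end

section

variable {α b c lam T : ℝ} {Ω : Type*} [MeasurableSpace Ω] {P : Measure Ω}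
  {X : Ω → SkorokhodSpace T} {hT : 0 ≤ T}

lemma HasIncrementMoments.integral_incr_one (H : HasIncrementMoments hT α b c lam X P) {d t : ℝ}
    (hd : 0 ≤ d) (h0 : 0 ≤ t - d) (ht : t ≤ T) :
    ∫ ω, incr X d t ω ∂P = aT α b c lam T * d := by
  have := H.integral_incr hd h0 ht le_rfl
  simp only [pow_one] at this
  rw [this, Nat.sub_self, blockInt_zero (by linarith)]
  simp

/-- The variance of a short increment. -/
lemma HasIncrementMoments.variance_incr [IsProbabilityMeasure P]
    (H : HasIncrementMoments hT α b c lam X P) (hα0 : 0 < α) {d t : ℝ} (hd : 0 < d)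
    (h0 : 0 ≤ t - d) (ht : t ≤ T) :
    Var[incr X d t; P] = aT α b c lam T * c * d ^ 2 *
      (2 * (∫ x in (0 : ℝ)..1, ∫ y in (0 : ℝ)..x, Real.exp (-lam * d * y) * y ^ (α - 1)) *
        d ^ (α - 1) - b * Real.exp (-lam * T) * T ^ (α - 1)) := by
  have h2 := H.integral_incr hd.le h0 ht (k := 2) (by norm_num)
  rw [show 2 - 1 = 0 + 1 by norm_num, blockInt_succ_eq hα0 0 (by linarith), sub_sub_cancel] at h2
  have hΓ := (Real.Gamma_pos_of_pos hα0).ne'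
  simp only [zero_add, Nat.cast_one, one_mul, pow_one, nu, Nat.factorial_two, Nat.cast_ofNat] at h2
  rw [mul_div_cancel_right₀ _ hΓ, show α + 1 = α - 1 + 2 by ring, Real.rpow_add hd,
    Real.rpow_two] at h2
  rw [variance_eq_sub (H.memLp_incr hd.le h0 ht), H.integral_incr_one hd.le h0 ht]
  have e : P[incr X d t ^ 2] = ∫ ω, incr X d t ω ^ 2 ∂P := rfl
  rw [e, h2]
  simp only [aT]
  ring

lemma eventually_incr_mem (s t : ℝ) (hs : 0 < s) (ht : 0 < t) :
    ∀ᶠ d in 𝓝[>] (0 : ℝ), 0 < d ∧ 0 ≤ s - d ∧ 0 ≤ s + t - d := by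
  have hid : Tendsto (fun d : ℝ => d) (𝓝[>] 0) (𝓝 0) := nhdsWithin_le_nhds
  filter_upwards [hid.eventually_lt_const hs, self_mem_nhdsWithin] with d h1 h2
  exact ⟨h2, by linarith, by linarith⟩

/-- The mixed second moment of two short increments, relative to the product of their means. -/
lemma HasIncrementMoments.tendsto_integral_incr_mul_incr
    (H : HasIncrementMoments hT α b c lam X P) (hT0 : 0 < T) (hb : 0 < b) (hc : 0 < c)
    (hα0 : 0 < α) (hα1 : α ≤ 1) (hlam : (α - 1) / T < lam) {s t : ℝ} (hs : 0 < s) (ht : 0 < t)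
    (hst : s + t ≤ T) :
    Tendsto (fun d : ℝ => (∫ ω, incr X d s ω * incr X d (s + t) ω ∂P) /
      (aT α b c lam T * d) ^ 2) (𝓝[>] 0)
      (𝓝 (c / aT α b c lam T * (Real.exp (-lam * t) * t ^ (α - 1)))) := by
  have key := H.tendsto_ratio hT0 hb hc hα0 hα1 hlam 2 (by norm_num)
    (fun r => if r = 1 then s else s + t) (fun _ => 1) (by simpa using hs) (by simp [ht])
    (by simpa using hst) (by simp)
  have e1 : Finset.Icc 1 2 = {1, 2} := rfl
  simp only [e1, Finset.Icc_self, Finset.prod_singleton, Finset.prod_pair (show 1 ≠ 2 by norm_num),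
    pow_one, if_true, show (2 : ℕ) ≠ 1 by norm_num, if_false, show 2 - 1 = 1 by norm_num,
    add_sub_cancel_left] at key
  rw [show c / aT α b c lam T * (Real.exp (-lam * t) * t ^ (α - 1)) =
    Real.exp (-lam * t) * (c / aT α b c lam T) * t ^ (α - 1) by ring]
  refine key.congr' ?_
  filter_upwards [eventually_incr_mem s t hs ht] with d ⟨hd, h1, h2⟩
  rw [H.integral_incr_one hd.le h1 (by linarith), H.integral_incr_one hd.le h2 hst, sq]

/-- The leading coefficient of the covariance of two increments is positive: the kernel at the gap
`t < T` exceeds `b ≤ 1` times the kernel at `T`. -/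
lemma mul_lt_kern (hT0 : 0 < T) (hb1 : b ≤ 1) (hc : 0 < c) (hα1 : α ≤ 1)
    (hlam : (α - 1) / T < lam) {t : ℝ} (ht : 0 < t) (htT : t < T) :
    b * Real.exp (-lam * T) * T ^ (α - 1) < Real.exp (-lam * t) * t ^ (α - 1) := by
  have h := kern_strictAntiOn hc hT0 hα1 hlam ⟨ht, htT.le⟩ ⟨hT0, le_rfl⟩ htT
  rw [kern_of_pos ht, kern_of_pos hT0, mul_assoc, mul_assoc, mul_lt_mul_iff_right₀ hc] at h
  refine lt_of_le_of_lt ?_ h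
  rw [mul_assoc]
  exact mul_le_of_le_one_left (by positivity) hb1

lemma HasIncrementMoments.tendsto_covariance_incr [IsProbabilityMeasure P]
    (H : HasIncrementMoments hT α b c lam X P) (hT0 : 0 < T) (hb : 0 < b) (hb1 : b ≤ 1)
    (hc : 0 < c) (hα0 : 0 < α) (hα1 : α ≤ 1) (hlam : (α - 1) / T < lam) {s t : ℝ} (hs : 0 < s)
    (ht : 0 < t) (hst : s + t ≤ T) :
    Tendsto (fun d : ℝ => cov[incr X d s, incr X d (s + t); P] /
      (aT α b c lam T * c * d ^ 2 *
        (Real.exp (-lam * t) * t ^ (α - 1) - b * Real.exp (-lam * T) * T ^ (α - 1))))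
      (𝓝[>] 0) (𝓝 1) := by
  have haT : 0 < aT α b c lam T := by rw [aT_eq b T hT0]; exact mul_pos hb (kern_pos hc hT0)
  have hlt := mul_lt_kern (b := b) hT0 hb1 hc hα1 hlam ht (by linarith)
  have haT' : aT α b c lam T = c * (b * Real.exp (-lam * T) * T ^ (α - 1)) := by rw [aT]; ring
  have h1 := ((H.tendsto_integral_incr_mul_incr hT0 hb hc hα0 hα1 hlam hs ht hst).sub_const
    1).mul_const (aT α b c lam T /
      (c * (Real.exp (-lam * t) * t ^ (α - 1) - b * Real.exp (-lam * T) * T ^ (α - 1))))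
  generalize Real.exp (-lam * t) * t ^ (α - 1) = G at *
  generalize b * Real.exp (-lam * T) * T ^ (α - 1) = B at *
  have hG : G - B ≠ 0 := (sub_pos.2 hlt).ne'
  have hB : B ≠ 0 := by rintro rfl; simp [haT'] at haT
  have e : (c / aT α b c lam T * G - 1) * (aT α b c lam T / (c * (G - B))) = 1 := by
    rw [haT']; field_simp
  rw [e] at h1
  refine h1.congr' ?_
  filter_upwards [eventually_incr_mem s t hs ht] with d ⟨hd, hd1, hd2⟩
  rw [covariance_eq_sub (H.memLp_incr hd.le hd1 (by linarith)) (H.memLp_incr hd.le hd2 hst),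
    H.integral_incr_one hd.le hd1 (by linarith), H.integral_incr_one hd.le hd2 hst]
  simp only [Pi.mul_apply]
  field_simp

/-- The ratio of the leading term of the variance of a short increment to the variance. If
`α = 1` both terms have the same order, and the condition on `λ` keeps their difference
positive. -/
lemma tendsto_variance_factor (hT0 : 0 < T) (hb1 : b ≤ 1) (hα0 : 0 < α) (hα1 : α ≤ 1)
    (hlam : (α - 1) / T < lam) :
    Tendsto (fun d : ℝ =>
      (2 / (α * (α + 1)) * d ^ (α - 1) - b * Real.exp (-lam * T) * T ^ (α - 1)) /
      (2 * (∫ x in (0 : ℝ)..1, ∫ y in (0 : ℝ)..x, Real.exp (-lam * d * y) * y ^ (α - 1)) *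
        d ^ (α - 1) - b * Real.exp (-lam * T) * T ^ (α - 1))) (𝓝[>] 0) (𝓝 1) := by
  -- Multiplying numerator and denominator by `d^{1-α}` leaves quantities with finite limits.
  obtain ⟨l, hl, hne⟩ : ∃ l, Tendsto (fun d : ℝ => d ^ (1 - α)) (𝓝[>] 0) (𝓝 l) ∧
      2 / (α * (α + 1)) - b * Real.exp (-lam * T) * T ^ (α - 1) * l ≠ 0 := by
    rcases hα1.lt_or_eq with h | rfl
    · refine ⟨0, ?_, ?_⟩
      · have := (Real.continuousAt_rpow_const 0 (1 - α) (Or.inr (sub_nonneg.2 hα1))).tendsto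
        rw [Real.zero_rpow (sub_pos.2 h).ne'] at this
        exact this.mono_left nhdsWithin_le_nhds
      · rw [mul_zero, sub_zero]; positivity
    · refine ⟨1, by simp, ne_of_gt ?_⟩
      have hl0 : 0 < lam := by simpa using hlam
      have h1 : Real.exp (-lam * T) < 1 := by
        rw [Real.exp_lt_one_iff]; nlinarith
      have := mul_le_of_le_one_left (Real.exp_pos (-lam * T)).le hb1
      norm_num
      simp only [neg_mul] at *
      linarith
  have hI := (tendsto_integral_exp_mul_rpow (lam := lam) hα0).const_mul 2
  rw [show 2 * (1 / (α * (α + 1))) = 2 / (α * (α + 1)) by ring] at hI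
  have hB := hl.const_mul (b * Real.exp (-lam * T) * T ^ (α - 1))
  have h := (hB.const_sub (2 / (α * (α + 1)))).div (hI.sub hB) hne
  rw [div_self hne] at h
  refine h.congr' ?_
  filter_upwards [self_mem_nhdsWithin] with d hd
  have hd' : (0 : ℝ) < d ^ (1 - α) := Real.rpow_pos_of_pos hd _
  have e : ∀ K : ℝ, K * d ^ (α - 1) * d ^ (1 - α) = K := fun K => by
    rw [mul_assoc, ← Real.rpow_add hd, sub_add_sub_cancel, sub_self, Real.rpow_zero, mul_one]
  rw [Pi.div_apply, ← mul_div_mul_right (2 / (α * (α + 1)) * d ^ (α - 1) - _) _ hd'.ne',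
    sub_mul, sub_mul, e, e]

lemma HasIncrementMoments.tendsto_corr_incr [IsProbabilityMeasure P]
    (H : HasIncrementMoments hT α b c lam X P) (hT0 : 0 < T) (hb : 0 < b) (hb1 : b ≤ 1)
    (hc : 0 < c) (hα0 : 0 < α) (hα1 : α ≤ 1) (hlam : (α - 1) / T < lam) {s t : ℝ} (hs : 0 < s)
    (ht : 0 < t) (hst : s + t ≤ T) :
    Tendsto (fun d : ℝ => corr (incr X d s) (incr X d (s + t)) P /
      ((Real.exp (-lam * t) * t ^ (α - 1) - b * Real.exp (-lam * T) * T ^ (α - 1)) /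
        (2 / (α * (α + 1)) * d ^ (α - 1) - b * Real.exp (-lam * T) * T ^ (α - 1))))
      (𝓝[>] 0) (𝓝 1) := by
  have h := (H.tendsto_covariance_incr hT0 hb hb1 hc hα0 hα1 hlam hs ht hst).mul
    (tendsto_variance_factor hT0 hb1 hα0 hα1 hlam)
  rw [one_mul] at h
  refine h.congr' ?_
  filter_upwards [eventually_incr_mem s t hs ht] with d ⟨hd, hd1, hd2⟩
  -- Both increments have the same variance, so the product of the standard
  -- deviations is that variance.
  have hv := H.variance_incr hα0 hd hd1 (by linarith)
  rw [corr, H.variance_incr hα0 hd hd2 hst, ← hv, Real.mul_self_sqrt (variance_nonneg _ _), hv]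
  simp only [div_eq_mul_inv, mul_inv, inv_inv]
  ring

end

end GBP

theorem corollary3p2 {α b c lam T : ℝ}
    (hT : 0 < T) (hb0 : 0 < b) (hb1 : b ≤ 1) (hα0 : 0 < α) (hα1 : α ≤ 1)
    (hc0 : 0 < c) (hc1 : c < 2 ^ (α - 1)) (hlam : (α - 1) / T < lam)
    {Ω' : ℕ → Type*} [∀ n, MeasurableSpace (Ω' n)] (P' : ∀ n, Measure (Ω' n))
    [∀ n, IsProbabilityMeasure (P' n)]
    (ξ : ∀ n, ℕ → Ω' n → ℝ)
    (hξ : ∀ᶠ n in atTop, GBP.IsGBP (GBP.tempered c lam α n) b ⌊(n : ℝ) * T⌋₊ (ξ n) (P' n))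
    {Ω : Type*} [MeasurableSpace Ω] (P : Measure Ω) [IsProbabilityMeasure P]
    (X : Ω → SkorokhodSpace T)
    (hX : TendstoInDistribution (fun n => GBP.walk α T n (ξ n)) atTop X P' P) :
    -- (i)
    (∀ t, 0 < t → t ≤ T →
      (∀ k : ℕ, Integrable (fun ω => GBP.at_ X t ω ^ k) P) ∧
      ∫ ω, GBP.at_ X t ω ∂P = t * GBP.aT α b c lam T ∧
      ∀ k : ℕ, 2 ≤ k →
        ∫ ω, GBP.at_ X t ω ^ k ∂P =
          t ^ (α * ((k : ℝ) - 1) + 1) *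
            (GBP.aT α b c lam T * (k.factorial : ℝ) * GBP.nu α c ^ (k - 1) /
              Real.Gamma (((k : ℝ) - 1) * α)) *
            ∫ x in (0 : ℝ)..1, ∫ y in (0 : ℝ)..x,
              Real.exp (-lam * t * y) * y ^ (α * ((k : ℝ) - 1) - 1)) ∧
    -- (ii)
    (∀ t s, 0 < t → t < s → s ≤ T →
      Integrable (fun ω => GBP.at_ X t ω * GBP.at_ X s ω) P ∧
      ∫ ω, GBP.at_ X t ω * GBP.at_ X s ω ∂P =
        s ^ (α + 1) * c * GBP.aT α b c lam T *
            (∫ x₂ in (t / s)..1, ∫ x₁ in (0 : ℝ)..(t / s),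
              (x₂ - x₁) ^ (α - 1) * Real.exp (-lam * s * (x₂ - x₁))) +
          t ^ (α + 1) * (2 * c * GBP.aT α b c lam T) *
            (∫ x in (0 : ℝ)..1, ∫ y in (0 : ℝ)..x, Real.exp (-lam * t * y) * y ^ (α - 1)) ∧
      cov[GBP.at_ X t, GBP.at_ X s; P] =
        s ^ (α + 1) * c * GBP.aT α b c lam T *
            (∫ x₂ in (t / s)..1, ∫ x₁ in (0 : ℝ)..(t / s),
              (x₂ - x₁) ^ (α - 1) * Real.exp (-lam * s * (x₂ - x₁))) +
          t ^ (α + 1) * (2 * c * GBP.aT α b c lam T) *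
            (∫ x in (0 : ℝ)..1, ∫ y in (0 : ℝ)..x, Real.exp (-lam * t * y) * y ^ (α - 1)) -
          t * s * GBP.aT α b c lam T ^ 2) ∧
    -- (iii)
    (∀ s t, 0 < s → 0 < t → s + t ≤ T →
      Tendsto (fun d : ℝ =>
          (∫ ω, GBP.incr X d s ω * GBP.incr X d (s + t) ω ∂P) /
            (GBP.aT α b c lam T * c * d ^ 2 * (Real.exp (-lam * t) * t ^ (α - 1))))
        (𝓝[>] 0) (𝓝 1) ∧
      Tendsto (fun d : ℝ =>
          cov[GBP.incr X d s, GBP.incr X d (s + t); P] /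
            (GBP.aT α b c lam T * c * d ^ 2 *
              (Real.exp (-lam * t) * t ^ (α - 1) - b * Real.exp (-lam * T) * T ^ (α - 1))))
        (𝓝[>] 0) (𝓝 1) ∧
      Tendsto (fun d : ℝ =>
          GBP.corr (GBP.incr X d s) (GBP.incr X d (s + t)) P /
            ((Real.exp (-lam * t) * t ^ (α - 1) - b * Real.exp (-lam * T) * T ^ (α - 1)) /
              (2 / (α * (α + 1)) * d ^ (α - 1) - b * Real.exp (-lam * T) * T ^ (α - 1))))
        (𝓝[>] 0) (𝓝 1)) ∧
    -- (iv)
    (∀ (m : ℕ), 1 ≤ m → ∀ (t : ℕ → ℝ) (k : ℕ → ℕ),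
      0 < t 1 → (∀ i ∈ Finset.Icc 2 m, t (i - 1) < t i) → t m ≤ T →
      (∀ i ∈ Finset.Icc 1 m, 1 ≤ k i) →
      Tendsto (fun d : ℝ =>
          (∫ ω, ∏ i ∈ Finset.Icc 1 m, GBP.incr X d (t i) ω ^ k i ∂P) /
            ∏ i ∈ Finset.Icc 1 m, ∫ ω, GBP.incr X d (t i) ω ^ k i ∂P)
        (𝓝[>] 0)
        (𝓝 (Real.exp (-lam * (t m - t 1)) * (c / GBP.aT α b c lam T) ^ (m - 1) *
          ∏ i ∈ Finset.Icc 2 m, (t i - t (i - 1)) ^ (α - 1)))) := by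
  have H : GBP.HasIncrementMoments hT.le α b c lam X P :=
    { clamp_zero := (ae_mem_incrPaths hT.le hX
        (hξ.mono fun _ hn => hn.walk_mem_incrPaths hT.le)).mono fun ω hω => hω.1
      integrable_prod := fun s u v k =>
        (GBP.integrable_prod_incr hT hα0 hα1 hc0.le hb0.le hξ hX s u v k).1
      integral_prod := fun J k i m hJ hJ' J₀ l hl =>
        GBP.integral_prod_incr hT hα0 hα1 hc0.le hb0.le hξ hX J k i m hJ hJ' hl }
  have haT : 0 < GBP.aT α b c lam T := by
    rw [GBP.aT_eq b T hT]; exact mul_pos hb0 (GBP.kern_pos hc0 hT)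
  refine ⟨fun t ht htT => ⟨H.integrable_at_pow ⟨ht.le, htT⟩, H.integral_at ⟨ht.le, htT⟩,
    fun k hk => H.integral_at_pow_eq hα0 ht htT hk⟩, fun t s ht hts hsT => ?_,
    fun s t hs ht hst => ⟨?_, H.tendsto_covariance_incr hT hb0 hb1 hc0 hα0 hα1 hlam hs ht hst,
      H.tendsto_corr_incr hT hb0 hb1 hc0 hα0 hα1 hlam hs ht hst⟩,
    H.tendsto_ratio hT hb0 hc0 hα0 hα1 hlam⟩
  · have ht' : t ∈ Icc 0 T := ⟨ht.le, hts.le.trans hsT⟩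
    have hs' : s ∈ Icc 0 T := ⟨(ht.trans hts).le, hsT⟩
    have h := H.at_mul_at hα0 ht hts hsT
    refine ⟨h.1, h.2, ?_⟩
    rw [covariance_eq_sub (H.memLp_at ht') (H.memLp_at hs'), H.integral_at ht', H.integral_at hs']
    simp only [Pi.mul_apply]
    rw [h.2]
    ring
  · have hG : 0 < Real.exp (-lam * t) * t ^ (α - 1) := by positivity
    have h := (H.tendsto_integral_incr_mul_incr hT hb0 hc0 hα0 hα1 hlam hs ht hst).mul_const
      (GBP.aT α b c lam T / (c * (Real.exp (-lam * t) * t ^ (α - 1))))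
    generalize Real.exp (-lam * t) * t ^ (α - 1) = G at *
    have e : c / GBP.aT α b c lam T * G * (GBP.aT α b c lam T / (c * G)) = 1 := by field_simp
    rw [e] at h
    refine h.congr fun d => ?_
    rcases eq_or_ne d 0 with rfl | hd
    · simp
    · field_simp
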